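/- Let $(M,g)$ be a compact Riemannian manifold with boundary, of dimension $d\ge 1$, and let $0\le k,m\le d$. Let $\Omega^{k,m}(M)$ be the space of double forms, the smooth sections of $\Lambda^{k,m}T^*M=\Lambda^kT^*M\otimes\Lambda^mT^*M$ (zero if $k<0$ or $m<0$); transposition $\psi\mapsto\psi^T$ exchanges the two factors. Let $d^\nabla:\Omega^{k,m}\to\Omega^{k+1,m}$ be the exterior covariant derivative and $\delta^\nabla:\Omega^{k,m}\to\Omega^{k-1,m}$ the covariant codifferential defined by the Levi-Civita connection, $d^\nabla_V\psi=(d^\nabla\psi^T)^T$, $\delta^\nabla_V\psi=(\delta^\nabla\psi^T)^T$. Let $D:\Lambda^{k,m}T^*M\to\Lambda^{k+1,m+1}T^*M$ and $S:\Lambda^{k,m}T^*M\to\Lambda^{k+1,m-1}T^*M$ (for all $k,m$) be smooth bundle maps with metric duals $D^*$, $S^*$, such that $D\psi^T=(D\psi)^T$ and $S\psi=(S^*\psi^T)^T$, and put $$\mathbf H=\tfrac12(d^\nabla_Vd^\nabla+d^\nabla d^\nabla_V)+D,\qquad \mathbf H^*=\tfrac12(\delta^\nabla\delta^\nabla_V+\delta^\nabla_V\delta^\nabla)+D^*,$$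 $$\mathbf F=\tfrac12(d^\nabla\delta^\nabla_V+\delta^\nabla_Vd^\nabla)+S,\qquad \mathbf F^*=\tfrac12(d^\nabla_V\delta^\nabla+\delta^\nabla d^\nabla_V)+S^*,$$ $$\mathbf B=\mathbf H\mathbf H^*+\mathbf H^*\mathbf H+\mathbf F^*\mathbf F+\mathbf F\mathbf F^*.$$ Let $j:\partial M\to M$ be the inclusion, $g_0=j^*g$, $\partial_r$ the inward unit normal and $dr$ its dual covector. Let $\mathbb P^{tt},\mathbb P^{nt},\mathbb P^{tn},\mathbb P^{nn}$ map $\psi\in\Omega^{k,m}(M)$ to the pullbacks to $\partial M$ (in both factors) of $\psi$, $i_{\partial_r}\psi$, $i^V_{\partial_r}\psi$, $i_{\partial_r}i^V_{\partial_r}\psi$, where $i_X^V\psi=(i_X\psi^T)^T$. With $d^0,d^0_V,\delta^0,\delta^0_V$ denoting the corresponding operators of $(\partial M,g_0)$, put $$\mathfrak T=\tfrac12(\mathbb P^{nt}d^\nabla-d^0\mathbb P^{nt})+\tfrac12(\mathbb P^{tn}d^\nabla_V-d^0_V\mathbb P^{tn}),\qquad \mathfrak T^*=-\tfrac12(\mathbb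 P^{tn}\delta^\nabla+\delta^0\mathbb P^{tn})-\tfrac12(\mathbb P^{nt}\delta^\nabla_V+\delta^0_V\mathbb P^{nt}),$$ $$\mathfrak F^*=\tfrac12(\mathbb P^{nn}d^\nabla_V-d^0_V\mathbb P^{nn})-\tfrac12(\mathbb P^{tt}\delta^\nabla+\delta^0\mathbb P^{tt}),\qquad \mathfrak F=\tfrac12(\mathbb P^{nn}d^\nabla-d^0\mathbb P^{nn})-\tfrac12(\mathbb P^{tt}\delta^\nabla_V+\delta^0_V\mathbb P^{tt}).$$ A boundary-value problem on $\Omega^{k,m}(M)$, given by $A:\Omega^{k,m}(M)\to\Omega^{k,m}(M)$ of order $a$ and boundary operators $B_j:\Omega^{k,m}(M)\to\Gamma(\mathbb F_j)$, $j=1,\dots,l$, of orders less than $a$, is called regular elliptic in the sense of Lopatinskij–Shapiro if the following hold, with $P_L$ the principal symbol of $L=\sum_\alpha a_\alpha D^\alpha$, $D_j=-\imath\partial_j$: 1. for all $(x,\xi)\in T^*M$, $P_A(x,\xi)$ is an isomorphism of $\Lambda^{k,m}T_x^*M$ if and only if $\xi\ne0$; 2. for all $x\in\partial M$ and all $0\ne\xi\in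 T^*_xM$ with $\xi(\partial_r)=0$, the map $\sigma\mapsto\bigl(P_{B_j}(x,\xi+\imath\partial_s\,dr)\sigma(0)\bigr)_{j}$ is a linear isomorphism from the space of smooth $\sigma:\mathbb R\to\mathbb C\otimes\Lambda^{k,m}T^*_xM$ that are bounded on $[0,\infty)$ and satisfy $P_A(x,\xi+\imath\partial_s\,dr)\sigma=0$ onto $\mathbb C\otimes\bigoplus_j\mathbb F_j|_x$. Here $P_L(x,\xi+\imath\partial_s\,dr)$ is obtained by substituting $\imath\partial_s$ for $t$ in the polynomial $P_L(x,\xi+t\,dr)$. Theorem. The operator $\mathbf B$ on $\Omega^{k,m}(M)$ (of order $4$) forms a regular elliptic boundary-value problem with each of the following four sets of boundary operators, of orders $0,0,0,1,1,1,2,3$: $$\begin{aligned} \mathrm{TT}:&\quad(\mathbb P^{tt},\mathbb P^{tn},\mathbb P^{nt},\mathfrak T,\mathfrak F^*,\mathfrak F,\mathbb P^{tt}\mathbf H^*,\mathfrak T\mathbf H^*),\\ \mathrm{NN}:&\quad(\mathbb P^{nn},\mathbb P^{tn},\mathbb P^{nt},\mathfrak T^*,\mathfrak F^*,\mathfrak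 F,\mathbb P^{nn}\mathbf H,\mathfrak T^*\mathbf H),\\ \mathrm{NT}:&\quad(\mathbb P^{nt},\mathbb P^{nn},\mathbb P^{tt},\mathfrak F^*,\mathfrak T,\mathfrak T^*,\mathbb P^{nt}\mathbf F,\mathfrak F^*\mathbf F),\\ \mathrm{TN}:&\quad(\mathbb P^{tn},\mathbb P^{nn},\mathbb P^{tt},\mathfrak F,\mathfrak T,\mathfrak T^*,\mathbb P^{tn}\mathbf F^*,\mathfrak F\mathbf F^*). \end{aligned}$$ Each operator takes values in double forms on $\partial M$: $\mathbb P^{tt},\mathfrak T,\mathbb P^{nn}\mathbf H,\mathfrak T^*\mathbf H$ in $\Omega^{k,m}(\partial M)$; $\mathbb P^{nt},\mathfrak F^*,\mathbb P^{tn}\mathbf F^*,\mathfrak F\mathbf F^*$ in $\Omega^{k-1,m}(\partial M)$; $\mathbb P^{tn},\mathfrak F,\mathbb P^{nt}\mathbf F,\mathfrak F^*\mathbf F$ in $\Omega^{k,m-1}(\partial M)$; $\mathbb P^{nn},\mathfrak T^*,\mathbb P^{tt}\mathbf H^*,\mathfrak T\mathbf H^*$ in $\Omega^{k-1,m-1}(\partial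 M)$. -/

import Mathlib

open scoped Manifold ContDiff
open Set

set_option maxSynthPendingDepth 3

noncomputable section

namespace DoubleForms

/-! ### Linear algebra of double forms -/

/-- The model space `ℝᵈ`. -/
abbrev Euc (d : ℕ) : Type := EuclideanSpace ℝ (Fin d)

/-- Double forms `ψ(X₁,…,X_k ; Y₁,…,Y_m)` of type `(k,m)` on a real vector space `V`, with
coefficients in `F`: the space `Λᵏ V* ⊗ Λᵐ V* ⊗ F`.  `F = ℝ` gives double forms, `F = ℂ` gives
complexified double forms. -/
abbrev DForm (V : Type*) [AddCommGroup V] [Module ℝ V] [TopologicalSpace V]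
    (F : Type*) [NormedAddCommGroup F] [NormedSpace ℝ F] (k m : ℕ) : Type _ :=
  V [⋀^Fin k]→L[ℝ] (V [⋀^Fin m]→L[ℝ] F)

section Fiber

variable {V : Type*} [AddCommGroup V] [Module ℝ V] [TopologicalSpace V]
variable {W : Type*} [AddCommGroup W] [Module ℝ W] [TopologicalSpace W]
variable {F : Type*} [NormedAddCommGroup F] [NormedSpace ℝ F]
variable {F' : Type*} [NormedAddCommGroup F'] [NormedSpace ℝ F']
variable {k m k' m' : ℕ}

/-- Pullback of double forms along `A : V → W`, in both the form part and the vector part. -/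
def pull [ContinuousSMul ℝ V] [ContinuousSMul ℝ W] (A : V →L[ℝ] W) :
    DForm W F k m →L[ℝ] DForm V F k m :=
  (ContinuousLinearMap.compContinuousAlternatingMapCLM ℝ V _ _ (Fin k)
    (ContinuousAlternatingMap.compContinuousLinearMapCLM A)) ∘L
  (ContinuousAlternatingMap.compContinuousLinearMapCLM A)

/-- Change of coefficients. -/
def mapCoeff [ContinuousSMul ℝ V] (c : F →L[ℝ] F') : DForm V F k m →L[ℝ] DForm V F' k m :=
  ContinuousLinearMap.compContinuousAlternatingMapCLM ℝ V _ _ (Fin k)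
    (ContinuousLinearMap.compContinuousAlternatingMapCLM ℝ V _ _ (Fin m) c)

/-- Complex-linear extension of a real linear map between spaces of double forms:
`ψ ↦ T (Re ψ) + i T (Im ψ)`. -/
def cplx [ContinuousSMul ℝ V] (T : DForm V ℝ k m →L[ℝ] DForm V ℝ k' m') :
    DForm V ℂ k m →L[ℝ] DForm V ℂ k' m' :=
  mapCoeff Complex.ofRealCLM ∘L T ∘L mapCoeff Complex.reCLM +
  mapCoeff (Complex.I • Complex.ofRealCLM) ∘L T ∘L mapCoeff Complex.imCLM

/-- The inner product of two double forms, computed in an orthonormal basis `b`. -/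
def formInner {d : ℕ} (b : Fin d → V) (ψ χ : DForm V ℝ k m) : ℝ :=
  ((k.factorial : ℝ) * (m.factorial : ℝ))⁻¹ * ∑ I : Fin k → Fin d, ∑ J : Fin m → Fin d,
    ψ (fun i => b (I i)) (fun j => b (J j)) * χ (fun i => b (I i)) (fun j => b (J j))

end Fiber

section Normed

variable {V : Type*} [NormedAddCommGroup V] [NormedSpace ℝ V]
variable {k m : ℕ}

/-- Transposition `ψᵀ(Y ; X) = ψ(X ; Y)`. -/
def transp : DForm V ℂ k m →L[ℝ] DForm V ℂ m k :=
  let ev : V [⋀^Fin m]→L[ℝ] ((V [⋀^Fin m]→L[ℝ] ℂ) →L[ℝ] ℂ) :=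
    ContinuousLinearMap.flipAlternating (ContinuousLinearMap.id ℝ (V [⋀^Fin m]→L[ℝ] ℂ))
  let post : DForm V ℂ k m →L[ℝ] ((V [⋀^Fin m]→L[ℝ] ℂ) →L[ℝ] ℂ) →L[ℝ] (V [⋀^Fin k]→L[ℝ] ℂ) :=
    (ContinuousLinearMap.compContinuousAlternatingMapCLM ℝ V (V [⋀^Fin m]→L[ℝ] ℂ) ℂ (Fin k)).flip
  (ContinuousLinearMap.compContinuousAlternatingMapCLM ℝ V
    ((V [⋀^Fin m]→L[ℝ] ℂ) →L[ℝ] ℂ) (V [⋀^Fin k]→L[ℝ] ℂ) (Fin m)).flip ev ∘L post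

theorem transp_apply (ψ : DForm V ℂ k m) (X : Fin k → V) (Y : Fin m → V) :
    transp ψ Y X = ψ X Y := rfl

/-- Interior product `i_v` with the form part. -/
def intForm (v : V) (ψ : DForm V ℂ (k + 1) m) : DForm V ℂ k m := ψ.curryLeft v

/-- Interior product `i_v^V = (i_v (·)ᵀ)ᵀ` with the vector part. -/
def intVec (v : V) (ψ : DForm V ℂ k (m + 1)) : DForm V ℂ k m :=
  transp (intForm v (transp ψ))

/-- The action of endomorphisms by derivations, as a linear map in the endomorphism `A`:
`(A · ψ)(X ; Y) = ∑ᵢ ψ(X₁,…,A Xᵢ,…,X_k ; Y) + ∑ⱼ ψ(X ; Y₁,…,A Yⱼ,…,Y_m)`. -/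
def derivAct (ψ : DForm V ℂ k m) : (V →L[ℝ] V) →L[ℝ] DForm V ℂ k m :=
  ψ.fderivCompContinuousLinearMap (ContinuousLinearMap.id ℝ V) +
  transp ∘L (transp ψ).fderivCompContinuousLinearMap (ContinuousLinearMap.id ℝ V)

theorem derivAct_apply (ψ : DForm V ℂ k m) (A : V →L[ℝ] V) (X : Fin k → V) (Y : Fin m → V) :
    derivAct ψ A X Y = ∑ i, ψ (Function.update X i (A (X i))) Y +
      ∑ j, ψ X (Function.update Y j (A (Y j))) := by
  have key : ∀ {r : ℕ} (Z : Fin r → V) (i : Fin r),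
      (fun j => Function.update (fun _ => ContinuousLinearMap.id ℝ V) i A j (Z j)) =
        Function.update Z i (A (Z i)) := by
    intro r Z i
    funext j
    by_cases h : j = i
    · subst h; simp
    · simp [Function.update_of_ne h]
  simp only [derivAct, _root_.add_apply, ContinuousAlternatingMap.add_apply,
    ContinuousLinearMap.comp_apply, transp_apply,
    ContinuousAlternatingMap.fderivCompContinuousLinearMap_apply, key]
  simp [ContinuousAlternatingMap.sum_apply, transp_apply]

end Normed

/-- An element of the graded fibre `⊕_{k,m} ℂ ⊗ Λ^{k,m}`. -/
abbrev GForm (d : ℕ) : Type := ∀ k m : ℕ, DForm (Euc d) ℂ k m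

/-- A graded double form `ψ = (ψ_{k,m})`, in a coordinate chart.  Coefficients are complex: all
operators below are the complex-linear extensions of the corresponding operators on real double
forms, so that their symbols act on the complexified fibres. -/
abbrev DField (d : ℕ) : Type := ∀ k m : ℕ, Euc d → DForm (Euc d) ℂ k m

/-- The value of a graded double form at a point. -/
def evalAt {d : ℕ} (ψ : DField d) (y : Euc d) : GForm d := fun k m => ψ k m y

/-! ### First order operators in a coordinate domain

Throughout, `G` is the matrix-valued function of metric coefficients of a Riemannian metric on a
coordinate domain, and derivatives are taken within a set `s`, which is a half-space in the charts
of a manifold with boundary and the whole space in the charts of its boundary. -/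

section Local

variable {d : ℕ}

/-- Metric coefficients on a coordinate domain. -/
abbrev MetricField (d : ℕ) : Type := Euc d → Euc d →L[ℝ] Euc d →L[ℝ] ℝ

/-- The musical isomorphism from covectors to vectors. -/
def sharp (G : MetricField d) (y : Euc d) (α : Euc d →L[ℝ] ℝ) : Euc d :=
  ContinuousLinearMap.inverse (G y) α

/-- The covector `w ↦ ½ (∂_u G(v,w) + ∂_v G(u,w) - ∂_w G(u,v))`, bilinear in `(u,v)`. -/
def koszul (G : MetricField d) (s : Set (Euc d)) (y : Euc d) :
    Euc d →L[ℝ] Euc d →L[ℝ] Euc d →L[ℝ] ℝ :=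
  let DG : Euc d →L[ℝ] Euc d →L[ℝ] Euc d →L[ℝ] ℝ := fderivWithin ℝ G s y
  let flip : (Euc d →L[ℝ] Euc d →L[ℝ] ℝ) →L[ℝ] (Euc d →L[ℝ] Euc d →L[ℝ] ℝ) :=
    (ContinuousLinearMap.flipₗᵢ ℝ (Euc d) (Euc d) ℝ).toContinuousLinearEquiv
  (1 / 2 : ℝ) • (DG + DG.flip - flip ∘L DG.flip)

theorem koszul_apply (G : MetricField d) (s : Set (Euc d)) (y u v w : Euc d) :
    koszul G s y u v w = (1 / 2) * (fderivWithin ℝ G s y u v w + fderivWithin ℝ G s y v u w -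
      fderivWithin ℝ G s y w u v) := rfl

/-- Christoffel symbols of the Levi-Civita connection: `∇_u v = ∂_u v + Γ(u,v)`. -/
def christoffel (G : MetricField d) (s : Set (Euc d)) (y : Euc d) :
    Euc d →L[ℝ] Euc d →L[ℝ] Euc d :=
  (ContinuousLinearMap.compL ℝ (Euc d) (Euc d →L[ℝ] ℝ) (Euc d)
    (ContinuousLinearMap.inverse (G y))) ∘L koszul G s y

/-- The Levi-Civita connection on double forms:
`(∇_u ψ)(X ; Y) = ∂_u ψ(X ; Y) - ∑ᵢ ψ(…,Γ(u,Xᵢ),… ; Y) - ∑ⱼ ψ(X ; …,Γ(u,Yⱼ),…)`. -/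
def covDeriv (G : MetricField d) (s : Set (Euc d)) {k m : ℕ}
    (ψ : Euc d → DForm (Euc d) ℂ k m) (y : Euc d) : Euc d →L[ℝ] DForm (Euc d) ℂ k m :=
  fderivWithin ℝ ψ s y - derivAct (ψ y) ∘L christoffel G s y

/-- Pointwise transposition. -/
def transpose (ψ : DField d) : DField d := fun k m y => transp (ψ m k y)

/-- The exterior covariant derivative
`(dψ)(X₁,…,X_{k+1} ; Y) = ∑ᵢ (-1)^{i+1} (∇_{Xᵢ} ψ)(X₁,…,X̂ᵢ,…,X_{k+1} ; Y)`. -/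
def extD (G : MetricField d) (s : Set (Euc d)) (ψ : DField d) : DField d
  | 0, _ => 0
  | k + 1, m => fun y => ContinuousAlternatingMap.alternatizeUncurryFin (covDeriv G s (ψ k m) y)

/-- The covariant codifferential `δψ = - ∑ⱼ i_{(dxʲ)♯} ∇_{∂ⱼ} ψ`, the negative metric contraction
of the derivative slot of `∇ψ` with the first form slot. -/
def coD (G : MetricField d) (s : Set (Euc d)) (ψ : DField d) : DField d := fun k m y =>
  -∑ j : Fin d, intForm (sharp G y (EuclideanSpace.proj j))
    (covDeriv G s (ψ (k + 1) m) y (EuclideanSpace.single j 1))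

/-- `d_V ψ = (d ψᵀ)ᵀ`. -/
def extDV (G : MetricField d) (s : Set (Euc d)) (ψ : DField d) : DField d :=
  transpose (extD G s (transpose ψ))

/-- `δ_V ψ = (δ ψᵀ)ᵀ`. -/
def coDV (G : MetricField d) (s : Set (Euc d)) (ψ : DField d) : DField d :=
  transpose (coD G s (transpose ψ))

end Local

/-! ### Second order operators and the double bilaplacian -/

/-- The geometric data on a coordinate domain of a `d = n + 1` dimensional manifold with boundary:
metric coefficients and the tensorial operators `D`, `D*`, `S`, `S*`. -/
structure LocalData (n : ℕ) where
  /-- metric coefficients -/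
  G : MetricField (n + 1)
  /-- `D : Λ^{k,m} → Λ^{k+1,m+1}` -/
  D : ∀ k m : ℕ, Euc (n + 1) →
    DForm (Euc (n + 1)) ℝ k m →L[ℝ] DForm (Euc (n + 1)) ℝ (k + 1) (m + 1)
  /-- `D* : Λ^{k+1,m+1} → Λ^{k,m}` -/
  Dst : ∀ k m : ℕ, Euc (n + 1) →
    DForm (Euc (n + 1)) ℝ (k + 1) (m + 1) →L[ℝ] DForm (Euc (n + 1)) ℝ k m
  /-- `S : Λ^{k,m+1} → Λ^{k+1,m}` -/
  S : ∀ k m : ℕ, Euc (n + 1) →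
    DForm (Euc (n + 1)) ℝ k (m + 1) →L[ℝ] DForm (Euc (n + 1)) ℝ (k + 1) m
  /-- `S* : Λ^{k+1,m} → Λ^{k,m+1}` -/
  Sst : ∀ k m : ℕ, Euc (n + 1) →
    DForm (Euc (n + 1)) ℝ (k + 1) m →L[ℝ] DForm (Euc (n + 1)) ℝ k (m + 1)

namespace LocalData

variable {n : ℕ} (L : LocalData n)

/-- The closed half-space `{x | 0 ≤ x₀}` on which charts of manifolds with boundary are modelled. -/
abbrev halfSpace (n : ℕ) : Set (Euc (n + 1)) := range (𝓡∂ (n + 1))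

/-- `d` -/
def d : DField (n + 1) → DField (n + 1) := extD L.G (halfSpace n)
/-- `d_V` -/
def dV : DField (n + 1) → DField (n + 1) := extDV L.G (halfSpace n)
/-- `δ` -/
def δ : DField (n + 1) → DField (n + 1) := coD L.G (halfSpace n)
/-- `δ_V` -/
def δV : DField (n + 1) → DField (n + 1) := coDV L.G (halfSpace n)

/-- The zero order operator `D : Ω^{k,m} → Ω^{k+1,m+1}`. -/
def opD (ψ : DField (n + 1)) : DField (n + 1)
  | 0, _ => 0
  | _ + 1, 0 => 0
  | k + 1, m + 1 => fun y => cplx (L.D k m y) (ψ k m y)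

/-- The zero order operator `D* : Ω^{k,m} → Ω^{k-1,m-1}`. -/
def opDst (ψ : DField (n + 1)) : DField (n + 1) := fun k m y =>
  cplx (L.Dst k m y) (ψ (k + 1) (m + 1) y)

/-- The zero order operator `S : Ω^{k,m} → Ω^{k+1,m-1}`. -/
def opS (ψ : DField (n + 1)) : DField (n + 1)
  | 0, _ => 0
  | k + 1, m => fun y => cplx (L.S k m y) (ψ k (m + 1) y)

/-- The zero order operator `S* : Ω^{k,m} → Ω^{k-1,m+1}`. -/
def opSst (ψ : DField (n + 1)) : DField (n + 1)
  | _, 0 => 0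
  | k, m + 1 => fun y => cplx (L.Sst k m y) (ψ (k + 1) m y)

/-- `𝐇 = ½ (d_V d + d d_V) + D : Ω^{k,m} → Ω^{k+1,m+1}`. -/
def H (ψ : DField (n + 1)) : DField (n + 1) :=
  (1 / 2 : ℝ) • (L.dV (L.d ψ) + L.d (L.dV ψ)) + L.opD ψ

/-- `𝐇* = ½ (δ δ_V + δ_V δ) + D* : Ω^{k,m} → Ω^{k-1,m-1}`. -/
def Hst (ψ : DField (n + 1)) : DField (n + 1) :=
  (1 / 2 : ℝ) • (L.δ (L.δV ψ) + L.δV (L.δ ψ)) + L.opDst ψ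

/-- `𝐅 = ½ (d δ_V + δ_V d) + S : Ω^{k,m} → Ω^{k+1,m-1}`. -/
def F (ψ : DField (n + 1)) : DField (n + 1) :=
  (1 / 2 : ℝ) • (L.d (L.δV ψ) + L.δV (L.d ψ)) + L.opS ψ

/-- `𝐅* = ½ (d_V δ + δ d_V) + S* : Ω^{k,m} → Ω^{k-1,m+1}`. -/
def Fst (ψ : DField (n + 1)) : DField (n + 1) :=
  (1 / 2 : ℝ) • (L.dV (L.δ ψ) + L.δ (L.dV ψ)) + L.opSst ψ

/-- The double bilaplacian `𝐁 = 𝐇 𝐇* + 𝐇* 𝐇 + 𝐅* 𝐅 + 𝐅 𝐅*`. -/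
def bilaplacian (ψ : DField (n + 1)) : DField (n + 1) :=
  L.H (L.Hst ψ) + L.Hst (L.H ψ) + L.Fst (L.F ψ) + L.F (L.Fst ψ)

end LocalData

/-! ### Boundary operators -/

/-- The inclusion `j` of the boundary hyperplane `{x₀ = 0}`. -/
def bdry (n : ℕ) : Euc n →L[ℝ] Euc (n + 1) :=
  LinearMap.toContinuousLinearMap
    { toFun := fun v => WithLp.toLp 2 (Fin.cons 0 (fun i => v i))
      map_add' := fun u v => by
        ext i
        refine Fin.cases ?_ (fun j => ?_) i <;> simp
      map_smul' := fun c v => by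
        ext i
        refine Fin.cases ?_ (fun j => ?_) i <;> simp }

theorem bdry_zero {n : ℕ} (v : Euc n) : bdry n v 0 = 0 := rfl
theorem bdry_succ {n : ℕ} (v : Euc n) (i : Fin n) : bdry n v i.succ = v i := rfl

namespace LocalData

variable {n : ℕ} (L : LocalData n)

/-- The differential of the boundary defining coordinate `x₀`. -/
def dx0 (n : ℕ) : Euc (n + 1) →L[ℝ] ℝ := EuclideanSpace.proj 0

/-- The unit conormal `dr = dx₀ / |dx₀|` at a boundary point. -/
def dr (y : Euc (n + 1)) : Euc (n + 1) →L[ℝ] ℝ :=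
  (Real.sqrt (dx0 n (sharp L.G y (dx0 n))))⁻¹ • dx0 n

/-- The inward unit normal `∂_r = (dr)♯` at a boundary point. -/
def normal (y : Euc (n + 1)) : Euc (n + 1) := sharp L.G y (L.dr y)

/-- The coefficients of the induced metric `g₀ = j* g` on the boundary. -/
def G₀ : MetricField n := fun y => (L.G (bdry n y)).bilinearComp (bdry n) (bdry n)

/-- `d` of the boundary metric -/
def d₀ : DField n → DField n := extD L.G₀ univ
/-- `d_V` of the boundary metric -/
def dV₀ : DField n → DField n := extDV L.G₀ univ
/-- `δ` of the boundary metric -/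
def δ₀ : DField n → DField n := coD L.G₀ univ
/-- `δ_V` of the boundary metric -/
def δV₀ : DField n → DField n := coDV L.G₀ univ

/-- `P^{tt} : Ω^{k,m}(M) → Ω^{k,m}(∂M)`. -/
def Ptt (_ : LocalData n) (ψ : DField (n + 1)) : DField n := fun k m y =>
  pull (bdry n) (ψ k m (bdry n y))

/-- `P^{nt} : Ω^{k,m}(M) → Ω^{k-1,m}(∂M)`: normal in the form part, tangential in the vector
part. -/
def Pnt (ψ : DField (n + 1)) : DField n := fun k m y =>
  pull (bdry n) (intForm (L.normal (bdry n y)) (ψ (k + 1) m (bdry n y)))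

/-- `P^{tn} : Ω^{k,m}(M) → Ω^{k,m-1}(∂M)`. -/
def Ptn (ψ : DField (n + 1)) : DField n := fun k m y =>
  pull (bdry n) (intVec (L.normal (bdry n y)) (ψ k (m + 1) (bdry n y)))

/-- `P^{nn} : Ω^{k,m}(M) → Ω^{k-1,m-1}(∂M)`. -/
def Pnn (ψ : DField (n + 1)) : DField n := fun k m y =>
  pull (bdry n) (intForm (L.normal (bdry n y))
    (intVec (L.normal (bdry n y)) (ψ (k + 1) (m + 1) (bdry n y))))

/-- `𝔗 : Ω^{k,m}(M) → Ω^{k,m}(∂M)`. -/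
def T (ψ : DField (n + 1)) : DField n :=
  (1 / 2 : ℝ) • (L.Pnt (L.d ψ) - L.d₀ (L.Pnt ψ)) +
  (1 / 2 : ℝ) • (L.Ptn (L.dV ψ) - L.dV₀ (L.Ptn ψ))

/-- `𝔗* : Ω^{k,m}(M) → Ω^{k-1,m-1}(∂M)`. -/
def Tst (ψ : DField (n + 1)) : DField n :=
  -((1 / 2 : ℝ) • (L.Ptn (L.δ ψ) + L.δ₀ (L.Ptn ψ))) -
  (1 / 2 : ℝ) • (L.Pnt (L.δV ψ) + L.δV₀ (L.Pnt ψ))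

/-- `𝔉* : Ω^{k,m}(M) → Ω^{k-1,m}(∂M)`. -/
def Fbst (ψ : DField (n + 1)) : DField n :=
  (1 / 2 : ℝ) • (L.Pnn (L.dV ψ) - L.dV₀ (L.Pnn ψ)) -
  (1 / 2 : ℝ) • (L.Ptt (L.δ ψ) + L.δ₀ (L.Ptt ψ))

/-- `𝔉 : Ω^{k,m}(M) → Ω^{k,m-1}(∂M)`. -/
def Fb (ψ : DField (n + 1)) : DField n :=
  (1 / 2 : ℝ) • (L.Pnn (L.d ψ) - L.d₀ (L.Pnn ψ)) -
  (1 / 2 : ℝ) • (L.Ptt (L.δV ψ) + L.δV₀ (L.Ptt ψ))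

end LocalData

/-! ### Principal symbols and regular ellipticity -/

/-- The principal symbol at `x` of a differential operator of order `N`.
If `L ψ (x) = ∑_{|α| ≤ N} a_α(x) D^α ψ(x)` with `D_j = -i ∂_j`, then applying `L` to
`z ↦ (ξ · (z - x))^N η / N!`, whose only nonvanishing derivatives at `x` are `∂^α = ξ^α η`,
`|α| = N`, yields `∑_{|α| = N} a_α(x) ξ^α η = (i^N / N!) L((ξ · (z - x))^N η)(x)`.
Here `L` is the operator followed by evaluation at the point under consideration. -/
def principalSymbol {d d' : ℕ} (L : DField d → GForm d') (N : ℕ) (x : Euc d)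
    (ξ : Euc d →L[ℝ] ℝ) (η : GForm d) : GForm d' :=
  (Complex.I ^ N / (N.factorial : ℂ)) • L (fun k m z => ((ξ (z - x)) ^ N : ℝ) • η k m)

/-- The `s`-derivative of order `j` of a curve in the graded fibre. -/
def curveDeriv {d : ℕ} (j : ℕ) (σ : ℝ → GForm d) (s : ℝ) : GForm d := fun k m =>
  iteratedDeriv j (fun t => σ t k m) s

/-- The coefficient of `tʲ` in the polynomial `t ↦ P_L(x, ξ + t ν) η`. -/
def symbolCoeff {d d' : ℕ} (L : DField d → GForm d') (N : ℕ) (x : Euc d)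
    (ξ ν : Euc d →L[ℝ] ℝ) (j : ℕ) (η : GForm d) : GForm d' := fun k m =>
  ((j.factorial : ℝ)⁻¹) • iteratedDeriv j (fun t : ℝ => principalSymbol L N x (ξ + t • ν) η k m) 0

/-- The ordinary differential operator `P_L(x, ξ + i ∂_s ν)`, obtained by substituting `i ∂_s` for
`t` in the polynomial `t ↦ P_L(x, ξ + t ν)`. -/
def odeOp {d d' : ℕ} (L : DField d → GForm d') (N : ℕ) (x : Euc d)
    (ξ ν : Euc d →L[ℝ] ℝ) (σ : ℝ → GForm d) (s : ℝ) : GForm d' :=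
  ∑ j ∈ Finset.range (N + 1), (Complex.I ^ j) • symbolCoeff L N x ξ ν j (curveDeriv j σ s)

/-- `η` has degree `(p,q)`; the only such element is `0` if `p < 0` or `q < 0`. -/
def HasDegree {d : ℕ} (p q : ℤ) (η : GForm d) : Prop :=
  ∀ k m : ℕ, ¬ ((k : ℤ) = p ∧ (m : ℤ) = q) → η k m = 0

/-- `f` restricts to a (complex) linear isomorphism from the linear subspace `s` to the linear
subspace `t`. -/
def IsLinearIso {X Y : Type*} [AddCommGroup X] [Module ℂ X] [AddCommGroup Y] [Module ℂ Y]
    (f : X → Y) (s : Set X) (t : Set Y) : Prop :=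
  ∃ (p : Submodule ℂ X) (q : Submodule ℂ Y) (Φ : p ≃ₗ[ℂ] q),
    (p : Set X) = s ∧ (q : Set Y) = t ∧ ∀ x : p, (Φ x : Y) = f x

/-- An operator on graded double forms over a manifold, given by its coordinate expression in terms
of the coordinate expressions of the geometric data, together with its order. -/
structure InteriorOperator (n : ℕ) where
  /-- the coordinate expression -/
  op : LocalData n → DField (n + 1) → DField (n + 1)
  /-- the order -/
  order : ℕ

/-- A boundary operator `Ω^{k,m}(M) → Ω^{k+a,m+b}(∂M)`, given by its coordinate expression, with its
order and the degree shift `(a,b)`. -/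
structure BoundaryOperator (n : ℕ) where
  /-- the coordinate expression -/
  op : LocalData n → DField (n + 1) → DField n
  /-- the order -/
  order : ℕ
  /-- the shift of the degree of the form part -/
  formShift : ℤ
  /-- the shift of the degree of the vector part -/
  vecShift : ℤ

/-- The space `𝓜⁺_{x,ξ}` of solutions, bounded on `[0,∞)`, of `P_A(x, ξ + i ∂_s dr) σ = 0`, with
values in complexified double forms of degree `(k,m)`. -/
def boundedSolutions {n : ℕ} (L : LocalData n) (k m : ℕ) (A : InteriorOperator n)
    (x : Euc (n + 1)) (ξ : Euc (n + 1) →L[ℝ] ℝ) : Set (ℝ → GForm (n + 1)) :=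
  {σ | (∀ s, HasDegree k m (σ s)) ∧
    (∀ a b : ℕ, ContDiff ℝ ∞ (fun s => σ s a b)) ∧
    (∀ a b : ℕ, ∃ C : ℝ, ∀ s, 0 ≤ s → ‖σ s a b‖ ≤ C) ∧
    ∀ s, odeOp (fun ψ => evalAt (A.op L ψ) x) A.order x ξ (L.dr x) σ s = 0}

/-- The map `Ξ_{x,ξ}` from curves to boundary data, at the boundary point `x = j(y)`. -/
def boundaryMap {n l : ℕ} (L : LocalData n) (B : Fin l → BoundaryOperator n)
    (y : Euc n) (ξ : Euc (n + 1) →L[ℝ] ℝ) (σ : ℝ → GForm (n + 1)) : Fin l → GForm n :=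
  fun j => odeOp (fun ψ => evalAt ((B j).op L ψ) y) (B j).order (bdry n y) ξ
    (L.dr (bdry n y)) σ 0

/-- The space `⊕_j ℂ ⊗ F_j` of boundary data, `F_j = Λ^{k+a_j,m+b_j} T*∂M`. -/
def boundaryData {n l : ℕ} (k m : ℕ) (B : Fin l → BoundaryOperator n) : Set (Fin l → GForm n) :=
  {θ | ∀ j, HasDegree (k + (B j).formShift) (m + (B j).vecShift) (θ j)}

/-! ### Riemannian manifolds with boundary -/

section Manifold

variable {n : ℕ} {M : Type*} [TopologicalSpace M] [ChartedSpace (EuclideanHalfSpace (n + 1)) M]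

/-- Linear maps `Λ^{k,m} T_p*M → Λ^{k',m'} T_p*M`, `p ∈ M`. -/
abbrev FiberMaps (n : ℕ) (M : Type*) [TopologicalSpace M]
    [ChartedSpace (EuclideanHalfSpace (n + 1)) M] (k m k' m' : ℕ) : Type _ :=
  ∀ p : M, DForm (TangentSpace (𝓡∂ (n + 1)) p) ℝ k m →L[ℝ]
    DForm (TangentSpace (𝓡∂ (n + 1)) p) ℝ k' m'

/-- The differential of the inverse of the chart `e`, at the point `y` of the half-space. -/
def chartSymmDeriv (e : OpenPartialHomeomorph M (EuclideanHalfSpace (n + 1))) (y : Euc (n + 1)) :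
    Euc (n + 1) →L[ℝ] TangentSpace (𝓡∂ (n + 1)) ((e.extend (𝓡∂ (n + 1))).symm y) :=
  mfderivWithin 𝓘(ℝ, Euc (n + 1)) (𝓡∂ (n + 1)) (e.extend (𝓡∂ (n + 1))).symm
    (range (𝓡∂ (n + 1))) y

/-- The differential of the chart `e` at the point with coordinates `y`. -/
def chartDeriv (e : OpenPartialHomeomorph M (EuclideanHalfSpace (n + 1))) (y : Euc (n + 1)) :
    TangentSpace (𝓡∂ (n + 1)) ((e.extend (𝓡∂ (n + 1))).symm y) →L[ℝ] Euc (n + 1) :=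
  mfderiv (𝓡∂ (n + 1)) 𝓘(ℝ, Euc (n + 1)) (e.extend (𝓡∂ (n + 1)))
    ((e.extend (𝓡∂ (n + 1))).symm y)

/-- The coordinate expression in the chart `e` of a family of fibre maps. -/
def localFiberMaps {k m k' m' : ℕ} (e : OpenPartialHomeomorph M (EuclideanHalfSpace (n + 1)))
    (T : FiberMaps n M k m k' m') (y : Euc (n + 1)) :
    DForm (Euc (n + 1)) ℝ k m →L[ℝ] DForm (Euc (n + 1)) ℝ k' m' :=
  pull (chartSymmDeriv e y) ∘L T ((e.extend (𝓡∂ (n + 1))).symm y) ∘L pull (chartDeriv e y)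

/-- A family of fibre maps is a smooth bundle map if it is smooth in every chart. -/
def IsSmoothBundleMap {k m k' m' : ℕ} (T : FiberMaps n M k m k' m') : Prop :=
  ∀ e ∈ IsManifold.maximalAtlas (𝓡∂ (n + 1)) ∞ M,
    ContDiffOn ℝ ∞ (localFiberMaps e T) (e.extend (𝓡∂ (n + 1))).target

variable [IsManifold (𝓡∂ (n + 1)) ∞ M]

/-- A smooth Riemannian metric on `M`. -/
abbrev Metric (n : ℕ) (M : Type*) [TopologicalSpace M]
    [ChartedSpace (EuclideanHalfSpace (n + 1)) M] [IsManifold (𝓡∂ (n + 1)) ∞ M] : Type _ :=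
  Bundle.ContMDiffRiemannianMetric (𝓡∂ (n + 1)) ∞ (Euc (n + 1))
    (fun p : M => TangentSpace (𝓡∂ (n + 1)) p)

/-- The coefficients of the metric `g` in the chart `e`. -/
def localMetric (g : Metric n M) (e : OpenPartialHomeomorph M (EuclideanHalfSpace (n + 1))) :
    MetricField (n + 1) := fun y =>
  (ContinuousLinearMap.precomp ℝ (chartSymmDeriv e y)) ∘L
    g.inner ((e.extend (𝓡∂ (n + 1))).symm y) ∘L chartSymmDeriv e y

theorem localMetric_apply (g : Metric n M)
    (e : OpenPartialHomeomorph M (EuclideanHalfSpace (n + 1))) (y u v : Euc (n + 1)) :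
    localMetric g e y u v = g.inner ((e.extend (𝓡∂ (n + 1))).symm y)
      (chartSymmDeriv e y u) (chartSymmDeriv e y v) := rfl

/-- `T'` is the fibrewise adjoint of `T` for the inner product on double forms induced by `g`. -/
def IsMetricDual (g : Metric n M) {k m k' m' : ℕ}
    (T : FiberMaps n M k m k' m') (T' : FiberMaps n M k' m' k m) : Prop :=
  ∀ (p : M) (b : Fin (n + 1) → TangentSpace (𝓡∂ (n + 1)) p),
    (∀ i j, g.inner p (b i) (b j) = if i = j then 1 else 0) →
    ∀ ψ χ, formInner b (T p ψ) χ = formInner b ψ (T' p χ)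

/-- Graded tensorial operators `D : Λ^{k,m} → Λ^{k+1,m+1}` and `S : Λ^{k,m} → Λ^{k+1,m-1}` with
their metric duals, such that `D ψᵀ = (D ψ)ᵀ` and `S ψ = (S* ψᵀ)ᵀ`.
The last two fields spell these identities out: `ψ'` is the transpose of `ψ`. -/
structure TensorialOperators (g : Metric n M) where
  /-- the operator `D` -/
  D : ∀ k m, FiberMaps n M k m (k + 1) (m + 1)
  /-- the metric dual of `D` -/
  Dst : ∀ k m, FiberMaps n M (k + 1) (m + 1) k m
  /-- the operator `S` -/
  S : ∀ k m, FiberMaps n M k (m + 1) (k + 1) m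
  /-- the metric dual of `S` -/
  Sst : ∀ k m, FiberMaps n M (k + 1) m k (m + 1)
  smooth_D : ∀ k m, IsSmoothBundleMap (D k m)
  smooth_Dst : ∀ k m, IsSmoothBundleMap (Dst k m)
  smooth_S : ∀ k m, IsSmoothBundleMap (S k m)
  smooth_Sst : ∀ k m, IsSmoothBundleMap (Sst k m)
  dual_D : ∀ k m, IsMetricDual g (D k m) (Dst k m)
  dual_S : ∀ k m, IsMetricDual g (S k m) (Sst k m)
  transpose_D : ∀ (k m) (p : M) (ψ : DForm (TangentSpace (𝓡∂ (n + 1)) p) ℝ k m)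
    (ψ' : DForm (TangentSpace (𝓡∂ (n + 1)) p) ℝ m k), (∀ X Y, ψ' Y X = ψ X Y) →
    ∀ X Y, D m k p ψ' Y X = D k m p ψ X Y
  transpose_S : ∀ (k m) (p : M) (ψ : DForm (TangentSpace (𝓡∂ (n + 1)) p) ℝ k (m + 1))
    (ψ' : DForm (TangentSpace (𝓡∂ (n + 1)) p) ℝ (m + 1) k), (∀ X Y, ψ' Y X = ψ X Y) →
    ∀ X Y, Sst m k p ψ' Y X = S k m p ψ X Y

/-- The coordinate expressions of the geometric data in the chart `e`. -/
def localData (g : Metric n M) (P : TensorialOperators g)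
    (e : OpenPartialHomeomorph M (EuclideanHalfSpace (n + 1))) : LocalData n where
  G := localMetric g e
  D k m := localFiberMaps e (P.D k m)
  Dst k m := localFiberMaps e (P.Dst k m)
  S k m := localFiberMaps e (P.S k m)
  Sst k m := localFiberMaps e (P.Sst k m)

/-- Regular ellipticity, in the sense of Lopatinskij and Shapiro, of the boundary value problem on
`Ω^{k,m}(M)` for an operator `A : Ω^{k,m}(M) → Ω^{k,m}(M)` with boundary operators `B_j`; the
symbols are computed in arbitrary charts of the (maximal) smooth atlas.

* The orders of the boundary operators are smaller than the order of `A`.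
* At each point `x` of `M`, the principal symbol `P_A(x,ξ)` is an isomorphism iff `ξ ≠ 0`.
* At each point `x` of `∂M` and for each nonzero covector `ξ` tangential to `∂M`
  (one that vanishes on `∂_r`), the map
  `σ ↦ (P_{B_j}(x, ξ + i ∂_s dr) σ(0))_j` is a linear isomorphism from the space of solutions of
  `P_A(x, ξ + i ∂_s dr) σ = 0` bounded on `[0,∞)` onto `⊕_j ℂ ⊗ F_j`. -/
def IsRegularElliptic (g : Metric n M) (P : TensorialOperators g) (k m : ℕ)
    (A : InteriorOperator n) {l : ℕ} (B : Fin l → BoundaryOperator n) : Prop :=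
  (∀ j, (B j).order < A.order) ∧
  (∀ e ∈ IsManifold.maximalAtlas (𝓡∂ (n + 1)) ∞ M, ∀ x ∈ (e.extend (𝓡∂ (n + 1))).target,
    ∀ ξ : Euc (n + 1) →L[ℝ] ℝ,
      IsLinearIso
        (principalSymbol (fun ψ => evalAt (A.op (localData g P e) ψ) x) A.order x ξ)
        {η | HasDegree k m η} {η | HasDegree k m η} ↔ ξ ≠ 0) ∧
  (∀ e ∈ IsManifold.maximalAtlas (𝓡∂ (n + 1)) ∞ M, ∀ y : Euc n,
    bdry n y ∈ (e.extend (𝓡∂ (n + 1))).target →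
    ∀ ξ : Euc (n + 1) →L[ℝ] ℝ, ξ ((localData g P e).normal (bdry n y)) = 0 → ξ ≠ 0 →
      IsLinearIso (boundaryMap (localData g P e) B y ξ)
        (boundedSolutions (localData g P e) k m A (bdry n y) ξ)
        (boundaryData k m B))

end Manifold

/-! ### The four boundary value problems -/

section Problems

open LocalData

variable (n : ℕ)

/-- The double bilaplacian, an operator of order four. -/
def bilaplacianOp : InteriorOperator n := ⟨fun L => L.bilaplacian, 4⟩

/-- `(P^{tt}, P^{tn}, P^{nt}, 𝔗, 𝔉*, 𝔉, P^{tt} 𝐇*, 𝔗 𝐇*)` -/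
def boundaryTT : Fin 8 → BoundaryOperator n :=
  ![⟨fun L => L.Ptt, 0, 0, 0⟩, ⟨fun L => L.Ptn, 0, 0, -1⟩, ⟨fun L => L.Pnt, 0, -1, 0⟩,
    ⟨fun L => L.T, 1, 0, 0⟩, ⟨fun L => L.Fbst, 1, -1, 0⟩, ⟨fun L => L.Fb, 1, 0, -1⟩,
    ⟨fun L ψ => L.Ptt (L.Hst ψ), 2, -1, -1⟩, ⟨fun L ψ => L.T (L.Hst ψ), 3, -1, -1⟩]

/-- `(P^{nn}, P^{tn}, P^{nt}, 𝔗*, 𝔉*, 𝔉, P^{nn} 𝐇, 𝔗* 𝐇)` -/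
def boundaryNN : Fin 8 → BoundaryOperator n :=
  ![⟨fun L => L.Pnn, 0, -1, -1⟩, ⟨fun L => L.Ptn, 0, 0, -1⟩, ⟨fun L => L.Pnt, 0, -1, 0⟩,
    ⟨fun L => L.Tst, 1, -1, -1⟩, ⟨fun L => L.Fbst, 1, -1, 0⟩, ⟨fun L => L.Fb, 1, 0, -1⟩,
    ⟨fun L ψ => L.Pnn (L.H ψ), 2, 0, 0⟩, ⟨fun L ψ => L.Tst (L.H ψ), 3, 0, 0⟩]

/-- `(P^{nt}, P^{nn}, P^{tt}, 𝔉*, 𝔗, 𝔗*, P^{nt} 𝐅, 𝔉* 𝐅)` -/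
def boundaryNT : Fin 8 → BoundaryOperator n :=
  ![⟨fun L => L.Pnt, 0, -1, 0⟩, ⟨fun L => L.Pnn, 0, -1, -1⟩, ⟨fun L => L.Ptt, 0, 0, 0⟩,
    ⟨fun L => L.Fbst, 1, -1, 0⟩, ⟨fun L => L.T, 1, 0, 0⟩, ⟨fun L => L.Tst, 1, -1, -1⟩,
    ⟨fun L ψ => L.Pnt (L.F ψ), 2, 0, -1⟩, ⟨fun L ψ => L.Fbst (L.F ψ), 3, 0, -1⟩]

/-- `(P^{tn}, P^{nn}, P^{tt}, 𝔉, 𝔗, 𝔗*, P^{tn} 𝐅*, 𝔉 𝐅*)` -/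
def boundaryTN : Fin 8 → BoundaryOperator n :=
  ![⟨fun L => L.Ptn, 0, 0, -1⟩, ⟨fun L => L.Pnn, 0, -1, -1⟩, ⟨fun L => L.Ptt, 0, 0, 0⟩,
    ⟨fun L => L.Fb, 1, 0, -1⟩, ⟨fun L => L.T, 1, 0, 0⟩, ⟨fun L => L.Tst, 1, -1, -1⟩,
    ⟨fun L ψ => L.Ptn (L.Fst ψ), 2, -1, 0⟩, ⟨fun L ψ => L.Fb (L.Fst ψ), 3, -1, 0⟩]

end Problems

end DoubleForms

end

/-!
The four boundary value problems are regular elliptic because, after freezing the geometry at a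
point, all of them reduce to one explicitly solvable system.

*Symbols.*  Put `φ z = ξ (z - x)`.  A double form `ψ` on a coordinate domain has leading term `η` of
order `r` at `x` in the direction `ξ` if `ψ = φʳ/r! · a` with `a` smooth at `x` and `a x = η`
(`HasLeadingTerm`).  If an operator of order `N` takes leading terms `η` of order `r + N` to leading
terms `P η` of order `r` (`HasSymbol`), its principal symbol is `iᴺ P`
(`HasSymbol.principalSymbol_eq`), and this property is compatible with sums and compositions.
The symbols of `d`, `d_V`, `δ`, `δ_V` are exterior multiplication with `ξ` and minus the interior
product with `ξ♯`, in the form part and in the vector part, up to the factor `i`; the Christoffel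
terms and the tensorial operators `D`, `S` are of lower order.  The canonical anticommutation
relations then give `|ξ|⁴` as the symbol of `𝐁` (`LocalData.hasSymbol_bilaplacian`), which proves
the interior condition.

*Boundary symbols.*  A double form at a boundary point has four components `tt, tn, nt, nn`, which
are double forms on the boundary and can be prescribed arbitrarily (`IsConormalPair`).  In terms of
them, the symbols at `ξ + t dr` of the eight boundary operators of each of the four problems have
the same shape (`modelSymbol`): the problems differ by a permutation of the components and by the
replacement of exterior by interior products, up to sign (`LocalData.hasSymbol_boundaryTT` and its
three companions).

*The Lopatinskij-Shapiro condition.*  With `λ = |ξ|`, the symbol of `𝐁` at `ξ + t dr` is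
`(λ² + t²)²`, so that the bounded solutions of `(λ² - ∂ₛ²)² σ = 0` are the curves
`e^{-λs} (a + s b)` (`exists_eq_expCurve_of_bounded`).  The boundary operators of order `0` and `1`
determine the components `A, B, C` of `a` directly and those of `b` up to the fourth component `D a`
of `a`.  The two remaining operators give a triangular system for `D a` and `D b + λ D a`, with
diagonal entries `3λ² - Z` and `λ² + Z`, where `Z = ie + jf` is a sum of two commuting
operators with eigenvalues `0` and `λ²`.  Both entries are therefore invertible
(`IsModelProblem.modelBoundary_injective`, `IsModelProblem.exists_modelBoundary_eq`).
-/

set_option autoImplicit false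

noncomputable section

namespace DoubleForms

/-! ### Shortcut instances -/

-- Instance search through the nested spaces of alternating maps behind `DForm` and `GForm` is slow;
-- these shortcuts spare it.

section Instances

variable (d k m : ℕ)

instance : NormedAddCommGroup (DForm (Euc d) ℂ k m) := inferInstance
instance : SeminormedAddCommGroup (DForm (Euc d) ℂ k m) := inferInstance
instance : NormedSpace ℝ (DForm (Euc d) ℂ k m) := inferInstance
instance : AddCommGroup (DForm (Euc d) ℂ k m) := inferInstance
instance : AddCommMonoid (DForm (Euc d) ℂ k m) := inferInstance
instance : Module ℝ (DForm (Euc d) ℂ k m) := inferInstance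
instance : Module ℂ (DForm (Euc d) ℂ k m) := inferInstance
instance : SMul ℝ (DForm (Euc d) ℂ k m) := inferInstance
instance : SMul ℂ (DForm (Euc d) ℂ k m) := inferInstance
instance : Zero (DForm (Euc d) ℂ k m) := inferInstance
instance : Add (DForm (Euc d) ℂ k m) := inferInstance
instance : Sub (DForm (Euc d) ℂ k m) := inferInstance
instance : Neg (DForm (Euc d) ℂ k m) := inferInstance
instance : TopologicalSpace (DForm (Euc d) ℂ k m) := inferInstance
instance : AddCommGroup (GForm d) := inferInstance
instance : AddCommMonoid (GForm d) := inferInstance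
instance : Module ℂ (GForm d) := inferInstance
instance : SMul ℂ (GForm d) := inferInstance
instance : Zero (GForm d) := inferInstance
instance : Add (GForm d) := inferInstance
instance : Sub (GForm d) := inferInstance
instance : Neg (GForm d) := inferInstance

end Instances

/-! ### Exterior algebra of graded double forms -/

section GradedAlgebra

variable {d d' d'' : ℕ}

/-- Transposition of graded double forms. -/
def transG : GForm d →ₗ[ℂ] GForm d where
  toFun η k m := transp (η m k)
  map_add' _ _ := rfl
  map_smul' _ _ := rfl

/-- Exterior multiplication `ξ ∧ ψ` in the form part of a double form `ψ`. -/
def extForm (ξ : Euc d →L[ℝ] ℝ) {k m : ℕ} (ψ : DForm (Euc d) ℂ k m) :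
    DForm (Euc d) ℂ (k + 1) m :=
  ContinuousAlternatingMap.alternatizeUncurryFin (ξ.smulRight ψ)

theorem extForm_apply (ξ : Euc d →L[ℝ] ℝ) {k m : ℕ} (ψ : DForm (Euc d) ℂ k m)
    (X : Fin (k + 1) → Euc d) (Y : Fin m → Euc d) :
    extForm ξ ψ X Y =
      ∑ i : Fin (k + 1), (-1) ^ (i : ℕ) * ((ξ (X i) : ℂ) * ψ (i.removeNth X) Y) := by
  rw [extForm, ContinuousAlternatingMap.alternatizeUncurryFin_apply,
    ContinuousAlternatingMap.sum_apply]
  refine Finset.sum_congr rfl fun i _ => ?_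
  simp

/-- Exterior multiplication `ξ ∧` in the form part of graded double forms. -/
def extMul (ξ : Euc d →L[ℝ] ℝ) : GForm d →ₗ[ℂ] GForm d where
  toFun η k m := match k with
    | 0 => 0
    | k + 1 => extForm ξ (η k m)
  map_add' η ζ := by
    funext k m
    cases k with
    | zero => exact (add_zero (0 : DForm (Euc d) ℂ 0 m)).symm
    | succ k =>
      ext X Y
      change extForm ξ (η k m + ζ k m) X Y = extForm ξ (η k m) X Y + extForm ξ (ζ k m) X Y
      simp only [extForm_apply, ContinuousAlternatingMap.add_apply, mul_add,
        Finset.sum_add_distrib]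
  map_smul' c η := by
    funext k m
    cases k with
    | zero => exact (smul_zero (A := DForm (Euc d) ℂ 0 m) c).symm
    | succ k =>
      ext X Y
      change extForm ξ (c • η k m) X Y = c • extForm ξ (η k m) X Y
      simp only [extForm_apply, ContinuousAlternatingMap.smul_apply, smul_eq_mul,
        Finset.mul_sum, mul_left_comm c]

/-- The interior product `i_v` with the form part. -/
def contr (v : Euc d) : GForm d →ₗ[ℂ] GForm d where
  toFun η k m := intForm v (η (k + 1) m)
  map_add' _ _ := rfl
  map_smul' _ _ := rfl

/-- Exterior multiplication `ξ ∧` in the vector part. -/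
def extMulV (ξ : Euc d →L[ℝ] ℝ) : GForm d →ₗ[ℂ] GForm d := transG ∘ₗ extMul ξ ∘ₗ transG

/-- The interior product `i_v^V` with the vector part. -/
def contrV (v : Euc d) : GForm d →ₗ[ℂ] GForm d := transG ∘ₗ contr v ∘ₗ transG

/-- Pullback of graded double forms along a linear map. -/
def pullG (A : Euc d' →L[ℝ] Euc d) : GForm d →ₗ[ℂ] GForm d' where
  toFun η k m := pull A (η k m)
  map_add' _ _ := rfl
  map_smul' _ _ := rfl

@[simp] theorem transG_transG (η : GForm d) : transG (transG η) = η := rfl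

theorem extMul_zero_apply (ξ : Euc d →L[ℝ] ℝ) (η : GForm d) (m : ℕ) : extMul ξ η 0 m = 0 := rfl

theorem extMul_succ_apply (ξ : Euc d →L[ℝ] ℝ) (η : GForm d) (k m : ℕ)
    (X : Fin (k + 1) → Euc d) (Y : Fin m → Euc d) :
    extMul ξ η (k + 1) m X Y =
      ∑ i : Fin (k + 1), (-1) ^ (i : ℕ) * ((ξ (X i) : ℂ) * η k m (i.removeNth X) Y) :=
  extForm_apply ξ (η k m) X Y

theorem contr_apply (v : Euc d) (η : GForm d) (k m : ℕ)
    (X : Fin k → Euc d) (Y : Fin m → Euc d) :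
    contr v η k m X Y = η (k + 1) m (Matrix.vecCons v X) Y := rfl

theorem extMulV_zero_apply (ξ : Euc d →L[ℝ] ℝ) (η : GForm d) (k : ℕ) :
    extMulV ξ η k 0 = 0 := rfl

theorem extMulV_succ_apply (ξ : Euc d →L[ℝ] ℝ) (η : GForm d) (k m : ℕ)
    (X : Fin k → Euc d) (Y : Fin (m + 1) → Euc d) :
    extMulV ξ η k (m + 1) X Y =
      ∑ i : Fin (m + 1), (-1) ^ (i : ℕ) * ((ξ (Y i) : ℂ) * η k m X (i.removeNth Y)) :=
  extMul_succ_apply ξ (transG η) m k Y X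

theorem contrV_apply (v : Euc d) (η : GForm d) (k m : ℕ)
    (X : Fin k → Euc d) (Y : Fin m → Euc d) :
    contrV v η k m X Y = η k (m + 1) X (Matrix.vecCons v Y) := rfl

theorem pullG_apply (A : Euc d' →L[ℝ] Euc d) (η : GForm d) (k m : ℕ)
    (X : Fin k → Euc d') (Y : Fin m → Euc d') :
    pullG A η k m X Y = η k m (fun i => A (X i)) (fun j => A (Y j)) := rfl

theorem GForm.ext_apply {η ζ : GForm d} (h : ∀ k m X Y, η k m X Y = ζ k m X Y) : η = ζ := by
  funext k m
  ext X Y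
  exact h k m X Y

theorem extMul_zero_covector (η : GForm d) : extMul 0 η = 0 := by
  refine GForm.ext_apply fun k m X Y => ?_
  cases k with
  | zero => simp [extMul_zero_apply]
  | succ k => simp [extMul_succ_apply]

theorem contr_add_smul (u v : Euc d) (t : ℝ) (η : GForm d) :
    contr (u + t • v) η = contr u η + (t : ℂ) • contr v η := by
  refine GForm.ext_apply fun k m X Y => ?_
  have h : (η (k + 1) m).curryLeft (u + t • v) X Y =
      (η (k + 1) m).curryLeft u X Y + t • (η (k + 1) m).curryLeft v X Y := by
    rw [map_add, map_smul]; rfl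
  simp only [Pi.add_apply, Pi.smul_apply, ContinuousAlternatingMap.add_apply,
    ContinuousAlternatingMap.smul_apply, smul_eq_mul]
  rw [← Complex.real_smul]
  exact h

theorem contrV_add_smul (u v : Euc d) (t : ℝ) (η : GForm d) :
    contrV (u + t • v) η = contrV u η + (t : ℂ) • contrV v η := by
  simp [contrV, contr_add_smul]

/-- Cartan's relation `i_v (ξ ∧ η) + ξ ∧ i_v η = ξ(v) η`. -/
theorem contr_extMul (v : Euc d) (ξ : Euc d →L[ℝ] ℝ) (η : GForm d) :
    contr v (extMul ξ η) = (ξ v : ℂ) • η - extMul ξ (contr v η) := by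
  refine GForm.ext_apply fun k m X Y => ?_
  simp only [Pi.sub_apply, Pi.smul_apply, ContinuousAlternatingMap.sub_apply,
      ContinuousAlternatingMap.smul_apply, contr_apply, extMul_succ_apply]
  rw [Fin.sum_univ_succ]
  cases k with
  | zero =>
    simp [extMul_zero_apply, Matrix.vecCons]
  | succ k =>
    rw [extMul_succ_apply]
    have h0 : (0 : Fin (k + 1 + 1)).removeNth (Matrix.vecCons v X : Fin (k + 1 + 1) → Euc d) = X :=
      rfl
    have h1 (i : Fin (k + 1)) :
        (i.succ).removeNth (Matrix.vecCons v X : Fin (k + 1 + 1) → Euc d) =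
          Matrix.vecCons v (i.removeNth X) := by
      funext j
      refine Fin.cases ?_ (fun j => ?_) j <;> simp [Fin.removeNth]
    simp only [h0, h1, contr_apply, Matrix.cons_val_zero, Matrix.cons_val_succ, Fin.val_zero,
      Fin.val_succ, pow_succ, pow_zero, one_mul, smul_eq_mul, sub_eq_add_neg,
      ← Finset.sum_neg_distrib]
    congr 1
    exact Finset.sum_congr rfl fun i _ => by ring

theorem extMul_extMul (ξ : Euc d →L[ℝ] ℝ) (η : GForm d) : extMul ξ (extMul ξ η) = 0 := by
  funext k m
  match k with
  | 0 => rfl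
  | 1 =>
    ext X Y
    simp [extMul_succ_apply, extMul_zero_apply]
  | k + 2 =>
    have h := ContinuousAlternatingMap.alternatizeUncurryFin_alternatizeUncurryFinCLM_comp_of_symmetric
      (f := ξ.smulRight (ξ.smulRight (η k m))) (fun x y => by
        simp [smul_smul, mul_comm])
    have hc : ContinuousAlternatingMap.alternatizeUncurryFinCLM ℝ (Euc d) _ ∘L
        ξ.smulRight (ξ.smulRight (η k m)) = ξ.smulRight (extForm ξ (η k m)) := by
      refine ContinuousLinearMap.ext fun v => ?_
      rw [ContinuousLinearMap.comp_apply, ContinuousLinearMap.smulRight_apply, map_smul]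
      rfl
    rw [hc] at h
    exact h

theorem contr_contr (v : Euc d) (η : GForm d) : contr v (contr v η) = 0 := by
  refine GForm.ext_apply fun k m X Y => ?_
  have := (η (k + 1 + 1) m).map_eq_zero_of_eq (Matrix.vecCons v (Matrix.vecCons v X))
    (i := 0) (j := 1) (by simp) (by simp)
  simp [contr_apply, this]

theorem extMulV_extMul (ξ ζ : Euc d →L[ℝ] ℝ) (η : GForm d) :
    extMulV ζ (extMul ξ η) = extMul ξ (extMulV ζ η) := by
  refine GForm.ext_apply fun k m X Y => ?_
  cases k with
  | zero =>
    cases m with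
    | zero => simp [extMul_zero_apply, extMulV_zero_apply]
    | succ m => simp [extMul_zero_apply, extMulV_succ_apply]
  | succ k =>
    cases m with
    | zero => simp [extMul_succ_apply, extMulV_zero_apply]
    | succ m =>
      simp only [extMul_succ_apply, extMulV_succ_apply, Finset.mul_sum]
      rw [Finset.sum_comm]
      exact Finset.sum_congr rfl fun i _ => Finset.sum_congr rfl fun j _ => by ring

theorem contrV_extMul (v : Euc d) (ξ : Euc d →L[ℝ] ℝ) (η : GForm d) :
    contrV v (extMul ξ η) = extMul ξ (contrV v η) := by
  refine GForm.ext_apply fun k m X Y => ?_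
  cases k with
  | zero => simp [extMul_zero_apply, contrV_apply]
  | succ k => simp [extMul_succ_apply, contrV_apply]

theorem contrV_contr (u v : Euc d) (η : GForm d) :
    contrV u (contr v η) = contr v (contrV u η) := rfl

theorem extMulV_contr (ξ : Euc d →L[ℝ] ℝ) (v : Euc d) (η : GForm d) :
    extMulV ξ (contr v η) = contr v (extMulV ξ η) := by
  have := contrV_extMul v ξ (transG η)
  simpa [extMulV, contrV] using (congrArg transG this).symm

theorem contrV_extMulV (v : Euc d) (ξ : Euc d →L[ℝ] ℝ) (η : GForm d) :
    contrV v (extMulV ξ η) = (ξ v : ℂ) • η - extMulV ξ (contrV v η) := by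
  simp [contrV, extMulV, contr_extMul]

theorem extMulV_extMulV (ξ : Euc d →L[ℝ] ℝ) (η : GForm d) : extMulV ξ (extMulV ξ η) = 0 := by
  simp [extMulV, extMul_extMul]

theorem contrV_contrV (v : Euc d) (η : GForm d) : contrV v (contrV v η) = 0 := by
  simp [contrV, contr_contr]

theorem pullG_transG (A : Euc d' →L[ℝ] Euc d) (η : GForm d) :
    pullG A (transG η) = transG (pullG A η) := rfl

theorem pullG_extMul (A : Euc d' →L[ℝ] Euc d) (ξ : Euc d →L[ℝ] ℝ) (η : GForm d) :
    pullG A (extMul ξ η) = extMul (ξ ∘L A) (pullG A η) := by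
  refine GForm.ext_apply fun k m X Y => ?_
  cases k with
  | zero => simp [extMul_zero_apply, pullG_apply]
  | succ k => simp [extMul_succ_apply, pullG_apply]; rfl

theorem pullG_extMulV (A : Euc d' →L[ℝ] Euc d) (ξ : Euc d →L[ℝ] ℝ) (η : GForm d) :
    pullG A (extMulV ξ η) = extMulV (ξ ∘L A) (pullG A η) := by
  simp [extMulV, pullG_transG, pullG_extMul]

theorem pullG_contr (A : Euc d' →L[ℝ] Euc d) (v : Euc d') (η : GForm d) :
    pullG A (contr (A v) η) = contr v (pullG A η) := by
  refine GForm.ext_apply fun k m X Y => ?_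
  simp only [contr_apply, pullG_apply]
  congr 2
  funext i
  refine Fin.cases ?_ (fun j => ?_) i <;> simp

theorem pullG_contrV (A : Euc d' →L[ℝ] Euc d) (v : Euc d') (η : GForm d) :
    pullG A (contrV (A v) η) = contrV v (pullG A η) := by
  simp [contrV, pullG_transG, pullG_contr]

theorem pullG_pullG (A : Euc d' →L[ℝ] Euc d) (B : Euc d'' →L[ℝ] Euc d') (η : GForm d) :
    pullG B (pullG A η) = pullG (A ∘L B) η := rfl

theorem pullG_id (η : GForm d) : pullG (ContinuousLinearMap.id ℝ (Euc d)) η = η := rfl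

theorem contr_pullG_of_eq_zero (A : Euc d' →L[ℝ] Euc d) {v : Euc d'} (hv : A v = 0)
    (η : GForm d) : contr v (pullG A η) = 0 := by
  rw [← pullG_contr, hv]
  have : contr (0 : Euc d) η = 0 := by
    simpa using contr_add_smul (0 : Euc d) 0 (-1) η
  rw [this, map_zero]

theorem contrV_pullG_of_eq_zero (A : Euc d' →L[ℝ] Euc d) {v : Euc d'} (hv : A v = 0)
    (η : GForm d) : contrV v (pullG A η) = 0 := by
  simp [contrV, ← pullG_transG, contr_pullG_of_eq_zero A hv]

/-! ### Degrees -/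

variable {p q : ℤ}

theorem hasDegree_zero (p q : ℤ) : HasDegree p q (0 : GForm d) := fun _ _ _ => rfl

theorem HasDegree.add {η ζ : GForm d} (hη : HasDegree p q η) (hζ : HasDegree p q ζ) :
    HasDegree p q (η + ζ) := fun k m h => by simp [hη k m h, hζ k m h]

theorem HasDegree.smul {η : GForm d} (c : ℂ) (hη : HasDegree p q η) :
    HasDegree p q (c • η) := fun k m h => by simp [hη k m h]

/-- Graded double forms of degree `(p,q)`. -/
def degSubmodule (d : ℕ) (p q : ℤ) : Submodule ℂ (GForm d) where
  carrier := {η | HasDegree p q η}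
  add_mem' := HasDegree.add
  zero_mem' := hasDegree_zero p q
  smul_mem' c _ h := h.smul c

theorem mem_degSubmodule {η : GForm d} : η ∈ degSubmodule d p q ↔ HasDegree p q η := Iff.rfl

theorem HasDegree.transG {η : GForm d} (h : HasDegree p q η) : HasDegree q p (transG η) :=
  fun k m hkm => by
    change transp (η m k) = 0
    rw [h m k (by tauto), map_zero]

theorem HasDegree.extMul {η : GForm d} (h : HasDegree p q η) (ξ : Euc d →L[ℝ] ℝ) :
    HasDegree (p + 1) q (extMul ξ η) := fun k m hkm => by
  cases k with
  | zero => rfl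
  | succ k =>
    ext X Y
    rw [extMul_succ_apply, h k m (by push_cast at hkm; omega)]
    simp

theorem HasDegree.contr {η : GForm d} (h : HasDegree p q η) (v : Euc d) :
    HasDegree (p - 1) q (contr v η) := fun k m hkm => by
  ext X Y
  rw [contr_apply, h (k + 1) m (by push_cast; omega)]
  simp

theorem HasDegree.extMulV {η : GForm d} (h : HasDegree p q η) (ξ : Euc d →L[ℝ] ℝ) :
    HasDegree p (q + 1) (extMulV ξ η) := (h.transG.extMul ξ).transG

theorem HasDegree.contrV {η : GForm d} (h : HasDegree p q η) (v : Euc d) :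
    HasDegree p (q - 1) (contrV v η) := (h.transG.contr v).transG

theorem HasDegree.pullG {η : GForm d} (h : HasDegree p q η) (A : Euc d' →L[ℝ] Euc d) :
    HasDegree p q (pullG A η) := fun k m hkm => by
  change pull A (η k m) = 0
  rw [h k m hkm, map_zero]

end GradedAlgebra

/-! ### Tangential and normal components at the boundary -/

section Components

variable {n : ℕ}

/-- The tangential component `tt`. -/
def compTT (n : ℕ) : GForm (n + 1) →ₗ[ℂ] GForm n := pullG (bdry n)

/-- The component `nt`, normal in the form part with respect to the normal vector `N`. -/
def compNT (N : Euc (n + 1)) : GForm (n + 1) →ₗ[ℂ] GForm n := pullG (bdry n) ∘ₗ contr N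

/-- The component `tn`, normal in the vector part with respect to the normal vector `N`. -/
def compTN (N : Euc (n + 1)) : GForm (n + 1) →ₗ[ℂ] GForm n := pullG (bdry n) ∘ₗ contrV N

/-- The component `nn`. -/
def compNN (N : Euc (n + 1)) : GForm (n + 1) →ₗ[ℂ] GForm n :=
  pullG (bdry n) ∘ₗ contr N ∘ₗ contrV N

/-- A normal vector `N` to the hyperplane `{x₀ = 0}` together with a conormal `ρ`, `ρ(N) = 1`. -/
structure IsConormalPair (ρ : Euc (n + 1) →L[ℝ] ℝ) (N : Euc (n + 1)) : Prop where
  apply_bdry : ∀ v, ρ (bdry n v) = 0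
  apply_normal : ρ N = 1

namespace IsConormalPair

variable {ρ : Euc (n + 1) →L[ℝ] ℝ} {N : Euc (n + 1)}

theorem comp_bdry (h : IsConormalPair ρ N) : ρ ∘L bdry n = 0 :=
  ContinuousLinearMap.ext h.apply_bdry

/-- The projection of `ℝⁿ⁺¹` onto the hyperplane `{x₀ = 0}` along `N`. -/
def proj (ρ : Euc (n + 1) →L[ℝ] ℝ) (N : Euc (n + 1)) : Euc (n + 1) →L[ℝ] Euc n :=
  LinearMap.toContinuousLinearMap
    { toFun := fun v => WithLp.toLp 2 (fun i => v i.succ - ρ v * N i.succ)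
      map_add' := fun u v => by
        ext i
        simp
        ring
      map_smul' := fun c v => by
        ext i
        simp
        ring }

theorem proj_apply (v : Euc (n + 1)) (i : Fin n) :
    proj ρ N v i = v i.succ - ρ v * N i.succ := rfl

theorem eq_zero_of_apply_eq_zero (h : IsConormalPair ρ N) {v : Euc (n + 1)} (hv : ρ v = 0) :
    v 0 = 0 := by
  have key (w : Euc (n + 1)) : ρ w = w 0 * ρ (EuclideanSpace.single 0 1) := by
    have hw : w = bdry n (WithLp.toLp 2 fun i => w i.succ) +
        w 0 • EuclideanSpace.single (0 : Fin (n + 1)) (1 : ℝ) := by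
      ext i
      refine Fin.cases ?_ (fun j => ?_) i
      · simp [bdry_zero]
      · simp [bdry_succ]
    conv_lhs => rw [hw]
    rw [map_add, h.apply_bdry, map_smul, zero_add, smul_eq_mul]
  have hN := key N
  rw [h.apply_normal] at hN
  rw [key] at hv
  rcases mul_eq_zero.1 hv with h0 | h0
  · exact h0
  · rw [h0, mul_zero] at hN
    exact absurd hN one_ne_zero

theorem bdry_proj (h : IsConormalPair ρ N) (v : Euc (n + 1)) :
    bdry n (proj ρ N v) = v - ρ v • N := by
  have h0 : (v - ρ v • N) 0 = 0 := h.eq_zero_of_apply_eq_zero (by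
    rw [map_sub, map_smul, h.apply_normal, smul_eq_mul, mul_one, sub_self])
  ext i
  refine Fin.cases ?_ (fun j => ?_) i
  · rw [bdry_zero, h0]
  · simp [bdry_succ, proj_apply]

theorem proj_comp_bdry (h : IsConormalPair ρ N) :
    proj ρ N ∘L bdry n = ContinuousLinearMap.id ℝ (Euc n) := by
  ext v i
  simp [proj_apply, h.apply_bdry, bdry_succ]

theorem proj_normal (h : IsConormalPair ρ N) : proj ρ N N = 0 := by
  ext i
  simp [proj_apply, h.apply_normal]

/-- The basis `(N, ∂₁, …, ∂ₙ)` adapted to the splitting into normal and tangential directions. -/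
def basis (h : IsConormalPair ρ N) : Module.Basis (Fin (n + 1)) ℝ (Euc (n + 1)) :=
  Module.Basis.ofEquivFun
    { toFun := fun v => Fin.cons (ρ v) (fun i => proj ρ N v i)
      map_add' := fun u v => by
        funext i
        refine Fin.cases ?_ (fun j => ?_) i <;> simp
      map_smul' := fun c v => by
        funext i
        refine Fin.cases ?_ (fun j => ?_) i <;> simp
      invFun := fun c => c 0 • N + bdry n (WithLp.toLp 2 fun i => c i.succ)
      left_inv := fun v => by
        have hv : (WithLp.toLp 2 fun i => proj ρ N v i : Euc n) = proj ρ N v := rfl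
        simp [hv, h.bdry_proj]
      right_inv := fun c => by
        funext i
        have hp (u : Euc n) : proj ρ N (bdry n u) = u := congrArg (fun f => f u) h.proj_comp_bdry
        refine Fin.cases ?_ (fun j => ?_) i
        · simp [h.apply_bdry, h.apply_normal]
        · simp [hp, h.proj_normal] }

theorem basis_zero (h : IsConormalPair ρ N) : h.basis 0 = N := by
  have hz : (WithLp.toLp 2 fun i : Fin n =>
      (Pi.single (0 : Fin (n + 1)) (1 : ℝ) : Fin (n + 1) → ℝ) i.succ : Euc n) = 0 := by
    ext i; simp
  rw [basis, Module.Basis.coe_ofEquivFun]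
  change (Pi.single (0 : Fin (n + 1)) (1 : ℝ) : Fin (n + 1) → ℝ) 0 • N + bdry n _ = N
  rw [hz]; simp

theorem basis_succ (h : IsConormalPair ρ N) (i : Fin n) :
    h.basis i.succ = bdry n (EuclideanSpace.single i 1) := by
  have hz : (WithLp.toLp 2 fun j : Fin n => (Pi.single i.succ (1 : ℝ) : Fin (n + 1) → ℝ) j.succ
    : Euc n) = EuclideanSpace.single i 1 := by
    ext j; simp [Pi.single_apply]
  rw [basis, Module.Basis.coe_ofEquivFun]
  change (Pi.single i.succ (1 : ℝ) : Fin (n + 1) → ℝ) 0 • N + bdry n _ = _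
  rw [hz]; simp

/-- An alternating form vanishes if its tangential and normal components vanish: evaluate on
injective tuples from the adapted basis, and move `N` to the first slot if it occurs. -/
theorem alternating_eq_zero (h : IsConormalPair ρ N) {F : Type*} [NormedAddCommGroup F]
    [NormedSpace ℝ F] {k : ℕ} (χ : Euc (n + 1) [⋀^Fin k]→L[ℝ] F)
    (ht : ∀ X : Fin k → Euc n, χ (fun i => bdry n (X i)) = 0)
    (hn : ∀ (l : ℕ) (hl : k = l + 1) (X : Fin l → Euc n),
      χ ((Matrix.vecCons N fun i => bdry n (X i) : Fin (l + 1) → Euc (n + 1)) ∘ Fin.cast hl) = 0) :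
    χ = 0 := by
  refine ContinuousAlternatingMap.toAlternatingMap_injective ?_
  refine Module.Basis.ext_alternating h.basis fun I hI => ?_
  change χ (fun i => h.basis (I i)) = 0
  by_cases h0 : ∃ i, I i = 0
  · obtain ⟨i₀, hi₀⟩ := h0
    obtain ⟨l, rfl⟩ : ∃ l, k = l + 1 := ⟨k - 1, by have := i₀.2; omega⟩
    have hs : χ ((fun i => h.basis (I i)) ∘ Equiv.swap 0 i₀) = 0 := by
      have hne (j : Fin l) : I (Equiv.swap 0 i₀ j.succ) ≠ 0 := fun hj => by
        rw [← hi₀] at hj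
        have := hI hj
        rw [Equiv.swap_apply_eq_iff, Equiv.swap_apply_right] at this
        exact Fin.succ_ne_zero j this
      have := hn l rfl (fun j => EuclideanSpace.single
        ((I (Equiv.swap 0 i₀ j.succ)).pred (hne j)) 1)
      convert this using 2
      funext i
      refine Fin.cases ?_ (fun j => ?_) i
      · simp [hi₀, h.basis_zero]
      · simp [← h.basis_succ]
    have hp := χ.toAlternatingMap.map_perm (fun i => h.basis (I i)) (Equiv.swap 0 i₀)
    change χ ((fun i => h.basis (I i)) ∘ Equiv.swap 0 i₀) = _ at hp
    rw [hs] at hp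
    rcases Int.units_eq_one_or (Equiv.Perm.sign (Equiv.swap 0 i₀)) with hσ | hσ <;>
      rw [hσ] at hp
    · simpa using hp.symm
    · simpa using hp.symm
  · push Not at h0
    have := ht (fun i => EuclideanSpace.single ((I i).pred (h0 i)) 1)
    simpa [← h.basis_succ] using this

/-- A graded double form is determined by its four components. -/
theorem eq_zero_of_components (h : IsConormalPair ρ N) {η : GForm (n + 1)}
    (htt : compTT n η = 0) (hnt : compNT N η = 0) (htn : compTN N η = 0)
    (hnn : compNN N η = 0) : η = 0 := by
  have e {ζ : GForm n} (hζ : ζ = 0) (k m X Y) : ζ k m X Y = 0 := by rw [hζ]; rfl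
  have key (k m : ℕ) (Z : Fin k → Euc (n + 1))
      (h1 : ∀ (l : ℕ) (Y : Fin l → Euc n), η k l Z (fun j => bdry n (Y j)) = 0)
      (h2 : ∀ (l : ℕ) (Y : Fin l → Euc n),
        η k (l + 1) Z (Matrix.vecCons N fun j => bdry n (Y j)) = 0) : η k m Z = 0 := by
    refine h.alternating_eq_zero _ (h1 m) ?_
    intro l hl Y
    obtain rfl : m = l + 1 := hl
    exact h2 l Y
  funext k m
  refine h.alternating_eq_zero _ (fun X => ?_) ?_
  · exact key k m _ (fun l Y => e htt k l X Y) (fun l Y => e htn k l X Y)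
  · intro l hl X
    obtain rfl : k = l + 1 := hl
    exact key (l + 1) m _ (fun j Y => e hnt l j X Y) (fun j Y => e hnn l j X Y)

/-- The double form with prescribed components. -/
def ofComponents (ρ : Euc (n + 1) →L[ℝ] ℝ) (N : Euc (n + 1)) (tt tn nt nn : GForm n) :
    GForm (n + 1) :=
  pullG (proj ρ N) tt + extMulV ρ (pullG (proj ρ N) tn) + extMul ρ (pullG (proj ρ N) nt) +
    extMul ρ (extMulV ρ (pullG (proj ρ N) nn))

theorem pullG_bdry_proj (h : IsConormalPair ρ N) (η : GForm n) :
    pullG (bdry n) (pullG (proj ρ N) η) = η := by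
  rw [pullG_pullG, h.proj_comp_bdry, pullG_id]

theorem pullG_bdry_extMul (h : IsConormalPair ρ N) (η : GForm (n + 1)) :
    pullG (bdry n) (extMul ρ η) = 0 := by
  rw [pullG_extMul, h.comp_bdry, extMul_zero_covector]

theorem pullG_bdry_extMulV (h : IsConormalPair ρ N) (η : GForm (n + 1)) :
    pullG (bdry n) (extMulV ρ η) = 0 := by
  rw [extMulV, LinearMap.comp_apply, LinearMap.comp_apply, pullG_transG, h.pullG_bdry_extMul,
    map_zero]

theorem contr_pullG_proj (h : IsConormalPair ρ N) (η : GForm n) : contr N (pullG (proj ρ N) η) = 0 :=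
  contr_pullG_of_eq_zero _ h.proj_normal η

theorem contrV_pullG_proj (h : IsConormalPair ρ N) (η : GForm n) : contrV N (pullG (proj ρ N) η) = 0 :=
  contrV_pullG_of_eq_zero _ h.proj_normal η

theorem compTT_ofComponents (h : IsConormalPair ρ N) (tt tn nt nn : GForm n) :
    compTT n (ofComponents ρ N tt tn nt nn) = tt := by
  simp [compTT, ofComponents, h.pullG_bdry_proj, h.pullG_bdry_extMul, h.pullG_bdry_extMulV]

theorem compNT_ofComponents (h : IsConormalPair ρ N) (tt tn nt nn : GForm n) :
    compNT N (ofComponents ρ N tt tn nt nn) = nt := by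
  simp [compNT, ofComponents, h.pullG_bdry_proj, h.pullG_bdry_extMulV,
    contr_extMul, ← extMulV_contr, h.contr_pullG_proj, h.apply_normal]

theorem compTN_ofComponents (h : IsConormalPair ρ N) (tt tn nt nn : GForm n) :
    compTN N (ofComponents ρ N tt tn nt nn) = tn := by
  simp [compTN, ofComponents, h.pullG_bdry_proj, h.pullG_bdry_extMul,
    contrV_extMulV, contrV_extMul, h.contrV_pullG_proj, h.apply_normal]

theorem compNN_ofComponents (h : IsConormalPair ρ N) (tt tn nt nn : GForm n) :
    compNN N (ofComponents ρ N tt tn nt nn) = nn := by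
  simp [compNN, ofComponents, h.pullG_bdry_proj,
    contrV_extMulV, contrV_extMul, h.contrV_pullG_proj, h.apply_normal, contr_extMul,
    h.contr_pullG_proj]

theorem hasDegree_ofComponents {p q : ℤ} {tt tn nt nn : GForm n} (htt : HasDegree p q tt)
    (htn : HasDegree p (q - 1) tn) (hnt : HasDegree (p - 1) q nt)
    (hnn : HasDegree (p - 1) (q - 1) nn) :
    HasDegree p q (ofComponents ρ N tt tn nt nn) := by
  refine (((htt.pullG _).add ?_).add ?_).add ?_
  · simpa using (htn.pullG (proj ρ N)).extMulV ρ
  · simpa using (hnt.pullG (proj ρ N)).extMul ρ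
  · simpa using ((hnn.pullG (proj ρ N)).extMulV ρ).extMul ρ

end IsConormalPair

theorem hasDegree_compTT {p q : ℤ} {η : GForm (n + 1)} (h : HasDegree p q η) :
    HasDegree p q (compTT n η) := h.pullG _

theorem hasDegree_compNT {p q : ℤ} {η : GForm (n + 1)} (h : HasDegree p q η)
    (N : Euc (n + 1)) : HasDegree (p - 1) q (compNT N η) := by
  rw [compNT, LinearMap.comp_apply]
  exact (h.contr N).pullG _

theorem hasDegree_compTN {p q : ℤ} {η : GForm (n + 1)} (h : HasDegree p q η)
    (N : Euc (n + 1)) : HasDegree p (q - 1) (compTN N η) := by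
  rw [compTN, LinearMap.comp_apply]
  exact (h.contrV N).pullG _

theorem hasDegree_compNN {p q : ℤ} {η : GForm (n + 1)} (h : HasDegree p q η)
    (N : Euc (n + 1)) : HasDegree (p - 1) (q - 1) (compNN N η) := by
  rw [compNN, LinearMap.comp_apply, LinearMap.comp_apply]
  exact ((h.contrV N).contr N).pullG _

end Components

/-! ### Jets of fields along powers of a linear function -/

section Jets

variable {d d' d'' : ℕ}

/-- A point `x` of a domain `s` in which derivatives are taken, and a covector `ξ` at `x`. -/
structure Cov (d : ℕ) where
  /-- the domain in which derivatives are taken -/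
  s : Set (Euc d)
  /-- the base point -/
  x : Euc d
  /-- the covector -/
  ξ : Euc d →L[ℝ] ℝ
  uniqueDiffOn : UniqueDiffOn ℝ s
  mem : x ∈ s

variable {E F : Type*} [NormedAddCommGroup E] [NormedSpace ℝ E]
  [NormedAddCommGroup F] [NormedSpace ℝ F]

/-- Near the base point of `p`, the field `f` has the form `φʳ / r! • a` with `φ z = ξ (z - x)`
and a smooth coefficient field `a` whose value at the base point is `v`. -/
def HasLeadingTerm (p : Cov d) (r : ℕ) (f : Euc d → E) (v : E) : Prop :=
  ∃ a : Euc d → E, ContDiffWithinAt ℝ ∞ a p.s p.x ∧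
    (∀ᶠ z in nhdsWithin p.x p.s, f z = ((p.ξ (z - p.x)) ^ r / r.factorial) • a z) ∧ a p.x = v

namespace HasLeadingTerm

variable {p : Cov d} {r : ℕ} {f g : Euc d → E} {v w : E}

theorem eval (h : HasLeadingTerm p 0 f v) : f p.x = v := by
  obtain ⟨a, -, ha, rfl⟩ := h
  simpa using ha.self_of_nhdsWithin p.mem

theorem add (hf : HasLeadingTerm p r f v) (hg : HasLeadingTerm p r g w) :
    HasLeadingTerm p r (f + g) (v + w) := by
  obtain ⟨a, ha, hfa, rfl⟩ := hf
  obtain ⟨b, hb, hgb, rfl⟩ := hg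
  refine ⟨a + b, ha.add hb, ?_, rfl⟩
  filter_upwards [hfa, hgb] with z h1 h2
  simp [h1, h2]

/-- A constant linear map acts on leading terms. -/
theorem clm (L : E →L[ℝ] F) (hf : HasLeadingTerm p r f v) :
    HasLeadingTerm p r (fun z => L (f z)) (L v) := by
  obtain ⟨a, ha, hfa, rfl⟩ := hf
  refine ⟨fun z => L (a z), L.contDiff.comp_contDiffWithinAt ha, ?_, rfl⟩
  filter_upwards [hfa] with z h1
  rw [h1, map_smul]

/-- A smooth family of linear maps acts on leading terms through its value at the base point. -/
theorem clm_apply {A : Euc d → E →L[ℝ] F} (hA : ContDiffWithinAt ℝ ∞ A p.s p.x)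
    (hf : HasLeadingTerm p r f v) : HasLeadingTerm p r (fun z => A z (f z)) (A p.x v) := by
  obtain ⟨a, ha, hfa, rfl⟩ := hf
  refine ⟨fun z => A z (a z), hA.clm_apply ha, ?_, rfl⟩
  filter_upwards [hfa] with z h1
  rw [h1, map_smul]

theorem clm_apply₂ {H : Type*} [NormedAddCommGroup H] [NormedSpace ℝ H] (B : E →L[ℝ] F →L[ℝ] H)
    {c : Euc d → F} (hc : ContDiffWithinAt ℝ ∞ c p.s p.x) (hf : HasLeadingTerm p r f v) :
    HasLeadingTerm p r (fun z => B (f z) (c z)) (B v (c p.x)) :=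
  hf.clm_apply (A := fun z => B.flip (c z)) (B.flip.contDiff.comp_contDiffWithinAt hc)

theorem contDiffWithinAt_linear (p : Cov d) (s : Set (Euc d)) (x : Euc d) :
    ContDiffWithinAt ℝ ∞ (fun z => p.ξ (z - p.x)) s x :=
  p.ξ.contDiff.comp_contDiffWithinAt (contDiffWithinAt_id.sub contDiffWithinAt_const)

theorem lower (hf : HasLeadingTerm p (r + 1) f v) : HasLeadingTerm p r f 0 := by
  obtain ⟨a, ha, hfa, rfl⟩ := hf
  refine ⟨fun z => (p.ξ (z - p.x) / (r + 1)) • a z,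
    ((contDiffWithinAt_linear p _ _).div_const _).smul ha, ?_, by simp⟩
  filter_upwards [hfa] with z h1
  rw [h1, smul_smul, Nat.factorial_succ, pow_succ]
  congr 1
  push_cast
  field_simp

theorem neg (hf : HasLeadingTerm p r f v) : HasLeadingTerm p r (-f) (-v) :=
  hf.clm (-ContinuousLinearMap.id ℝ E)

theorem sub (hf : HasLeadingTerm p r f v) (hg : HasLeadingTerm p r g w) :
    HasLeadingTerm p r (f - g) (v - w) := by
  simpa only [sub_eq_add_neg] using hf.add hg.neg

theorem _root_.DoubleForms.hasFDerivWithinAt_pow_div_factorial (p : Cov d) (r : ℕ) (z : Euc d) :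
    HasFDerivWithinAt (fun z => (p.ξ (z - p.x)) ^ (r + 1) / ((r + 1).factorial : ℝ))
      (((p.ξ (z - p.x)) ^ r / (r.factorial : ℝ)) • p.ξ) p.s z := by
  have h1 : HasFDerivWithinAt (fun z => p.ξ (z - p.x)) p.ξ p.s z :=
    p.ξ.hasFDerivAt.comp_hasFDerivWithinAt z ((hasFDerivWithinAt_id z p.s).sub_const p.x)
  have h2 := (h1.pow (r + 1)).mul_const (((r + 1).factorial : ℝ)⁻¹)
  convert! h2 using 1
  rw [smul_smul]
  congr 1
  rw [Nat.factorial_succ]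
  push_cast
  field_simp
  rw [nsmul_eq_mul]
  push_cast
  ring

/-- The leading term of a derivative: `D(φʳ⁺¹/(r+1)! a) = φʳ/r! (ξ ⊗ a + φ/(r+1) D a)`. -/
theorem fderivWithin (hf : HasLeadingTerm p (r + 1) f v) :
    HasLeadingTerm p r (fderivWithin ℝ f p.s) (p.ξ.smulRight v) := by
  obtain ⟨a, ha, hfa, rfl⟩ := hf
  have hD : ContDiffWithinAt ℝ ∞ (_root_.fderivWithin ℝ a p.s) p.s p.x :=
    ha.fderivWithin_right p.uniqueDiffOn (by simp) p.mem
  refine ⟨fun z => ContinuousLinearMap.smulRightL ℝ (Euc d) E p.ξ (a z) +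
      (p.ξ (z - p.x) / (r + 1)) • _root_.fderivWithin ℝ a p.s z,
    ((ContinuousLinearMap.smulRightL ℝ (Euc d) E p.ξ).contDiff.comp_contDiffWithinAt ha).add
      (((contDiffWithinAt_linear p _ _).div_const _).smul hD), ?_, ?_⟩
  · have hdiff : ∀ᶠ z in nhdsWithin p.x p.s, DifferentiableWithinAt ℝ a p.s z := by
      have h1 : ContDiffWithinAt ℝ 1 a p.s p.x := ha.of_le (by simp)
      have h2 := h1.eventually (by simp)
      rw [insert_eq_of_mem p.mem] at h2
      exact h2.mono fun z hz => hz.differentiableWithinAt (by simp)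
    filter_upwards [hdiff, eventually_eventually_nhdsWithin.2 hfa, self_mem_nhdsWithin]
      with z hz hfz hzs
    have hfd := Filter.EventuallyEq.fderivWithin_eq (𝕜 := ℝ) hfz (hfz.self_of_nhdsWithin hzs)
    rw [hfd]
    refine (((hasFDerivWithinAt_pow_div_factorial p r z).smul
      hz.hasFDerivWithinAt).fderivWithin (p.uniqueDiffOn z hzs)).trans ?_
    refine ContinuousLinearMap.ext fun u => ?_
    have hR : ContinuousLinearMap.smulRightL ℝ (Euc d) E p.ξ (a z) u = p.ξ u • a z := rfl
    simp only [_root_.add_apply, _root_.smul_apply, ContinuousLinearMap.smulRight_apply, hR,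
      smul_add, smul_smul, smul_eq_mul]
    rw [add_comm]
    congr 2
    rw [Nat.factorial_succ, pow_succ]
    push_cast
    field_simp
  · simp only [sub_self, map_zero, zero_div, zero_smul, add_zero]
    rfl

/-- The action of endomorphisms by derivations, as a linear map in the double form. -/
def _root_.DoubleForms.derivActL (d k m : ℕ) :
    DForm (Euc d) ℂ k m →L[ℝ] (Euc d →L[ℝ] Euc d) →L[ℝ] DForm (Euc d) ℂ k m :=
  ContinuousAlternatingMap.fderivCompContinuousLinearMapCLM _ (ContinuousLinearMap.id ℝ (Euc d)) +
  (ContinuousLinearMap.compL ℝ _ _ _ transp) ∘L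
    ContinuousAlternatingMap.fderivCompContinuousLinearMapCLM _
      (ContinuousLinearMap.id ℝ (Euc d)) ∘L transp

/-- The leading term of the Levi-Civita derivative does not involve the Christoffel symbols. -/
theorem covDeriv {G : MetricField d} {k m : ℕ} {ψ : Euc d → DForm (Euc d) ℂ k m}
    {v : DForm (Euc d) ℂ k m}
    (hΓ : ContDiffWithinAt ℝ ∞ (christoffel G p.s) p.s p.x)
    (hψ : HasLeadingTerm p (r + 1) ψ v) :
    HasLeadingTerm p r (covDeriv G p.s ψ) (p.ξ.smulRight v) := by
  have h := hψ.fderivWithin.sub (hψ.clm_apply₂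
    (ContinuousLinearMap.compL ℝ (Euc d) (Euc d →L[ℝ] Euc d) (DForm (Euc d) ℂ k m) ∘L
      derivActL d k m) hΓ).lower
  rw [sub_zero] at h
  exact h

/-- A leading term restricts to the hyperplane `{x₀ = 0}`. -/
theorem comp_bdry {n r : ℕ} {p : Cov (n + 1)} {q : Cov n} {f : Euc (n + 1) → E} {v : E}
    (hf : HasLeadingTerm p r f v) (hs : MapsTo (bdry n) q.s p.s) (hx : bdry n q.x = p.x)
    (hξ : ∀ u, q.ξ u = p.ξ (bdry n u)) :
    HasLeadingTerm q r (fun y => f (bdry n y)) v := by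
  obtain ⟨a, ha, hfa, rfl⟩ := hf
  rw [← hx] at ha hfa ⊢
  refine ⟨fun y => a (bdry n y), ha.comp q.x (bdry n).contDiff.contDiffWithinAt hs, ?_, rfl⟩
  have ht : Filter.Tendsto (bdry n) (nhdsWithin q.x q.s) (nhdsWithin (bdry n q.x) p.s) :=
    (bdry n).continuous.continuousWithinAt.tendsto_nhdsWithin hs
  filter_upwards [ht.eventually hfa] with y hy
  rw [hy, hξ, map_sub (bdry n)]

end HasLeadingTerm

/-- Componentwise leading terms of a graded double form. -/
def HasLeading (p : Cov d) (r : ℕ) (ψ : DField d) (η : GForm d) : Prop :=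
  ∀ k m, HasLeadingTerm p r (ψ k m) (η k m)

theorem HasLeading.eval {p : Cov d} {ψ : DField d} {η : GForm d} (h : HasLeading p 0 ψ η) :
    evalAt ψ p.x = η := by
  funext k m
  exact (h k m).eval

end Jets

/-! ### Riemannian metrics at a point of a coordinate domain -/

section Metrics

variable {d : ℕ}

/-- The metric coefficients `G` are smooth at `x` within `s`, and symmetric and positive definite
at `x`. -/
structure IsMetricAt (G : MetricField d) (s : Set (Euc d)) (x : Euc d) : Prop where
  contDiffWithinAt : ContDiffWithinAt ℝ ∞ G s x
  symm : ∀ u v, G x u v = G x v u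
  pos : ∀ v, v ≠ 0 → 0 < G x v v

namespace IsMetricAt

variable {G : MetricField d} {s : Set (Euc d)} {x : Euc d}

theorem isInvertible (h : IsMetricAt G s x) : (G x).IsInvertible := by
  have hinj : Function.Injective (G x : Euc d →ₗ[ℝ] (Euc d →L[ℝ] ℝ)) := by
    refine (injective_iff_map_eq_zero _).2 fun v hv => ?_
    by_contra hv0
    have h1 := h.pos v hv0
    rw [show G x v = 0 from hv] at h1
    exact lt_irrefl _ h1
  have hdim : Module.finrank ℝ (Euc d) = Module.finrank ℝ (Euc d →L[ℝ] ℝ) := by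
    rw [← (LinearMap.toContinuousLinearMap (𝕜 := ℝ) (E := Euc d) (F' := ℝ)).finrank_eq]
    exact Subspace.dual_finrank_eq.symm
  exact ⟨(LinearEquiv.ofInjectiveOfFinrankEq _ hinj hdim).toContinuousLinearEquiv, rfl⟩

theorem apply_sharp (h : IsMetricAt G s x) (α : Euc d →L[ℝ] ℝ) : G x (sharp G x α) = α := by
  obtain ⟨e, he⟩ := h.isInvertible
  rw [sharp, ← he, ContinuousLinearMap.inverse_equiv]
  exact e.apply_symm_apply α

theorem sharp_add_smul (α β : Euc d →L[ℝ] ℝ) (t : ℝ) :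
    sharp G x (α + t • β) = sharp G x α + t • sharp G x β := by
  simp [sharp]

theorem apply_sharp_comm (h : IsMetricAt G s x) (α β : Euc d →L[ℝ] ℝ) :
    α (sharp G x β) = β (sharp G x α) := by
  conv_lhs => rw [← h.apply_sharp α]
  conv_rhs => rw [← h.apply_sharp β]
  exact h.symm _ _

theorem apply_sharp_pos (h : IsMetricAt G s x) {α : Euc d →L[ℝ] ℝ} (hα : α ≠ 0) :
    0 < α (sharp G x α) := by
  have h0 : sharp G x α ≠ 0 := fun h0 => hα (by rw [← h.apply_sharp α, h0, map_zero])
  have := h.pos _ h0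
  rwa [h.apply_sharp] at this

/-- `♯ α` is determined by the metric. -/
theorem eq_sharp (h : IsMetricAt G s x) {α : Euc d →L[ℝ] ℝ} {v : Euc d} (hv : G x v = α) :
    v = sharp G x α := by
  by_contra hne
  have := h.pos (v - sharp G x α) (sub_ne_zero.2 hne)
  rw [map_sub (G x), hv, h.apply_sharp, sub_self] at this
  exact lt_irrefl _ this

theorem contDiffWithinAt_inverse (h : IsMetricAt G s x) :
    ContDiffWithinAt ℝ ∞ (fun y => ContinuousLinearMap.inverse (G y)) s x :=
  h.isInvertible.contDiffAt_map_inverse.comp_contDiffWithinAt x h.contDiffWithinAt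

theorem contDiffWithinAt_sharp (h : IsMetricAt G s x) (α : Euc d →L[ℝ] ℝ) :
    ContDiffWithinAt ℝ ∞ (fun y => sharp G y α) s x :=
  h.contDiffWithinAt_inverse.clm_apply contDiffWithinAt_const

theorem contDiffWithinAt_christoffel (h : IsMetricAt G s x) (hs : UniqueDiffOn ℝ s)
    (hx : x ∈ s) : ContDiffWithinAt ℝ ∞ (christoffel G s) s x := by
  have hD : ContDiffWithinAt ℝ ∞ (fderivWithin ℝ G s) s x :=
    h.contDiffWithinAt.fderivWithin_right hs (by simp) hx
  have hDf : ContDiffWithinAt ℝ ∞ (fun y => (fderivWithin ℝ G s y).flip) s x :=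
    (ContinuousLinearMap.flipₗᵢ ℝ (Euc d) (Euc d)
      (Euc d →L[ℝ] ℝ)).toContinuousLinearEquiv.contDiff.comp_contDiffWithinAt hD
  have hK : ContDiffWithinAt ℝ ∞ (koszul G s) s x :=
    ((hD.add hDf).sub (contDiffWithinAt_const.clm_comp hDf)).const_smul _
  exact ((ContinuousLinearMap.contDiff _).comp_contDiffWithinAt
    h.contDiffWithinAt_inverse).clm_comp hK

/-- The expansion `α♯ = ∑ⱼ α(∂ⱼ) (dxʲ)♯`. -/
theorem sharp_eq_sum (α : Euc d →L[ℝ] ℝ) :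
    sharp G x α =
      ∑ j, α (EuclideanSpace.single j 1) • sharp G x (EuclideanSpace.proj j) := by
  have hα : α = ∑ j, α (EuclideanSpace.single j 1) •
      (EuclideanSpace.proj j : Euc d →L[ℝ] ℝ) := by
    refine ContinuousLinearMap.ext fun v => ?_
    have hv : v = ∑ j, v j • EuclideanSpace.single j (1 : ℝ) := by
      ext i
      simp [Pi.single_apply]
    conv_lhs => rw [hv]
    simp [mul_comm]
  conv_lhs => rw [hα]
  simp [sharp]

end IsMetricAt

end Metrics

/-! ### Principal symbols of composite operators -/

section Symbols

variable {d d' d'' : ℕ}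

/-- The operator `op` has order `N` and its symbol is `iᴺ P`: it maps fields with leading term
`φʳ⁺ᴺ/(r+N)! η` to fields with leading term `φʳ/r! P η`.  The covector and the base point are part
of `p` and `q`. -/
def HasSymbol (p : Cov d) (q : Cov d') (op : DField d → DField d') (N : ℕ)
    (P : GForm d →ₗ[ℂ] GForm d') : Prop :=
  ∀ (r : ℕ) (ψ : DField d) (η : GForm d), HasLeading p (r + N) ψ η → HasLeading q r (op ψ) (P η)

theorem HasLeadingTerm.zero {E : Type*} [NormedAddCommGroup E] [NormedSpace ℝ E] (p : Cov d)
    (r : ℕ) : HasLeadingTerm p r (0 : Euc d → E) 0 :=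
  ⟨0, contDiffWithinAt_const, Filter.Eventually.of_forall fun z => by simp, rfl⟩

theorem HasLeadingTerm.sum {E ι : Type*} [NormedAddCommGroup E] [NormedSpace ℝ E] {p : Cov d}
    {r : ℕ} (s : Finset ι) {f : ι → Euc d → E} {v : ι → E}
    (h : ∀ i ∈ s, HasLeadingTerm p r (f i) (v i)) :
    HasLeadingTerm p r (∑ i ∈ s, f i) (∑ i ∈ s, v i) := by
  classical
  induction s using Finset.induction_on with
  | empty => simpa using HasLeadingTerm.zero p r
  | insert i s hi ih =>
    rw [Finset.sum_insert hi, Finset.sum_insert hi]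
    exact (h i (by simp)).add (ih fun j hj => h j (by simp [hj]))

namespace HasSymbol

variable {p : Cov d} {q : Cov d'} {o : Cov d''} {A B : DField d → DField d'}
  {C : DField d' → DField d''} {N M K : ℕ} {P Q : GForm d →ₗ[ℂ] GForm d'}
  {R : GForm d' →ₗ[ℂ] GForm d''}

theorem add (hA : HasSymbol p q A N P) (hB : HasSymbol p q B N Q) :
    HasSymbol p q (fun ψ => A ψ + B ψ) N (P + Q) :=
  fun r ψ η h k m => (hA r ψ η h k m).add (hB r ψ η h k m)

theorem neg (hA : HasSymbol p q A N P) : HasSymbol p q (fun ψ => -A ψ) N (-P) :=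
  fun r ψ η h k m => (hA r ψ η h k m).neg

theorem sub (hA : HasSymbol p q A N P) (hB : HasSymbol p q B N Q) :
    HasSymbol p q (fun ψ => A ψ - B ψ) N (P - Q) :=
  fun r ψ η h k m => (hA r ψ η h k m).sub (hB r ψ η h k m)

theorem smul (c : ℝ) (hA : HasSymbol p q A N P) :
    HasSymbol p q (fun ψ => c • A ψ) N ((c : ℂ) • P) := fun r ψ η h k m => by
  have hc := (hA r ψ η h k m).clm (c • ContinuousLinearMap.id ℝ _)
  have e : ((c : ℂ) • P) η k m = c • P η k m := by
    ext X Y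
    change (c : ℂ) • P η k m X Y = c • P η k m X Y
    simp
  rw [e]
  exact hc

theorem comp (hC : HasSymbol q o C M R) (hA : HasSymbol p q A N P) (hK : K = M + N) :
    HasSymbol p o (fun ψ => C (A ψ)) K (R ∘ₗ P) := fun r ψ η h =>
  hC r (A ψ) (P η) (hA (r + M) ψ η (by rwa [hK, ← add_assoc] at h))

theorem congr (hA : HasSymbol p q A N P) (h : ∀ η, P η = Q η) : HasSymbol p q A N Q := by
  rwa [LinearMap.ext h] at hA

theorem of_order_zero (h : ∀ (r : ℕ) (ψ : DField d) (η : GForm d),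
    HasLeading p r ψ η → HasLeading q r (A ψ) (P η)) : HasSymbol p q A 0 P :=
  fun r ψ η hψ => h r ψ η (by rwa [add_zero] at hψ)

theorem transpose (p : Cov d) : HasSymbol p p DoubleForms.transpose 0 transG :=
  of_order_zero fun _ _ _ h k m =>
    HasLeadingTerm.clm (transp (V := Euc d) (k := m) (m := k)) (h m k)

/-- The symbol of `d` is `i ξ ∧`. -/
theorem extD {G : MetricField d} (hG : IsMetricAt G p.s p.x) :
    HasSymbol p p (extD G p.s) 1 (extMul p.ξ) := fun r ψ η h k m => by
  cases k with
  | zero => exact HasLeadingTerm.zero p r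
  | succ k =>
    exact ((h k m).covDeriv (hG.contDiffWithinAt_christoffel p.uniqueDiffOn p.mem)).clm
      (ContinuousAlternatingMap.alternatizeUncurryFinCLM ℝ (Euc d) _)

/-- The interior product, as a bilinear map. -/
def _root_.DoubleForms.intFormL (d k m : ℕ) :
    DForm (Euc d) ℂ (k + 1) m →L[ℝ] Euc d →L[ℝ] DForm (Euc d) ℂ k m :=
  (ContinuousAlternatingMap.curryLeftLI (𝕜 := ℝ) (E := Euc d)
    (F := Euc d [⋀^Fin m]→L[ℝ] ℂ)).toContinuousLinearMap

/-- The symbol of `δ` is `-i i_{ξ♯}`. -/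
theorem coD {G : MetricField d} (hG : IsMetricAt G p.s p.x) :
    HasSymbol p p (coD G p.s) 1 (-contr (sharp G p.x p.ξ)) := fun r ψ η h k m => by
  have h1 (j : Fin d) := (((h (k + 1) m).covDeriv (hG.contDiffWithinAt_christoffel
    p.uniqueDiffOn p.mem)).clm (ContinuousLinearMap.apply ℝ _ (EuclideanSpace.single j 1))).clm_apply₂
      (intFormL d k m) (hG.contDiffWithinAt_sharp (EuclideanSpace.proj j))
  have h2 := (HasLeadingTerm.sum Finset.univ fun j _ => h1 j).neg
  convert h2 using 1
  · funext y
    simp only [DoubleForms.coD, Pi.neg_apply, Finset.sum_apply]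
    rfl
  · have h3 : contr (sharp G p.x p.ξ) η k m = intFormL d k m (η (k + 1) m) (sharp G p.x p.ξ) := rfl
    change -contr (sharp G p.x p.ξ) η k m = _
    rw [h3, IsMetricAt.sharp_eq_sum, map_sum]
    congr 1
    refine Finset.sum_congr rfl fun j _ => ?_
    rw [map_smul, ContinuousLinearMap.apply_apply, ContinuousLinearMap.smulRight_apply, map_smul]
    rfl

theorem extDV {G : MetricField d} (hG : IsMetricAt G p.s p.x) :
    HasSymbol p p (extDV G p.s) 1 (extMulV p.ξ) :=
  (transpose p).comp ((extD hG).comp (transpose p) rfl) rfl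

theorem coDV {G : MetricField d} (hG : IsMetricAt G p.s p.x) :
    HasSymbol p p (coDV G p.s) 1 (-contrV (sharp G p.x p.ξ)) :=
  ((transpose p).comp ((coD hG).comp (transpose p) rfl) rfl).congr fun η => by
    simp [contrV]

/-- The principal symbol, in the sense of evaluation on powers of a linear function. -/
theorem principalSymbol_eq (hA : HasSymbol p q A N P) (η : GForm d) :
    principalSymbol (fun ψ => evalAt (A ψ) q.x) N p.x p.ξ η = (Complex.I ^ N) • P η := by
  have h : HasLeading p (0 + N) (fun k m z => ((p.ξ (z - p.x)) ^ N : ℝ) • η k m)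
      ((N.factorial : ℂ) • η) := fun k m => by
    refine ⟨fun _ => (N.factorial : ℂ) • η k m, contDiffWithinAt_const,
      Filter.Eventually.of_forall fun z => ?_, rfl⟩
    have hN : (N.factorial : ℂ) ≠ 0 := by exact_mod_cast N.factorial_ne_zero
    ext X Y
    simp
    field_simp
  have hN : (N.factorial : ℂ) ≠ 0 := by exact_mod_cast N.factorial_ne_zero
  rw [principalSymbol, (hA 0 _ _ h).eval, map_smul, smul_smul, div_mul_cancel₀ _ hN]

end HasSymbol

end Symbols

/-! ### Symbols of the geometric operators -/

section GeometricSymbols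

variable {n : ℕ}

/-- The geometric data `L` come from smooth data near the point `x` of the half-space. -/
structure LocalData.IsRegularAt (L : LocalData n) (x : Euc (n + 1)) : Prop where
  mem : x ∈ LocalData.halfSpace n
  metric : IsMetricAt L.G (LocalData.halfSpace n) x
  smooth_D : ∀ k m, ContDiffWithinAt ℝ ∞ (L.D k m) (LocalData.halfSpace n) x
  smooth_Dst : ∀ k m, ContDiffWithinAt ℝ ∞ (L.Dst k m) (LocalData.halfSpace n) x
  smooth_S : ∀ k m, ContDiffWithinAt ℝ ∞ (L.S k m) (LocalData.halfSpace n) x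
  smooth_Sst : ∀ k m, ContDiffWithinAt ℝ ∞ (L.Sst k m) (LocalData.halfSpace n) x

/-- A covector at a point of the half-space. -/
def halfCov (x : Euc (n + 1)) (hx : x ∈ LocalData.halfSpace n) (ξ : Euc (n + 1) →L[ℝ] ℝ) :
    Cov (n + 1) := ⟨LocalData.halfSpace n, x, ξ, (𝓡∂ (n + 1)).uniqueDiffOn, hx⟩

/-- A covector at a point of the boundary hyperplane. -/
def planeCov (y : Euc n) (ξ : Euc n →L[ℝ] ℝ) : Cov n := ⟨univ, y, ξ, uniqueDiffOn_univ, mem_univ y⟩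

theorem contDiffWithinAt_cplx {k m k' m' : ℕ} {d : ℕ} {s : Set (Euc d)} {x : Euc d}
    {T : Euc d → DForm (Euc d) ℝ k m →L[ℝ] DForm (Euc d) ℝ k' m'}
    (hT : ContDiffWithinAt ℝ ∞ T s x) : ContDiffWithinAt ℝ ∞ (fun y => cplx (T y)) s x :=
  (contDiffWithinAt_const.clm_comp (hT.clm_comp contDiffWithinAt_const)).add
    (contDiffWithinAt_const.clm_comp (hT.clm_comp contDiffWithinAt_const))

/-- Operators of order zero do not contribute to leading terms two orders up. -/
theorem HasLeadingTerm.cplx_apply {d k m k' m' r : ℕ} {p : Cov d}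
    {T : Euc d → DForm (Euc d) ℝ k m →L[ℝ] DForm (Euc d) ℝ k' m'}
    (hT : ContDiffWithinAt ℝ ∞ T p.s p.x) {f : Euc d → DForm (Euc d) ℂ k m}
    {v : DForm (Euc d) ℂ k m} (hf : HasLeadingTerm p (r + 2) f v) :
    HasLeadingTerm p r (fun y => cplx (T y) (f y)) 0 := by
  have h := HasLeadingTerm.clm_apply (E := DForm (Euc d) ℂ k m) (F := DForm (Euc d) ℂ k' m')
    (contDiffWithinAt_cplx hT) hf.lower.lower
  rwa [map_zero] at h

namespace LocalData

variable {L : LocalData n} {x : Euc (n + 1)}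

theorem hasSymbol_opD (hL : L.IsRegularAt x) (ξ : Euc (n + 1) →L[ℝ] ℝ) :
    HasSymbol (halfCov x hL.mem ξ) (halfCov x hL.mem ξ) L.opD 2 0 := fun r ψ η h k m => by
  match k, m with
  | 0, _ => exact HasLeadingTerm.zero _ r
  | _ + 1, 0 => exact HasLeadingTerm.zero _ r
  | k + 1, m + 1 =>
    exact (h k m).cplx_apply (p := halfCov x hL.mem ξ) (hL.smooth_D k m)

theorem hasSymbol_opDst (hL : L.IsRegularAt x) (ξ : Euc (n + 1) →L[ℝ] ℝ) :
    HasSymbol (halfCov x hL.mem ξ) (halfCov x hL.mem ξ) L.opDst 2 0 := fun r ψ η h k m => by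
  exact (h (k + 1) (m + 1)).cplx_apply (p := halfCov x hL.mem ξ) (hL.smooth_Dst k m)

theorem hasSymbol_opS (hL : L.IsRegularAt x) (ξ : Euc (n + 1) →L[ℝ] ℝ) :
    HasSymbol (halfCov x hL.mem ξ) (halfCov x hL.mem ξ) L.opS 2 0 := fun r ψ η h k m => by
  match k with
  | 0 => exact HasLeadingTerm.zero _ r
  | k + 1 => exact (h k (m + 1)).cplx_apply (p := halfCov x hL.mem ξ) (hL.smooth_S k m)

theorem hasSymbol_opSst (hL : L.IsRegularAt x) (ξ : Euc (n + 1) →L[ℝ] ℝ) :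
    HasSymbol (halfCov x hL.mem ξ) (halfCov x hL.mem ξ) L.opSst 2 0 := fun r ψ η h k m => by
  match m with
  | 0 => exact HasLeadingTerm.zero _ r
  | m + 1 => exact (h (k + 1) m).cplx_apply (p := halfCov x hL.mem ξ) (hL.smooth_Sst k m)

theorem half_smul_add_self {U : Type*} [AddCommGroup U] [Module ℂ U] (u : U) :
    ((1 / 2 : ℝ) : ℂ) • (u + u) = u := by
  rw [← two_smul ℂ u, smul_smul]
  norm_num

theorem hasSymbol_H (hL : L.IsRegularAt x) (ξ : Euc (n + 1) →L[ℝ] ℝ) :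
    HasSymbol (halfCov x hL.mem ξ) (halfCov x hL.mem ξ) L.H 2 (extMul ξ ∘ₗ extMulV ξ) := by
  have hd := HasSymbol.extD (p := halfCov x hL.mem ξ) hL.metric
  have hdV := HasSymbol.extDV (p := halfCov x hL.mem ξ) hL.metric
  refine ((((hdV.comp hd rfl).add (hd.comp hdV rfl)).smul (1 / 2)).add
    (hasSymbol_opD hL ξ)).congr fun η => ?_
  simp only [LinearMap.add_apply, LinearMap.smul_apply, LinearMap.comp_apply,
    add_zero, extMulV_extMul]
  exact half_smul_add_self _

theorem hasSymbol_Hst (hL : L.IsRegularAt x) (ξ : Euc (n + 1) →L[ℝ] ℝ) :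
    HasSymbol (halfCov x hL.mem ξ) (halfCov x hL.mem ξ) L.Hst 2
      (contr (sharp L.G x ξ) ∘ₗ contrV (sharp L.G x ξ)) := by
  have hd := HasSymbol.coD (p := halfCov x hL.mem ξ) hL.metric
  have hdV := HasSymbol.coDV (p := halfCov x hL.mem ξ) hL.metric
  refine ((((hd.comp hdV rfl).add (hdV.comp hd rfl)).smul (1 / 2)).add
    (hasSymbol_opDst hL ξ)).congr fun η => ?_
  simp only [LinearMap.add_apply, LinearMap.smul_apply, LinearMap.comp_apply,
    add_zero, LinearMap.neg_apply, map_neg, neg_neg, contrV_contr]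
  exact half_smul_add_self _

theorem hasSymbol_F (hL : L.IsRegularAt x) (ξ : Euc (n + 1) →L[ℝ] ℝ) :
    HasSymbol (halfCov x hL.mem ξ) (halfCov x hL.mem ξ) L.F 2
      (-(extMul ξ ∘ₗ contrV (sharp L.G x ξ))) := by
  have hd := HasSymbol.extD (p := halfCov x hL.mem ξ) hL.metric
  have hdV := HasSymbol.coDV (p := halfCov x hL.mem ξ) hL.metric
  refine ((((hd.comp hdV rfl).add (hdV.comp hd rfl)).smul (1 / 2)).add
    (hasSymbol_opS hL ξ)).congr fun η => ?_
  simp only [LinearMap.add_apply, LinearMap.smul_apply, LinearMap.comp_apply,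
    add_zero, LinearMap.neg_apply, map_neg, contrV_extMul]
  exact half_smul_add_self _

theorem hasSymbol_Fst (hL : L.IsRegularAt x) (ξ : Euc (n + 1) →L[ℝ] ℝ) :
    HasSymbol (halfCov x hL.mem ξ) (halfCov x hL.mem ξ) L.Fst 2
      (-(extMulV ξ ∘ₗ contr (sharp L.G x ξ))) := by
  have hd := HasSymbol.coD (p := halfCov x hL.mem ξ) hL.metric
  have hdV := HasSymbol.extDV (p := halfCov x hL.mem ξ) hL.metric
  refine ((((hdV.comp hd rfl).add (hd.comp hdV rfl)).smul (1 / 2)).add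
    (hasSymbol_opSst hL ξ)).congr fun η => ?_
  simp only [LinearMap.add_apply, LinearMap.smul_apply, LinearMap.comp_apply,
    add_zero, LinearMap.neg_apply, map_neg, extMulV_contr]
  exact half_smul_add_self _

/-- The symbol of the double bilaplacian is `|ξ|⁴`: with `E = ξ ∧` and `ι = i_{ξ♯}` acting on
either factor it is `(E ι + ι E) (E_V ι_V + ι_V E_V)`. -/
theorem hasSymbol_bilaplacian (hL : L.IsRegularAt x) (ξ : Euc (n + 1) →L[ℝ] ℝ) :
    HasSymbol (halfCov x hL.mem ξ) (halfCov x hL.mem ξ) L.bilaplacian 4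
      (((ξ (sharp L.G x ξ) : ℂ) ^ 2) • LinearMap.id) := by
  have hH := hasSymbol_H hL ξ
  have hHst := hasSymbol_Hst hL ξ
  have hF := hasSymbol_F hL ξ
  have hFst := hasSymbol_Fst hL ξ
  refine ((((hH.comp hHst rfl).add (hHst.comp hH rfl)).add (hFst.comp hF rfl)).add
    (hF.comp hFst rfl)).congr fun η => ?_
  simp only [LinearMap.add_apply, LinearMap.smul_apply, LinearMap.comp_apply, LinearMap.id_apply,
    LinearMap.neg_apply, map_neg, neg_neg, contrV_extMul, contr_extMul, contrV_extMulV,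
    extMulV_contr, extMulV_extMul, map_sub, map_smul]
  simp only [← extMulV_contr, contrV_extMulV, contrV_contr, map_sub, map_smul]
  module

end LocalData

end GeometricSymbols

/-! ### The boundary metric and the unit normal -/

section BoundaryGeometry

variable {n : ℕ}

theorem bdry_mem_halfSpace (y : Euc n) : bdry n y ∈ LocalData.halfSpace n := by
  rw [LocalData.halfSpace, range_modelWithCornersEuclideanHalfSpace]
  exact le_of_eq (bdry_zero y).symm

theorem bdry_injective : Function.Injective (bdry n) := fun u v h => by
  ext i
  rw [← bdry_succ u i, ← bdry_succ v i, h]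

theorem bdry_tail {v : Euc (n + 1)} (hv : v 0 = 0) :
    bdry n (WithLp.toLp 2 fun i => v i.succ) = v := by
  ext i
  refine Fin.cases ?_ (fun j => ?_) i
  · rw [bdry_zero, hv]
  · rw [bdry_succ]

namespace LocalData

variable {L : LocalData n} {x : Euc (n + 1)} {y : Euc n}

theorem dx0_ne_zero (n : ℕ) : dx0 n ≠ 0 := fun h => by
  have := congrArg (fun f => f (EuclideanSpace.single 0 1)) h
  simp [dx0] at this

theorem IsRegularAt.dx0_sharp_pos (hL : L.IsRegularAt x) :
    0 < dx0 n (sharp L.G x (dx0 n)) := hL.metric.apply_sharp_pos (dx0_ne_zero n)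

theorem IsRegularAt.isConormalPair (hL : L.IsRegularAt x) :
    IsConormalPair (L.dr x) (L.normal x) where
  apply_bdry v := by
    simp [dr, dx0, bdry_zero]
  apply_normal := by
    have h := hL.dx0_sharp_pos
    have hs : sharp L.G x (L.dr x) =
        (Real.sqrt (dx0 n (sharp L.G x (dx0 n))))⁻¹ • sharp L.G x (dx0 n) := by
      simp [dr, sharp]
    rw [normal, hs, map_smul, dr, _root_.smul_apply, smul_eq_mul, smul_eq_mul, ← mul_assoc,
      ← mul_inv, Real.mul_self_sqrt h.le, inv_mul_cancel₀ h.ne']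

theorem IsRegularAt.contDiffWithinAt_normal (hL : L.IsRegularAt x) :
    ContDiffWithinAt ℝ ∞ L.normal (halfSpace n) x := by
  have h0 : ContDiffWithinAt ℝ ∞ (fun z => dx0 n (sharp L.G z (dx0 n))) (halfSpace n) x :=
    (dx0 n).contDiff.comp_contDiffWithinAt (hL.metric.contDiffWithinAt_sharp (dx0 n))
  have h1 : ContDiffWithinAt ℝ ∞ L.dr (halfSpace n) x :=
    ((h0.sqrt hL.dx0_sharp_pos.ne').inv (Real.sqrt_pos.2 hL.dx0_sharp_pos).ne').smul
      contDiffWithinAt_const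
  exact hL.metric.contDiffWithinAt_inverse.clm_apply h1

theorem IsRegularAt.isMetricAt_G₀ (hL : L.IsRegularAt (bdry n y)) :
    IsMetricAt L.G₀ univ y where
  contDiffWithinAt := by
    have hG : ContDiffWithinAt ℝ ∞ (fun y => L.G (bdry n y)) univ y :=
      hL.metric.contDiffWithinAt.comp y (bdry n).contDiff.contDiffWithinAt
        (fun z _ => bdry_mem_halfSpace z)
    have h1 : ContDiffWithinAt ℝ ∞ (fun y =>
        ((ContinuousLinearMap.compL ℝ (Euc n) (Euc (n + 1)) ℝ).flip (bdry n)) ∘L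
          (L.G (bdry n y) ∘L bdry n)) univ y :=
      contDiffWithinAt_const.clm_comp (hG.clm_comp contDiffWithinAt_const)
    exact h1
  symm u v := hL.metric.symm _ _
  pos v hv := hL.metric.pos _ fun h => hv (bdry_injective (h.trans (map_zero (bdry n)).symm))

/-- For a covector tangential to the boundary, `♯` commutes with the restriction to the
boundary. -/
theorem IsRegularAt.sharp_eq_bdry_sharp (hL : L.IsRegularAt (bdry n y))
    {ξ : Euc (n + 1) →L[ℝ] ℝ} (hξ : ξ (L.normal (bdry n y)) = 0) :
    sharp L.G (bdry n y) ξ = bdry n (sharp L.G₀ y (ξ ∘L bdry n)) := by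
  have h0 : sharp L.G (bdry n y) ξ 0 = 0 := by
    refine hL.isConormalPair.eq_zero_of_apply_eq_zero ?_
    rw [hL.metric.apply_sharp_comm]
    exact hξ
  rw [← hL.isMetricAt_G₀.eq_sharp
    (v := WithLp.toLp 2 fun i => sharp L.G (bdry n y) ξ i.succ), bdry_tail h0]
  refine ContinuousLinearMap.ext fun u => ?_
  change L.G (bdry n y) (bdry n _) (bdry n u) = ξ (bdry n u)
  rw [bdry_tail h0, hL.metric.apply_sharp]

/-! ### Symbols of the boundary operators -/

theorem _root_.DoubleForms.HasLeadingTerm.intForm {d k m r : ℕ} {p : Cov d}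
    {f : Euc d → DForm (Euc d) ℂ (k + 1) m} {v : DForm (Euc d) ℂ (k + 1) m} {N : Euc d → Euc d}
    (hN : ContDiffWithinAt ℝ ∞ N p.s p.x) (hf : HasLeadingTerm p r f v) :
    HasLeadingTerm p r (fun z => intForm (N z) (f z)) (intForm (N p.x) v) :=
  HasLeadingTerm.clm_apply₂ (E := DForm (Euc d) ℂ (k + 1) m) (F := Euc d)
    (H := DForm (Euc d) ℂ k m) (intFormL d k m) hN hf

theorem _root_.DoubleForms.HasLeadingTerm.transp {d k m r : ℕ} {p : Cov d}
    {f : Euc d → DForm (Euc d) ℂ k m} {v : DForm (Euc d) ℂ k m} (hf : HasLeadingTerm p r f v) :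
    HasLeadingTerm p r (fun z => transp (f z)) (transp v) :=
  HasLeadingTerm.clm (DoubleForms.transp (V := Euc d) (k := k) (m := m)) hf

/-- Leading terms are preserved by the pullback to the boundary, provided that the boundary
covector `ζ` is the restriction of `ξ`. -/
theorem _root_.DoubleForms.HasLeadingTerm.pull_bdry {k m r : ℕ} {x : Euc (n + 1)}
    {hx : x ∈ halfSpace n} (hxy : bdry n y = x) {ξ : Euc (n + 1) →L[ℝ] ℝ} {ζ : Euc n →L[ℝ] ℝ}
    (hζ : ∀ u, ζ u = ξ (bdry n u))
    {f : Euc (n + 1) → DForm (Euc (n + 1)) ℂ k m} {v : DForm (Euc (n + 1)) ℂ k m}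
    (hf : HasLeadingTerm (halfCov x hx ξ) r f v) :
    HasLeadingTerm (planeCov y ζ) r (fun y => pull (bdry n) (f (bdry n y))) (pull (bdry n) v) :=
  HasLeadingTerm.comp_bdry (q := planeCov y ζ)
    (HasLeadingTerm.clm (pull (V := Euc n) (W := Euc (n + 1)) (F := ℂ) (bdry n)) hf)
    (fun z _ => bdry_mem_halfSpace z) hxy hζ

theorem hasSymbol_Ptt (hL : L.IsRegularAt (bdry n y)) {ξ : Euc (n + 1) →L[ℝ] ℝ}
    {ζ : Euc n →L[ℝ] ℝ} (hζ : ∀ u, ζ u = ξ (bdry n u)) :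
    HasSymbol (halfCov (bdry n y) hL.mem ξ) (planeCov y ζ) L.Ptt 0 (compTT n) :=
  HasSymbol.of_order_zero fun _ _ _ h k m => (h k m).pull_bdry rfl hζ

theorem hasSymbol_intForm_normal (hL : L.IsRegularAt x) (ξ : Euc (n + 1) →L[ℝ] ℝ) :
    HasSymbol (halfCov x hL.mem ξ) (halfCov x hL.mem ξ)
      (fun ψ k m z => intForm (L.normal z) (ψ (k + 1) m z)) 0 (contr (L.normal x)) :=
  HasSymbol.of_order_zero fun _ _ _ h k m =>
    HasLeadingTerm.intForm (p := halfCov x hL.mem ξ) hL.contDiffWithinAt_normal (h (k + 1) m)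

theorem hasSymbol_Pnt (hL : L.IsRegularAt (bdry n y)) {ξ : Euc (n + 1) →L[ℝ] ℝ}
    {ζ : Euc n →L[ℝ] ℝ} (hζ : ∀ u, ζ u = ξ (bdry n u)) :
    HasSymbol (halfCov (bdry n y) hL.mem ξ) (planeCov y ζ) L.Pnt 0
      (compNT (L.normal (bdry n y))) := by
  have h := (hasSymbol_Ptt hL hζ).comp (hasSymbol_intForm_normal hL ξ) rfl
  exact h

theorem hasSymbol_intVec_normal (hL : L.IsRegularAt x) (ξ : Euc (n + 1) →L[ℝ] ℝ) :
    HasSymbol (halfCov x hL.mem ξ) (halfCov x hL.mem ξ)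
      (fun ψ k m z => intVec (L.normal z) (ψ k (m + 1) z)) 0 (contrV (L.normal x)) :=
  HasSymbol.of_order_zero fun _ _ _ h k m =>
    ((h k (m + 1)).transp.intForm (p := halfCov x hL.mem ξ) hL.contDiffWithinAt_normal).transp

theorem hasSymbol_Ptn (hL : L.IsRegularAt (bdry n y)) {ξ : Euc (n + 1) →L[ℝ] ℝ}
    {ζ : Euc n →L[ℝ] ℝ} (hζ : ∀ u, ζ u = ξ (bdry n u)) :
    HasSymbol (halfCov (bdry n y) hL.mem ξ) (planeCov y ζ) L.Ptn 0
      (compTN (L.normal (bdry n y))) := by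
  have h := (hasSymbol_Ptt hL hζ).comp (hasSymbol_intVec_normal hL ξ) rfl
  exact h

theorem hasSymbol_Pnn (hL : L.IsRegularAt (bdry n y)) {ξ : Euc (n + 1) →L[ℝ] ℝ}
    {ζ : Euc n →L[ℝ] ℝ} (hζ : ∀ u, ζ u = ξ (bdry n u)) :
    HasSymbol (halfCov (bdry n y) hL.mem ξ) (planeCov y ζ) L.Pnn 0
      (compNN (L.normal (bdry n y))) := by
  have h := (hasSymbol_Ptt hL hζ).comp
    ((hasSymbol_intForm_normal hL ξ).comp (hasSymbol_intVec_normal hL ξ) rfl) rfl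
  exact h

end LocalData

end BoundaryGeometry

/-! ### Components of the exterior and interior products -/

section ComponentRelations

variable {n : ℕ} {ρ ξ : Euc (n + 1) →L[ℝ] ℝ} {N : Euc (n + 1)}

namespace IsConormalPair

theorem shift_comp_bdry (h : IsConormalPair ρ N) (ξ : Euc (n + 1) →L[ℝ] ℝ) (t : ℝ) :
    (ξ + t • ρ) ∘L bdry n = ξ ∘L bdry n := by
  ext v
  simp [h.apply_bdry]

theorem shift_apply_normal (h : IsConormalPair ρ N) (hξ : ξ N = 0) (t : ℝ) :
    (ξ + t • ρ) N = t := by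
  simp [hξ, h.apply_normal]

theorem compTT_extMul (h : IsConormalPair ρ N) (t : ℝ) (η : GForm (n + 1)) :
    compTT n (extMul (ξ + t • ρ) η) = extMul (ξ ∘L bdry n) (compTT n η) := by
  rw [compTT, pullG_extMul, h.shift_comp_bdry]

theorem compTT_extMulV (h : IsConormalPair ρ N) (t : ℝ) (η : GForm (n + 1)) :
    compTT n (extMulV (ξ + t • ρ) η) = extMulV (ξ ∘L bdry n) (compTT n η) := by
  rw [compTT, pullG_extMulV, h.shift_comp_bdry]

theorem compNT_extMul (h : IsConormalPair ρ N) (hξ : ξ N = 0) (t : ℝ) (η : GForm (n + 1)) :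
    compNT N (extMul (ξ + t • ρ) η) =
      (t : ℂ) • compTT n η - extMul (ξ ∘L bdry n) (compNT N η) := by
  rw [compNT, LinearMap.comp_apply, contr_extMul, map_sub, map_smul, h.shift_apply_normal hξ]
  exact congrArg _ (h.compTT_extMul t _)

theorem compTN_extMulV (h : IsConormalPair ρ N) (hξ : ξ N = 0) (t : ℝ) (η : GForm (n + 1)) :
    compTN N (extMulV (ξ + t • ρ) η) =
      (t : ℂ) • compTT n η - extMulV (ξ ∘L bdry n) (compTN N η) := by
  rw [compTN, LinearMap.comp_apply, contrV_extMulV, map_sub, map_smul, h.shift_apply_normal hξ]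
  exact congrArg _ (h.compTT_extMulV t _)

theorem compTN_extMul (h : IsConormalPair ρ N) (t : ℝ) (η : GForm (n + 1)) :
    compTN N (extMul (ξ + t • ρ) η) = extMul (ξ ∘L bdry n) (compTN N η) := by
  rw [compTN, LinearMap.comp_apply, contrV_extMul]
  exact h.compTT_extMul t _

theorem compNT_extMulV (h : IsConormalPair ρ N) (t : ℝ) (η : GForm (n + 1)) :
    compNT N (extMulV (ξ + t • ρ) η) = extMulV (ξ ∘L bdry n) (compNT N η) := by
  rw [compNT, LinearMap.comp_apply, ← extMulV_contr]
  exact h.compTT_extMulV t _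

theorem compNN_extMul (h : IsConormalPair ρ N) (hξ : ξ N = 0) (t : ℝ) (η : GForm (n + 1)) :
    compNN N (extMul (ξ + t • ρ) η) =
      (t : ℂ) • compTN N η - extMul (ξ ∘L bdry n) (compNN N η) := by
  have e (ζ : GForm (n + 1)) : compNN N ζ = compNT N (contrV N ζ) := rfl
  rw [e, contrV_extMul, h.compNT_extMul hξ]
  rfl

theorem compNN_extMulV (h : IsConormalPair ρ N) (hξ : ξ N = 0) (t : ℝ) (η : GForm (n + 1)) :
    compNN N (extMulV (ξ + t • ρ) η) =
      (t : ℂ) • compNT N η - extMulV (ξ ∘L bdry n) (compNN N η) := by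
  have e (ζ : GForm (n + 1)) : compNN N ζ = compTN N (contr N ζ) := rfl
  rw [e, ← extMulV_contr, h.compTN_extMulV hξ]
  rfl

end IsConormalPair

theorem compTT_contr (w : Euc n) (N : Euc (n + 1)) (t : ℝ) (η : GForm (n + 1)) :
    compTT n (contr (bdry n w + t • N) η) = contr w (compTT n η) + (t : ℂ) • compNT N η := by
  rw [contr_add_smul, map_add, map_smul, compTT, pullG_contr]
  rfl

theorem compTT_contrV (w : Euc n) (N : Euc (n + 1)) (t : ℝ) (η : GForm (n + 1)) :
    compTT n (contrV (bdry n w + t • N) η) = contrV w (compTT n η) + (t : ℂ) • compTN N η := by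
  rw [contrV_add_smul, map_add, map_smul, compTT, pullG_contrV]
  rfl

theorem contr_anticomm (u v : Euc (n + 1)) (η : GForm (n + 1)) :
    contr u (contr v η) = -contr v (contr u η) := by
  have h := contr_contr (u + (1 : ℝ) • v) η
  rw [contr_add_smul u v 1 (contr (u + (1 : ℝ) • v) η), contr_add_smul u v 1 η] at h
  simp only [map_add, contr_contr, Complex.ofReal_one, one_smul, zero_add, add_zero] at h
  exact eq_neg_of_add_eq_zero_left h

theorem compNT_contr (w : Euc n) (N : Euc (n + 1)) (t : ℝ) (η : GForm (n + 1)) :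
    compNT N (contr (bdry n w + t • N) η) = -contr w (compNT N η) := by
  rw [compNT, LinearMap.comp_apply, contr_anticomm, map_neg]
  have h := compTT_contr w N t (contr N η)
  have h0 : compNT N (contr N η) = 0 := by
    rw [compNT, LinearMap.comp_apply, contr_contr, map_zero]
  rw [h0, smul_zero, add_zero] at h
  exact congrArg _ h

theorem compTN_contrV (w : Euc n) (N : Euc (n + 1)) (t : ℝ) (η : GForm (n + 1)) :
    compTN N (contrV (bdry n w + t • N) η) = -contrV w (compTN N η) :=
  congrArg transG (compNT_contr w N t (transG η))

theorem compTN_contr (w : Euc n) (N : Euc (n + 1)) (t : ℝ) (η : GForm (n + 1)) :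
    compTN N (contr (bdry n w + t • N) η) = contr w (compTN N η) + (t : ℂ) • compNN N η :=
  compTT_contr w N t (contrV N η)

theorem compNT_contrV (w : Euc n) (N : Euc (n + 1)) (t : ℝ) (η : GForm (n + 1)) :
    compNT N (contrV (bdry n w + t • N) η) = contrV w (compNT N η) + (t : ℂ) • compNN N η :=
  compTT_contrV w N t (contr N η)

theorem compNN_contr (w : Euc n) (N : Euc (n + 1)) (t : ℝ) (η : GForm (n + 1)) :
    compNN N (contr (bdry n w + t • N) η) = -contr w (compNN N η) :=
  compNT_contr w N t (contrV N η)

theorem compNN_contrV (w : Euc n) (N : Euc (n + 1)) (t : ℝ) (η : GForm (n + 1)) :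
    compNN N (contrV (bdry n w + t • N) η) = -contrV w (compNN N η) :=
  compTN_contrV w N t (contr N η)

end ComponentRelations

/-! ### Symbols of the first order boundary operators -/

section FirstOrder

variable {n : ℕ} {L : LocalData n} {y : Euc n} {ξ : Euc (n + 1) →L[ℝ] ℝ}

namespace LocalData

/-- Exterior multiplication in the form part with the boundary restriction of `ξ`. -/
abbrev bE (ξ : Euc (n + 1) →L[ℝ] ℝ) : GForm n →ₗ[ℂ] GForm n := extMul (ξ ∘L bdry n)

/-- Exterior multiplication in the vector part with the boundary restriction of `ξ`. -/
abbrev bEV (ξ : Euc (n + 1) →L[ℝ] ℝ) : GForm n →ₗ[ℂ] GForm n := extMulV (ξ ∘L bdry n)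

/-- Interior product in the form part with the boundary restriction of `ξ`. -/
abbrev bI (L : LocalData n) (y : Euc n) (ξ : Euc (n + 1) →L[ℝ] ℝ) : GForm n →ₗ[ℂ] GForm n :=
  contr (sharp L.G₀ y (ξ ∘L bdry n))

/-- Interior product in the vector part with the boundary restriction of `ξ`. -/
abbrev bIV (L : LocalData n) (y : Euc n) (ξ : Euc (n + 1) →L[ℝ] ℝ) : GForm n →ₗ[ℂ] GForm n :=
  contrV (sharp L.G₀ y (ξ ∘L bdry n))

/-- The component `nt` with respect to the unit normal at `y`. -/
abbrev cNT (L : LocalData n) (y : Euc n) : GForm (n + 1) →ₗ[ℂ] GForm n :=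
  compNT (L.normal (bdry n y))

/-- The component `tn` with respect to the unit normal at `y`. -/
abbrev cTN (L : LocalData n) (y : Euc n) : GForm (n + 1) →ₗ[ℂ] GForm n :=
  compTN (L.normal (bdry n y))

/-- The component `nn` with respect to the unit normal at `y`. -/
abbrev cNN (L : LocalData n) (y : Euc n) : GForm (n + 1) →ₗ[ℂ] GForm n :=
  compNN (L.normal (bdry n y))

/-- The covector `ξ + t dr` at the boundary point `y`. -/
abbrev shift (L : LocalData n) (y : Euc n) (ξ : Euc (n + 1) →L[ℝ] ℝ) (t : ℝ) :
    Euc (n + 1) →L[ℝ] ℝ := ξ + t • L.dr (bdry n y)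

theorem IsRegularAt.shift_bdry (hL : L.IsRegularAt (bdry n y)) (ξ : Euc (n + 1) →L[ℝ] ℝ) (t : ℝ)
    (u : Euc n) : (ξ ∘L bdry n) u = L.shift y ξ t (bdry n u) := by
  simp [hL.isConormalPair.apply_bdry]

theorem IsRegularAt.sharp_shift (hL : L.IsRegularAt (bdry n y))
    (hξ : ξ (L.normal (bdry n y)) = 0) (t : ℝ) :
    sharp L.G (bdry n y) (L.shift y ξ t) =
      bdry n (sharp L.G₀ y (ξ ∘L bdry n)) + t • L.normal (bdry n y) := by
  rw [IsMetricAt.sharp_add_smul, hL.sharp_eq_bdry_sharp hξ]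
  rfl

/-- The covector `ξ + t dr` at a boundary point, as a covector of the half-space. -/
abbrev shiftCov (hL : L.IsRegularAt (bdry n y)) (ξ : Euc (n + 1) →L[ℝ] ℝ) (t : ℝ) : Cov (n + 1) :=
  halfCov (bdry n y) hL.mem (L.shift y ξ t)

/-- The boundary restriction of `ξ`. -/
abbrev restrCov (y : Euc n) (ξ : Euc (n + 1) →L[ℝ] ℝ) : Cov n := planeCov y (ξ ∘L bdry n)

theorem hasSymbol_T (hL : L.IsRegularAt (bdry n y)) (hξ : ξ (L.normal (bdry n y)) = 0) (t : ℝ) :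
    HasSymbol (shiftCov hL ξ t) (restrCov y ξ) L.T 1
      ((t : ℂ) • compTT n - bE ξ ∘ₗ L.cNT y - bEV ξ ∘ₗ L.cTN y) := by
  have hd := HasSymbol.extD (p := shiftCov hL ξ t) hL.metric
  have hdV := HasSymbol.extDV (p := shiftCov hL ξ t) hL.metric
  have hd₀ := HasSymbol.extD (p := restrCov y ξ) hL.isMetricAt_G₀
  have hdV₀ := HasSymbol.extDV (p := restrCov y ξ) hL.isMetricAt_G₀
  have hnt := hasSymbol_Pnt hL (hL.shift_bdry ξ t)
  have htn := hasSymbol_Ptn hL (hL.shift_bdry ξ t)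
  refine ((((hnt.comp hd rfl).sub (hd₀.comp hnt rfl)).smul (1 / 2)).add
    (((htn.comp hdV rfl).sub (hdV₀.comp htn rfl)).smul (1 / 2))).congr fun η => ?_
  have e1 := hL.isConormalPair.compNT_extMul hξ t η
  have e2 := hL.isConormalPair.compTN_extMulV hξ t η
  simp only [LinearMap.add_apply, LinearMap.sub_apply, LinearMap.smul_apply, LinearMap.comp_apply,
    halfCov, planeCov, e1, e2]
  push_cast
  module

theorem hasSymbol_Tst (hL : L.IsRegularAt (bdry n y)) (hξ : ξ (L.normal (bdry n y)) = 0) (t : ℝ) :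
    HasSymbol (shiftCov hL ξ t) (restrCov y ξ) L.Tst 1
      ((t : ℂ) • L.cNN y + L.bI y ξ ∘ₗ L.cTN y + L.bIV y ξ ∘ₗ L.cNT y) := by
  have hd := HasSymbol.coD (p := shiftCov hL ξ t) hL.metric
  have hdV := HasSymbol.coDV (p := shiftCov hL ξ t) hL.metric
  have hd₀ := HasSymbol.coD (p := restrCov y ξ) hL.isMetricAt_G₀
  have hdV₀ := HasSymbol.coDV (p := restrCov y ξ) hL.isMetricAt_G₀
  have hnt := hasSymbol_Pnt hL (hL.shift_bdry ξ t)
  have htn := hasSymbol_Ptn hL (hL.shift_bdry ξ t)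
  refine (((((htn.comp hd rfl).add (hd₀.comp htn rfl)).smul (1 / 2)).neg).sub
    (((hnt.comp hdV rfl).add (hdV₀.comp hnt rfl)).smul (1 / 2))).congr fun η => ?_
  have e1 := compTN_contr (sharp L.G₀ y (ξ ∘L bdry n)) (L.normal (bdry n y)) t η
  have e2 := compNT_contrV (sharp L.G₀ y (ξ ∘L bdry n)) (L.normal (bdry n y)) t η
  simp only [LinearMap.add_apply, LinearMap.sub_apply, LinearMap.smul_apply, LinearMap.comp_apply,
    LinearMap.neg_apply, map_neg, halfCov, planeCov, hL.sharp_shift hξ, e1, e2]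
  push_cast
  module

theorem hasSymbol_Fbst (hL : L.IsRegularAt (bdry n y)) (hξ : ξ (L.normal (bdry n y)) = 0)
    (t : ℝ) : HasSymbol (shiftCov hL ξ t) (restrCov y ξ) L.Fbst 1
      ((t : ℂ) • L.cNT y - bEV ξ ∘ₗ L.cNN y + L.bI y ξ ∘ₗ compTT n) := by
  have hd := HasSymbol.coD (p := shiftCov hL ξ t) hL.metric
  have hdV := HasSymbol.extDV (p := shiftCov hL ξ t) hL.metric
  have hd₀ := HasSymbol.coD (p := restrCov y ξ) hL.isMetricAt_G₀
  have hdV₀ := HasSymbol.extDV (p := restrCov y ξ) hL.isMetricAt_G₀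
  have hnn := hasSymbol_Pnn hL (hL.shift_bdry ξ t)
  have htt := hasSymbol_Ptt hL (hL.shift_bdry ξ t)
  refine ((((hnn.comp hdV rfl).sub (hdV₀.comp hnn rfl)).smul (1 / 2)).sub
    (((htt.comp hd rfl).add (hd₀.comp htt rfl)).smul (1 / 2))).congr fun η => ?_
  have e1 := compTT_contr (sharp L.G₀ y (ξ ∘L bdry n)) (L.normal (bdry n y)) t η
  have e2 := hL.isConormalPair.compNN_extMulV hξ t η
  simp only [LinearMap.add_apply, LinearMap.sub_apply, LinearMap.smul_apply, LinearMap.comp_apply,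
    LinearMap.neg_apply, map_neg, halfCov, planeCov, hL.sharp_shift hξ, e1, e2]
  push_cast
  module

theorem hasSymbol_Fb (hL : L.IsRegularAt (bdry n y)) (hξ : ξ (L.normal (bdry n y)) = 0)
    (t : ℝ) : HasSymbol (shiftCov hL ξ t) (restrCov y ξ) L.Fb 1
      ((t : ℂ) • L.cTN y - bE ξ ∘ₗ L.cNN y + L.bIV y ξ ∘ₗ compTT n) := by
  have hd := HasSymbol.extD (p := shiftCov hL ξ t) hL.metric
  have hdV := HasSymbol.coDV (p := shiftCov hL ξ t) hL.metric
  have hd₀ := HasSymbol.extD (p := restrCov y ξ) hL.isMetricAt_G₀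
  have hdV₀ := HasSymbol.coDV (p := restrCov y ξ) hL.isMetricAt_G₀
  have hnn := hasSymbol_Pnn hL (hL.shift_bdry ξ t)
  have htt := hasSymbol_Ptt hL (hL.shift_bdry ξ t)
  refine ((((hnn.comp hd rfl).sub (hd₀.comp hnn rfl)).smul (1 / 2)).sub
    (((htt.comp hdV rfl).add (hdV₀.comp htt rfl)).smul (1 / 2))).congr fun η => ?_
  have e1 := compTT_contrV (sharp L.G₀ y (ξ ∘L bdry n)) (L.normal (bdry n y)) t η
  have e2 := hL.isConormalPair.compNN_extMul hξ t η
  simp only [LinearMap.add_apply, LinearMap.sub_apply, LinearMap.smul_apply, LinearMap.comp_apply,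
    LinearMap.neg_apply, map_neg, halfCov, planeCov, hL.sharp_shift hξ, e1, e2]
  push_cast
  module

end LocalData

end FirstOrder

/-! ### The model boundary symbol -/

section Model

/-- The orders of the eight boundary operators. -/
def modelOrder : Fin 8 → ℕ
  | 0 => 0
  | 1 => 0
  | 2 => 0
  | 3 => 1
  | 4 => 1
  | 5 => 1
  | 6 => 2
  | 7 => 3

theorem modelOrder_le_three (r : Fin 8) : modelOrder r ≤ 3 := by
  fin_cases r <;> decide

/-- The coefficient of `tˡ` in the symbol of the `r`-th boundary operator at `ξ + t dr`, up to a
power of `i`.  The four boundary value problems differ only by the choice of the components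
`A, B, C, D` of double forms, of the operators `e, f, i, j` built from exterior and interior
products on the boundary, and of the sign `ε`. -/
def modelCoeff {W U : Type*} [AddCommGroup W] [Module ℂ W] [AddCommGroup U] [Module ℂ U]
    (A B C D : W →ₗ[ℂ] U) (e f i j : U →ₗ[ℂ] U) (ε : ℂ) : Fin 8 → ℕ → (W →ₗ[ℂ] U)
  | 0, _ => A
  | 1, _ => B
  | 2, _ => C
  | 3, 0 => -(e ∘ₗ C) - f ∘ₗ B
  | 3, _ => A
  | 4, 0 => i ∘ₗ A - f ∘ₗ D
  | 4, _ => C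
  | 5, 0 => j ∘ₗ A - e ∘ₗ D
  | 5, _ => B
  | 6, 0 => ε • (i ∘ₗ j ∘ₗ A)
  | 6, 1 => ε • (i ∘ₗ B + j ∘ₗ C)
  | 6, _ => ε • D
  | 7, 0 => ε • (e ∘ₗ i ∘ₗ j ∘ₗ C + f ∘ₗ i ∘ₗ j ∘ₗ B)
  | 7, 1 => ε • (i ∘ₗ j ∘ₗ A + e ∘ₗ i ∘ₗ D + f ∘ₗ j ∘ₗ D)
  | 7, 2 => ε • (i ∘ₗ B + j ∘ₗ C)
  | 7, _ => ε • D

/-- The symbol of the `r`-th boundary operator at `ξ + t dr`, up to a power of `i`. -/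
def modelSymbol {W U : Type*} [AddCommGroup W] [Module ℂ W] [AddCommGroup U] [Module ℂ U]
    (A B C D : W →ₗ[ℂ] U) (e f i j : U →ₗ[ℂ] U) (ε : ℂ) (t : ℝ) (r : Fin 8) : W →ₗ[ℂ] U :=
  ∑ l ∈ Finset.range (modelOrder r + 1), (t : ℂ) ^ l • modelCoeff A B C D e f i j ε r l

section ModelSymbol

variable {W U : Type*} [AddCommGroup W] [Module ℂ W] [AddCommGroup U] [Module ℂ U]
  (A B C D : W →ₗ[ℂ] U) (e f i j : U →ₗ[ℂ] U) (ε : ℂ) (t : ℝ) (w : W)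

theorem modelSymbol_zero : modelSymbol A B C D e f i j ε t 0 = A := by
  simp [modelSymbol, modelOrder, modelCoeff]

theorem modelSymbol_one : modelSymbol A B C D e f i j ε t 1 = B := by
  simp [modelSymbol, modelOrder, modelCoeff]

theorem modelSymbol_two : modelSymbol A B C D e f i j ε t 2 = C := by
  simp [modelSymbol, modelOrder, modelCoeff]

theorem modelSymbol_three : modelSymbol A B C D e f i j ε t 3 w =
    (t : ℂ) • A w - e (C w) - f (B w) := by
  simp [modelSymbol, modelOrder, modelCoeff, Finset.sum_range_succ]
  module

theorem modelSymbol_four : modelSymbol A B C D e f i j ε t 4 w =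
    (t : ℂ) • C w - f (D w) + i (A w) := by
  simp [modelSymbol, modelOrder, modelCoeff, Finset.sum_range_succ]
  module

theorem modelSymbol_five : modelSymbol A B C D e f i j ε t 5 w =
    (t : ℂ) • B w - e (D w) + j (A w) := by
  simp [modelSymbol, modelOrder, modelCoeff, Finset.sum_range_succ]
  module

theorem modelSymbol_six : modelSymbol A B C D e f i j ε t 6 w =
    ε • (i (j (A w)) + (t : ℂ) • (i (B w) + j (C w)) + (t : ℂ) ^ 2 • D w) := by
  simp [modelSymbol, modelOrder, modelCoeff, Finset.sum_range_succ]
  module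

theorem modelSymbol_seven : modelSymbol A B C D e f i j ε t 7 w =
    ε • (e (i (j (C w))) + f (i (j (B w))) + (t : ℂ) • (i (j (A w)) + e (i (D w)) + f (j (D w))) +
      (t : ℂ) ^ 2 • (i (B w) + j (C w)) + (t : ℂ) ^ 3 • D w) := by
  simp [modelSymbol, modelOrder, modelCoeff, Finset.sum_range_succ]
  module

end ModelSymbol

namespace LocalData

variable {n : ℕ} {L : LocalData n} {y : Euc n} {ξ : Euc (n + 1) →L[ℝ] ℝ}

theorem hasSymbol_boundaryTT_six (hL : L.IsRegularAt (bdry n y))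
    (hξ : ξ (L.normal (bdry n y)) = 0) (t : ℝ) :
    HasSymbol (shiftCov hL ξ t) (restrCov y ξ) (fun ψ => L.Ptt (L.Hst ψ)) 2
      (modelSymbol (compTT n) (L.cTN y) (L.cNT y) (L.cNN y)
        (bE ξ) (bEV ξ) (L.bI y ξ) (L.bIV y ξ) 1 t 6) := by
  have hN := hL.isConormalPair
  have h1 := hasSymbol_Ptt hL (hL.shift_bdry ξ t)
  have h2 := hasSymbol_Hst hL (L.shift y ξ t)
  refine (h1.comp h2 rfl).congr fun η => ?_
  simp only [modelSymbol_six, LinearMap.comp_apply, map_add, map_smul, hL.sharp_shift hξ,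
    compTT_contr, compTT_contrV, compNT_contrV]
  module

theorem hasSymbol_boundaryTT_seven (hL : L.IsRegularAt (bdry n y))
    (hξ : ξ (L.normal (bdry n y)) = 0) (t : ℝ) :
    HasSymbol (shiftCov hL ξ t) (restrCov y ξ) (fun ψ => L.T (L.Hst ψ)) 3
      (modelSymbol (compTT n) (L.cTN y) (L.cNT y) (L.cNN y)
        (bE ξ) (bEV ξ) (L.bI y ξ) (L.bIV y ξ) 1 t 7) := by
  have hN := hL.isConormalPair
  have h1 := hasSymbol_T hL hξ t
  have h2 := hasSymbol_Hst hL (L.shift y ξ t)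
  refine (h1.comp h2 rfl).congr fun η => ?_
  simp only [modelSymbol_seven, LinearMap.comp_apply, LinearMap.sub_apply, LinearMap.smul_apply,
    map_neg, map_add, map_smul, hL.sharp_shift hξ, compTT_contr, compTT_contrV, compNT_contr,
    compNT_contrV, compTN_contr, compTN_contrV, compNN_contrV, extMulV_contr]
  module

theorem hasSymbol_boundaryTT (hL : L.IsRegularAt (bdry n y))
    (hξ : ξ (L.normal (bdry n y)) = 0) (t : ℝ) (r : Fin 8) :
    HasSymbol (shiftCov hL ξ t) (restrCov y ξ) ((boundaryTT n r).op L) (modelOrder r)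
      (modelSymbol (compTT n) (L.cTN y) (L.cNT y) (L.cNN y)
        (bE ξ) (bEV ξ) (L.bI y ξ) (L.bIV y ξ) 1 t r) := by
  match r with
  | 0 =>
    rw [modelSymbol_zero]
    exact hasSymbol_Ptt hL (hL.shift_bdry ξ t)
  | 1 =>
    rw [modelSymbol_one]
    exact hasSymbol_Ptn hL (hL.shift_bdry ξ t)
  | 2 =>
    rw [modelSymbol_two]
    exact hasSymbol_Pnt hL (hL.shift_bdry ξ t)
  | 3 =>
    refine (hasSymbol_T hL hξ t).congr fun η => ?_
    rw [modelSymbol_three]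
    simp only [LinearMap.comp_apply, LinearMap.sub_apply, LinearMap.smul_apply]
  | 4 =>
    refine (hasSymbol_Fbst hL hξ t).congr fun η => ?_
    rw [modelSymbol_four]
    simp only [LinearMap.comp_apply, LinearMap.add_apply, LinearMap.sub_apply,
      LinearMap.smul_apply]
  | 5 =>
    refine (hasSymbol_Fb hL hξ t).congr fun η => ?_
    rw [modelSymbol_five]
    simp only [LinearMap.comp_apply, LinearMap.add_apply, LinearMap.sub_apply,
      LinearMap.smul_apply]
  | 6 => exact hasSymbol_boundaryTT_six hL hξ t
  | 7 => exact hasSymbol_boundaryTT_seven hL hξ t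

theorem hasSymbol_boundaryNN_six (hL : L.IsRegularAt (bdry n y))
    (hξ : ξ (L.normal (bdry n y)) = 0) (t : ℝ) :
    HasSymbol (shiftCov hL ξ t) (restrCov y ξ) (fun ψ => L.Pnn (L.H ψ)) 2
      (modelSymbol (L.cNN y) (L.cTN y) (L.cNT y) (compTT n)
        (-(L.bIV y ξ)) (-(L.bI y ξ)) (-(bEV ξ)) (-(bE ξ)) 1 t 6) := by
  have hN := hL.isConormalPair
  have h1 := hasSymbol_Pnn hL (hL.shift_bdry ξ t)
  have h2 := hasSymbol_H hL (L.shift y ξ t)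
  refine (h1.comp h2 rfl).congr fun η => ?_
  simp only [modelSymbol_six, LinearMap.comp_apply, LinearMap.neg_apply, map_neg, map_sub,
    map_smul, neg_neg, hN.compTN_extMulV hξ, hN.compNN_extMul hξ, hN.compNN_extMulV hξ,
    extMulV_extMul]
  module

theorem hasSymbol_boundaryNN_seven (hL : L.IsRegularAt (bdry n y))
    (hξ : ξ (L.normal (bdry n y)) = 0) (t : ℝ) :
    HasSymbol (shiftCov hL ξ t) (restrCov y ξ) (fun ψ => L.Tst (L.H ψ)) 3
      (modelSymbol (L.cNN y) (L.cTN y) (L.cNT y) (compTT n)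
        (-(L.bIV y ξ)) (-(L.bI y ξ)) (-(bEV ξ)) (-(bE ξ)) 1 t 7) := by
  have hN := hL.isConormalPair
  have h1 := hasSymbol_Tst hL hξ t
  have h2 := hasSymbol_H hL (L.shift y ξ t)
  refine (h1.comp h2 rfl).congr fun η => ?_
  simp only [modelSymbol_seven, LinearMap.comp_apply, LinearMap.add_apply, LinearMap.smul_apply,
    LinearMap.neg_apply, map_neg, map_sub, map_smul, neg_neg, hN.compTT_extMulV,
    hN.compNT_extMul hξ, hN.compNT_extMulV, hN.compTN_extMul, hN.compTN_extMulV hξ,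
    hN.compNN_extMul hξ, hN.compNN_extMulV hξ, extMulV_extMul, contrV_extMul]
  module

theorem hasSymbol_boundaryNN (hL : L.IsRegularAt (bdry n y))
    (hξ : ξ (L.normal (bdry n y)) = 0) (t : ℝ) (r : Fin 8) :
    HasSymbol (shiftCov hL ξ t) (restrCov y ξ) ((boundaryNN n r).op L) (modelOrder r)
      (modelSymbol (L.cNN y) (L.cTN y) (L.cNT y) (compTT n)
        (-(L.bIV y ξ)) (-(L.bI y ξ)) (-(bEV ξ)) (-(bE ξ)) 1 t r) := by
  match r with
  | 0 =>
    rw [modelSymbol_zero]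
    exact hasSymbol_Pnn hL (hL.shift_bdry ξ t)
  | 1 =>
    rw [modelSymbol_one]
    exact hasSymbol_Ptn hL (hL.shift_bdry ξ t)
  | 2 =>
    rw [modelSymbol_two]
    exact hasSymbol_Pnt hL (hL.shift_bdry ξ t)
  | 3 =>
    refine (hasSymbol_Tst hL hξ t).congr fun η => ?_
    rw [modelSymbol_three]
    simp only [LinearMap.comp_apply, LinearMap.add_apply, LinearMap.smul_apply,
      LinearMap.neg_apply]
    module
  | 4 =>
    refine (hasSymbol_Fbst hL hξ t).congr fun η => ?_
    rw [modelSymbol_four]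
    simp only [LinearMap.comp_apply, LinearMap.add_apply, LinearMap.sub_apply,
      LinearMap.smul_apply, LinearMap.neg_apply]
    module
  | 5 =>
    refine (hasSymbol_Fb hL hξ t).congr fun η => ?_
    rw [modelSymbol_five]
    simp only [LinearMap.comp_apply, LinearMap.add_apply, LinearMap.sub_apply,
      LinearMap.smul_apply, LinearMap.neg_apply]
    module
  | 6 => exact hasSymbol_boundaryNN_six hL hξ t
  | 7 => exact hasSymbol_boundaryNN_seven hL hξ t

theorem hasSymbol_boundaryNT_six (hL : L.IsRegularAt (bdry n y))
    (hξ : ξ (L.normal (bdry n y)) = 0) (t : ℝ) :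
    HasSymbol (shiftCov hL ξ t) (restrCov y ξ) (fun ψ => L.Pnt (L.F ψ)) 2
      (modelSymbol (L.cNT y) (L.cNN y) (compTT n) (L.cTN y)
        (-(L.bI y ξ)) (bEV ξ) (-(bE ξ)) (L.bIV y ξ) (-1) t 6) := by
  have hN := hL.isConormalPair
  have h1 := hasSymbol_Pnt hL (hL.shift_bdry ξ t)
  have h2 := hasSymbol_F hL (L.shift y ξ t)
  refine (h1.comp h2 rfl).congr fun η => ?_
  simp only [modelSymbol_six, LinearMap.comp_apply, LinearMap.neg_apply, map_neg, map_add,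
    map_smul, hL.sharp_shift hξ, compTT_contrV, compNT_contrV, hN.compNT_extMul hξ]
  module

theorem hasSymbol_boundaryNT_seven (hL : L.IsRegularAt (bdry n y))
    (hξ : ξ (L.normal (bdry n y)) = 0) (t : ℝ) :
    HasSymbol (shiftCov hL ξ t) (restrCov y ξ) (fun ψ => L.Fbst (L.F ψ)) 3
      (modelSymbol (L.cNT y) (L.cNN y) (compTT n) (L.cTN y)
        (-(L.bI y ξ)) (bEV ξ) (-(bE ξ)) (L.bIV y ξ) (-1) t 7) := by
  have hN := hL.isConormalPair
  have h1 := hasSymbol_Fbst hL hξ t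
  have h2 := hasSymbol_F hL (L.shift y ξ t)
  refine (h1.comp h2 rfl).congr fun η => ?_
  simp only [modelSymbol_seven, LinearMap.comp_apply, LinearMap.add_apply, LinearMap.sub_apply,
    LinearMap.smul_apply, LinearMap.neg_apply, map_neg, map_add, map_sub, map_smul, neg_neg,
    hL.sharp_shift hξ, compTT_contrV, compNT_contrV, compTN_contrV, compNN_contrV,
    hN.compTT_extMul, hN.compNT_extMul hξ, hN.compNN_extMul hξ, extMulV_extMul]
  module

theorem hasSymbol_boundaryNT (hL : L.IsRegularAt (bdry n y))
    (hξ : ξ (L.normal (bdry n y)) = 0) (t : ℝ) (r : Fin 8) :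
    HasSymbol (shiftCov hL ξ t) (restrCov y ξ) ((boundaryNT n r).op L) (modelOrder r)
      (modelSymbol (L.cNT y) (L.cNN y) (compTT n) (L.cTN y)
        (-(L.bI y ξ)) (bEV ξ) (-(bE ξ)) (L.bIV y ξ) (-1) t r) := by
  match r with
  | 0 =>
    rw [modelSymbol_zero]
    exact hasSymbol_Pnt hL (hL.shift_bdry ξ t)
  | 1 =>
    rw [modelSymbol_one]
    exact hasSymbol_Pnn hL (hL.shift_bdry ξ t)
  | 2 =>
    rw [modelSymbol_two]
    exact hasSymbol_Ptt hL (hL.shift_bdry ξ t)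
  | 3 =>
    refine (hasSymbol_Fbst hL hξ t).congr fun η => ?_
    rw [modelSymbol_three]
    simp only [LinearMap.comp_apply, LinearMap.add_apply, LinearMap.sub_apply,
      LinearMap.smul_apply, LinearMap.neg_apply]
    module
  | 4 =>
    refine (hasSymbol_T hL hξ t).congr fun η => ?_
    rw [modelSymbol_four]
    simp only [LinearMap.comp_apply, LinearMap.sub_apply, LinearMap.smul_apply,
      LinearMap.neg_apply]
    module
  | 5 =>
    refine (hasSymbol_Tst hL hξ t).congr fun η => ?_
    rw [modelSymbol_five]
    simp only [LinearMap.comp_apply, LinearMap.add_apply, LinearMap.smul_apply,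
      LinearMap.neg_apply]
    module
  | 6 => exact hasSymbol_boundaryNT_six hL hξ t
  | 7 => exact hasSymbol_boundaryNT_seven hL hξ t

theorem hasSymbol_boundaryTN_six (hL : L.IsRegularAt (bdry n y))
    (hξ : ξ (L.normal (bdry n y)) = 0) (t : ℝ) :
    HasSymbol (shiftCov hL ξ t) (restrCov y ξ) (fun ψ => L.Ptn (L.Fst ψ)) 2
      (modelSymbol (L.cTN y) (L.cNN y) (compTT n) (L.cNT y)
        (-(L.bIV y ξ)) (bE ξ) (-(bEV ξ)) (L.bI y ξ) (-1) t 6) := by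
  have hN := hL.isConormalPair
  have h1 := hasSymbol_Ptn hL (hL.shift_bdry ξ t)
  have h2 := hasSymbol_Fst hL (L.shift y ξ t)
  refine (h1.comp h2 rfl).congr fun η => ?_
  simp only [modelSymbol_six, LinearMap.comp_apply, LinearMap.neg_apply, map_neg, map_sub,
    map_smul, hL.sharp_shift hξ, compTN_contr, hN.compTN_extMulV hξ, hN.compNN_extMulV hξ,
    extMulV_contr]
  module

theorem hasSymbol_boundaryTN_seven (hL : L.IsRegularAt (bdry n y))
    (hξ : ξ (L.normal (bdry n y)) = 0) (t : ℝ) :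
    HasSymbol (shiftCov hL ξ t) (restrCov y ξ) (fun ψ => L.Fb (L.Fst ψ)) 3
      (modelSymbol (L.cTN y) (L.cNN y) (compTT n) (L.cNT y)
        (-(L.bIV y ξ)) (bE ξ) (-(bEV ξ)) (L.bI y ξ) (-1) t 7) := by
  have hN := hL.isConormalPair
  have h1 := hasSymbol_Fb hL hξ t
  have h2 := hasSymbol_Fst hL (L.shift y ξ t)
  refine (h1.comp h2 rfl).congr fun η => ?_
  simp only [modelSymbol_seven, LinearMap.comp_apply, LinearMap.add_apply, LinearMap.sub_apply,
    LinearMap.smul_apply, LinearMap.neg_apply, map_neg, map_add, map_sub, map_smul, neg_neg,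
    hL.sharp_shift hξ, compTT_contr, compTN_contr, compNN_contr, hN.compTT_extMulV,
    hN.compNT_extMulV, hN.compTN_extMulV hξ, hN.compNN_extMulV hξ, contrV_contr, extMulV_contr]
  module

theorem hasSymbol_boundaryTN (hL : L.IsRegularAt (bdry n y))
    (hξ : ξ (L.normal (bdry n y)) = 0) (t : ℝ) (r : Fin 8) :
    HasSymbol (shiftCov hL ξ t) (restrCov y ξ) ((boundaryTN n r).op L) (modelOrder r)
      (modelSymbol (L.cTN y) (L.cNN y) (compTT n) (L.cNT y)
        (-(L.bIV y ξ)) (bE ξ) (-(bEV ξ)) (L.bI y ξ) (-1) t r) := by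
  match r with
  | 0 =>
    rw [modelSymbol_zero]
    exact hasSymbol_Ptn hL (hL.shift_bdry ξ t)
  | 1 =>
    rw [modelSymbol_one]
    exact hasSymbol_Pnn hL (hL.shift_bdry ξ t)
  | 2 =>
    rw [modelSymbol_two]
    exact hasSymbol_Ptt hL (hL.shift_bdry ξ t)
  | 3 =>
    refine (hasSymbol_Fb hL hξ t).congr fun η => ?_
    rw [modelSymbol_three]
    simp only [LinearMap.comp_apply, LinearMap.add_apply, LinearMap.sub_apply,
      LinearMap.smul_apply, LinearMap.neg_apply]
    module
  | 4 =>
    refine (hasSymbol_T hL hξ t).congr fun η => ?_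
    rw [modelSymbol_four]
    simp only [LinearMap.comp_apply, LinearMap.sub_apply, LinearMap.smul_apply,
      LinearMap.neg_apply]
    module
  | 5 =>
    refine (hasSymbol_Tst hL hξ t).congr fun η => ?_
    rw [modelSymbol_five]
    simp only [LinearMap.comp_apply, LinearMap.add_apply, LinearMap.smul_apply,
      LinearMap.neg_apply]
    module
  | 6 => exact hasSymbol_boundaryTN_six hL hξ t
  | 7 => exact hasSymbol_boundaryTN_seven hL hξ t

end LocalData

end Model

/-! ### The bounded solutions of `(λ² - ∂²)² σ = 0` -/

section ODE

variable {E : Type*} [NormedAddCommGroup E] [NormedSpace ℝ E]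

/-- The curve `s ↦ e^{cs} (a + s b)`. -/
def expCurve (c : ℝ) (a b : E) (s : ℝ) : E := Real.exp (c * s) • (a + s • b)

theorem hasDerivAt_expCurve (c : ℝ) (a b : E) (s : ℝ) :
    HasDerivAt (expCurve c a b) (expCurve c (b + c • a) (c • b) s) s := by
  have h1 : HasDerivAt (fun s => Real.exp (c * s)) (Real.exp (c * s) * (c * 1)) s :=
    ((hasDerivAt_id s).const_mul c).exp
  have h2 : HasDerivAt (fun s : ℝ => a + s • b) ((1 : ℝ) • b) s :=
    ((hasDerivAt_id s).smul_const b).const_add a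
  convert! h1.smul h2 using 1
  rw [expCurve]
  module

theorem deriv_expCurve (c : ℝ) (a b : E) :
    deriv (expCurve c a b) = expCurve c (b + c • a) (c • b) :=
  funext fun s => (hasDerivAt_expCurve c a b s).deriv

theorem contDiff_expCurve (c : ℝ) (a b : E) : ContDiff ℝ ∞ (expCurve c a b) :=
  (Real.contDiff_exp.comp (contDiff_const.mul contDiff_id)).smul
    (contDiff_const.add (contDiff_id.smul contDiff_const))

theorem iteratedDeriv_expCurve_one (c : ℝ) (a b : E) :
    iteratedDeriv 1 (expCurve c a b) = expCurve c (b + c • a) (c • b) := by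
  rw [iteratedDeriv_one, deriv_expCurve]

theorem iteratedDeriv_expCurve_two (c : ℝ) (a b : E) :
    iteratedDeriv 2 (expCurve c a b) =
      expCurve c ((2 * c) • b + c ^ 2 • a) (c ^ 2 • b) := by
  rw [iteratedDeriv_succ, iteratedDeriv_expCurve_one, deriv_expCurve]
  congr 1 <;> module

theorem iteratedDeriv_expCurve_three (c : ℝ) (a b : E) :
    iteratedDeriv 3 (expCurve c a b) =
      expCurve c ((3 * c ^ 2) • b + c ^ 3 • a) (c ^ 3 • b) := by
  rw [iteratedDeriv_succ, iteratedDeriv_expCurve_two, deriv_expCurve]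
  congr 1 <;> module

theorem iteratedDeriv_expCurve_four (c : ℝ) (a b : E) :
    iteratedDeriv 4 (expCurve c a b) =
      expCurve c ((4 * c ^ 3) • b + c ^ 4 • a) (c ^ 4 • b) := by
  rw [iteratedDeriv_succ, iteratedDeriv_expCurve_three, deriv_expCurve]
  congr 1 <;> module

theorem norm_expCurve_le {c : ℝ} (hc : 0 < c) (a b : E) {s : ℝ} (hs : 0 ≤ s) :
    ‖expCurve (-c) a b s‖ ≤ ‖a‖ + c⁻¹ * ‖b‖ := by
  have h1 : Real.exp (-c * s) ≤ 1 := Real.exp_le_one_iff.2 (by nlinarith)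
  have h2 : Real.exp (-c * s) * s ≤ c⁻¹ := by
    have h3 : c * s ≤ Real.exp (c * s) := by linarith [Real.add_one_le_exp (c * s)]
    rw [neg_mul, Real.exp_neg, inv_mul_le_iff₀ (Real.exp_pos _), ← div_eq_mul_inv,
      le_div_iff₀ hc]
    linarith
  rw [expCurve, smul_add, smul_smul]
  refine (norm_add_le _ _).trans (add_le_add ?_ ?_)
  · rw [norm_smul, Real.norm_of_nonneg (Real.exp_pos _).le]
    exact mul_le_of_le_one_left (norm_nonneg _) h1
  · rw [norm_smul, Real.norm_of_nonneg (mul_nonneg (Real.exp_pos _).le hs)]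
    exact mul_le_mul_of_nonneg_right h2 (norm_nonneg _)

/-- Solutions of `(∂ - c)² f = 0`: the second derivative of `e^{-cs} f` vanishes. -/
theorem exists_eq_expCurve (c : ℝ) {f f' : ℝ → E} (hf : ∀ s, HasDerivAt f (f' s) s)
    (hf' : ∀ s, HasDerivAt f' ((2 * c) • f' s - c ^ 2 • f s) s) :
    ∃ a b, f = expCurve c a b := by
  have hexp (s : ℝ) : HasDerivAt (fun s => Real.exp (-c * s)) (Real.exp (-c * s) * (-c * 1)) s :=
    ((hasDerivAt_id s).const_mul (-c)).exp
  have h1 (s : ℝ) : HasDerivAt (fun s => Real.exp (-c * s) • (f' s - c • f s)) 0 s := by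
    convert! (hexp s).smul ((hf' s).sub ((hf s).const_smul c)) using 1
    simp only [Pi.sub_apply, Pi.smul_apply]
    module
  have hconst (s : ℝ) : Real.exp (-c * s) • (f' s - c • f s) = f' 0 - c • f 0 := by
    have := is_const_of_deriv_eq_zero (fun s => (h1 s).differentiableAt)
      (fun s => (h1 s).deriv) s 0
    simpa using this
  have h2 (s : ℝ) : HasDerivAt (fun s => Real.exp (-c * s) • f s - s • (f' 0 - c • f 0)) 0 s := by
    convert! ((hexp s).smul (hf s)).sub ((hasDerivAt_id s).smul_const (f' 0 - c • f 0)) using 1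
    rw [← hconst s]
    module
  refine ⟨f 0, f' 0 - c • f 0, funext fun s => ?_⟩
  have h3 := is_const_of_deriv_eq_zero (fun s => (h2 s).differentiableAt)
    (fun s => (h2 s).deriv) s 0
  simp only [mul_zero, Real.exp_zero, one_smul, zero_smul, sub_zero] at h3
  have h4 := sub_eq_iff_eq_add'.1 h3
  rw [add_comm] at h4
  rw [expCurve, ← h4, smul_smul, ← Real.exp_add]
  simp

/-- The solutions of `(λ² - ∂²)² σ = 0` that are bounded on `[0,∞)` are the curves
`e^{-λs} (a + s b)`.  The functions `(∂ ± λ)² σ` solve `(∂ ∓ λ)² f = 0`, and `σ` is a combination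
of these two functions and of their derivatives. -/
theorem exists_eq_expCurve_of_bounded {c : ℝ} (hc : 0 < c) {σ : ℝ → E} (hσ : ContDiff ℝ ∞ σ)
    (hode : ∀ s, iteratedDeriv 4 σ s - (2 * c ^ 2) • iteratedDeriv 2 σ s + c ^ 4 • σ s = 0)
    (hbdd : ∃ C : ℝ, ∀ s, 0 ≤ s → ‖σ s‖ ≤ C) : ∃ a b, σ = expCurve (-c) a b := by
  have hd (j : ℕ) (s : ℝ) : HasDerivAt (iteratedDeriv j σ) (iteratedDeriv (j + 1) σ s) s := by
    rw [iteratedDeriv_succ]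
    exact ((hσ.differentiable_iteratedDeriv j (by exact_mod_cast WithTop.coe_lt_top _)) s).hasDerivAt
  have hd0 (s : ℝ) : HasDerivAt σ (iteratedDeriv 1 σ s) s := by
    simpa using hd 0 s
  have hode' (s : ℝ) : iteratedDeriv 4 σ s = (2 * c ^ 2) • iteratedDeriv 2 σ s - c ^ 4 • σ s := by
    rw [← sub_eq_zero, ← hode s]; module
  have hderiv (ε s : ℝ) : HasDerivAt (fun s => iteratedDeriv 2 σ s +
      (2 * ε) • iteratedDeriv 1 σ s + ε ^ 2 • σ s) (iteratedDeriv 3 σ s +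
      (2 * ε) • iteratedDeriv 2 σ s + ε ^ 2 • iteratedDeriv 1 σ s) s :=
    ((hd 2 s).add ((hd 1 s).const_smul _)).add ((hd0 s).const_smul _)
  have key (ε : ℝ) (hε : ε ^ 2 = c ^ 2) : ∃ a b, (fun s => iteratedDeriv 2 σ s +
      (2 * ε) • iteratedDeriv 1 σ s + ε ^ 2 • σ s) = expCurve ε a b := by
    refine exists_eq_expCurve ε (f' := fun s => iteratedDeriv 3 σ s +
      (2 * ε) • iteratedDeriv 2 σ s + ε ^ 2 • iteratedDeriv 1 σ s) (hderiv ε) (fun s => ?_)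
    convert! ((hd 3 s).add ((hd 2 s).const_smul (2 * ε))).add ((hd 1 s).const_smul (ε ^ 2)) using 1
    rw [hode' s, show c ^ 4 = (ε ^ 2) ^ 2 by rw [hε]; ring, ← hε]
    module
  obtain ⟨a₁, b₁, h₁⟩ := key c rfl
  obtain ⟨a₂, b₂, h₂⟩ := key (-c) (by ring)
  have hsum (s : ℝ) : σ s = expCurve c ((4 * c ^ 2)⁻¹ • a₁ - (4 * c ^ 3)⁻¹ • b₁)
      ((4 * c ^ 2)⁻¹ • b₁) s + expCurve (-c) ((4 * c ^ 2)⁻¹ • a₂ + (4 * c ^ 3)⁻¹ • b₂)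
      ((4 * c ^ 2)⁻¹ • b₂) s := by
    have e₁ := congrFun h₁ s
    have e₂ := congrFun h₂ s
    have e₃ := (hderiv c s).unique (h₁ ▸ hasDerivAt_expCurve c a₁ b₁ s)
    have e₄ := (hderiv (-c) s).unique (h₂ ▸ hasDerivAt_expCurve (-c) a₂ b₂ s)
    have e₅ : σ s = (2 * c ^ 2)⁻¹ • (expCurve c a₁ b₁ s + expCurve (-c) a₂ b₂ s) -
        (4 * c ^ 3)⁻¹ • (expCurve c (b₁ + c • a₁) (c • b₁) s -
          expCurve (-c) (b₂ + (-c) • a₂) ((-c) • b₂) s) := by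
      rw [← e₁, ← e₂, ← e₃, ← e₄]
      match_scalars <;> field_simp <;> ring
    rw [e₅]
    simp only [expCurve]
    match_scalars <;> field_simp <;> ring
  generalize (4 * c ^ 2)⁻¹ • a₁ - (4 * c ^ 3)⁻¹ • b₁ = A at hsum
  generalize (4 * c ^ 2)⁻¹ • b₁ = B at hsum
  generalize (4 * c ^ 2)⁻¹ • a₂ + (4 * c ^ 3)⁻¹ • b₂ = A' at hsum
  generalize (4 * c ^ 2)⁻¹ • b₂ = B' at hsum
  obtain ⟨C, hC⟩ := hbdd
  have hlim : Filter.Tendsto (fun s : ℝ => A + s • B) Filter.atTop (nhds 0) := by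
    have hC' : ∀ s, 0 ≤ s → ‖A + s • B‖ ≤ (C + (‖A'‖ + c⁻¹ * ‖B'‖)) * Real.exp (-(c * s)) := by
      intro s hs
      have h3 : A + s • B = Real.exp (-(c * s)) • (σ s - expCurve (-c) A' B' s) := by
        rw [hsum s, add_sub_cancel_right, expCurve, smul_smul (Real.exp _) (Real.exp _),
          ← Real.exp_add]
        simp
      rw [h3, norm_smul, Real.norm_of_nonneg (Real.exp_pos _).le, mul_comm]
      refine mul_le_mul_of_nonneg_right ((norm_sub_le _ _).trans
        (add_le_add (hC s hs) (norm_expCurve_le hc _ _ hs))) (Real.exp_pos _).le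
    have hexp : Filter.Tendsto (fun s : ℝ => (C + (‖A'‖ + c⁻¹ * ‖B'‖)) * Real.exp (-(c * s)))
        Filter.atTop (nhds 0) := by
      have := (Real.tendsto_exp_neg_atTop_nhds_zero.comp
        (Filter.tendsto_id.const_mul_atTop hc)).const_mul (C + (‖A'‖ + c⁻¹ * ‖B'‖))
      simpa using this
    refine squeeze_zero_norm' ?_ hexp
    filter_upwards [Filter.eventually_ge_atTop 0] with s hs using hC' s hs
  have hB : B = 0 := by
    have h3 : Filter.Tendsto (fun s : ℝ => (A + (s + 1) • B) - (A + s • B)) Filter.atTop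
        (nhds (0 - 0)) :=
      (hlim.comp (Filter.tendsto_atTop_add_const_right _ 1 Filter.tendsto_id)).sub hlim
    have h4 : (fun s : ℝ => (A + (s + 1) • B) - (A + s • B)) = fun _ => B := by
      funext s; module
    rw [h4, sub_zero] at h3
    exact tendsto_nhds_unique tendsto_const_nhds h3
  have hA : A = 0 := by
    rw [hB] at hlim
    simp only [smul_zero, add_zero] at hlim
    exact tendsto_nhds_unique tendsto_const_nhds hlim
  refine ⟨A', B', funext fun s => ?_⟩
  rw [hsum s, hA, hB, expCurve]
  simp

end ODE

/-! ### The operators `P(x, ξ + i ∂ₛ ν)` -/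

section SymbolPolynomial

variable {d d' : ℕ} {L : DField d → GForm d'} {N : ℕ} {x : Euc d} {ξ ν : Euc d →L[ℝ] ℝ}

theorem symbolCoeff_eq {η : GForm d} {C : ℕ → GForm d'}
    (h : ∀ t : ℝ, principalSymbol L N x (ξ + t • ν) η =
      ∑ l ∈ Finset.range (N + 1), (t : ℂ) ^ l • C l) {j : ℕ} (hj : j ∈ Finset.range (N + 1)) :
    symbolCoeff L N x ξ ν j η = C j := by
  funext k m
  have h1 : (fun t : ℝ => principalSymbol L N x (ξ + t • ν) η k m) =
      fun t => ∑ l ∈ Finset.range (N + 1), t ^ l • C l k m := by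
    funext t
    rw [h t, Finset.sum_apply, Finset.sum_apply]
    refine Finset.sum_congr rfl fun l _ => ?_
    ext X Y
    simp
  have h2 (l : ℕ) : iteratedDeriv j (fun t : ℝ => t ^ l • C l k m) 0 =
      (if l = j then (j.factorial : ℝ) else 0) • C l k m := by
    have hc : ContDiffAt ℝ j (fun t : ℝ => t ^ l) 0 := by fun_prop
    rw [iteratedDeriv_smul_const hc]
    congr 1
    rw [iteratedDeriv_fun_pow_zero]
    by_cases hlj : l = j
    · rw [if_pos hlj, if_pos hlj.symm, hlj]
    · rw [if_neg hlj, if_neg (Ne.symm hlj)]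
      exact Nat.cast_zero
  rw [symbolCoeff, h1, iteratedDeriv_fun_sum fun l _ => by fun_prop]
  simp only [h2, ite_smul, zero_smul]
  rw [Finset.sum_ite_eq' _ j, if_pos hj, smul_smul, inv_mul_cancel₀ (by positivity), one_smul]

theorem odeOp_eq {C : ℕ → (GForm d →ₗ[ℂ] GForm d')}
    (h : ∀ (t : ℝ) (η : GForm d), principalSymbol L N x (ξ + t • ν) η =
      Complex.I ^ N • (∑ l ∈ Finset.range (N + 1), (t : ℂ) ^ l • C l) η)
    (σ : ℝ → GForm d) (s : ℝ) :
    odeOp L N x ξ ν σ s =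
      Complex.I ^ N • ∑ l ∈ Finset.range (N + 1), Complex.I ^ l • C l (curveDeriv l σ s) := by
  rw [odeOp, Finset.smul_sum]
  refine Finset.sum_congr rfl fun l hl => ?_
  rw [symbolCoeff_eq (C := fun l' => Complex.I ^ N • C l' (curveDeriv l σ s)) (fun t => ?_) hl,
    smul_comm]
  rw [h, LinearMap.sum_apply, Finset.smul_sum]
  exact Finset.sum_congr rfl fun l' _ => by rw [LinearMap.smul_apply, smul_comm]

end SymbolPolynomial

/-! ### Solving the model boundary value problem -/

section ModelProblem

variable {W U : Type*} [AddCommGroup W] [Module ℂ W] [AddCommGroup U] [Module ℂ U]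

/-- The `l`-th derivative at `s = 0` (`l ≤ 3`) of the curve `s ↦ e^{-μs} (a + s b)`, as a linear
function of `(a, b)`. -/
def decayDeriv (μ : ℂ) : ℕ → (W × W →ₗ[ℂ] W)
  | 0 => LinearMap.fst ℂ W W
  | 1 => LinearMap.snd ℂ W W - μ • LinearMap.fst ℂ W W
  | 2 => μ ^ 2 • LinearMap.fst ℂ W W - (2 * μ) • LinearMap.snd ℂ W W
  | _ => (3 * μ ^ 2) • LinearMap.snd ℂ W W - μ ^ 3 • LinearMap.fst ℂ W W

/-- The boundary data of the curve `s ↦ e^{-μs} (a + s b)`, as a linear function of `(a, b)`. -/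
def modelBoundary (A B C D : W →ₗ[ℂ] U) (e f i j : U →ₗ[ℂ] U) (ε μ : ℂ) :
    W × W →ₗ[ℂ] (Fin 8 → U) :=
  LinearMap.pi fun r => Complex.I ^ modelOrder r • ∑ l ∈ Finset.range (modelOrder r + 1),
    Complex.I ^ l • (modelCoeff A B C D e f i j ε r l ∘ₗ decayDeriv μ l)

/-- The algebraic structure shared by the four boundary value problems.  The fibre of degree
`(k,m)` is `SW`, its four components lie in `SA`, `SB`, `SC`, `SD`, and the operators `e, i` and
`f, j` satisfy the relations of two commuting pairs of exterior and interior products. -/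
structure IsModelProblem (A B C D : W →ₗ[ℂ] U) (e f i j : U →ₗ[ℂ] U) (c : ℂ)
    (SW : Submodule ℂ W) (SA SB SC SD : Submodule ℂ U) : Prop where
  e_e : ∀ v, e (e v) = 0
  f_f : ∀ v, f (f v) = 0
  i_i : ∀ v, i (i v) = 0
  j_j : ∀ v, j (j v) = 0
  e_i : ∀ v, e (i v) = c • v - i (e v)
  f_j : ∀ v, f (j v) = c • v - j (f v)
  f_e : ∀ v, f (e v) = e (f v)
  j_i : ∀ v, j (i v) = i (j v)
  f_i : ∀ v, f (i v) = i (f v)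
  e_j : ∀ v, e (j v) = j (e v)
  A_mem : ∀ w ∈ SW, A w ∈ SA
  B_mem : ∀ w ∈ SW, B w ∈ SB
  C_mem : ∀ w ∈ SW, C w ∈ SC
  D_mem : ∀ w ∈ SW, D w ∈ SD
  eC_mem : ∀ v ∈ SC, e v ∈ SA
  eD_mem : ∀ v ∈ SD, e v ∈ SB
  fB_mem : ∀ v ∈ SB, f v ∈ SA
  fD_mem : ∀ v ∈ SD, f v ∈ SC
  iA_mem : ∀ v ∈ SA, i v ∈ SC
  iB_mem : ∀ v ∈ SB, i v ∈ SD
  jA_mem : ∀ v ∈ SA, j v ∈ SB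
  jC_mem : ∀ v ∈ SC, j v ∈ SD
  eq_zero : ∀ w, A w = 0 → B w = 0 → C w = 0 → D w = 0 → w = 0
  exists_components : ∀ a ∈ SA, ∀ b ∈ SB, ∀ c ∈ SC, ∀ d ∈ SD,
    ∃ w ∈ SW, A w = a ∧ B w = b ∧ C w = c ∧ D w = d

namespace IsModelProblem

variable {A B C D : W →ₗ[ℂ] U} {e f i j : U →ₗ[ℂ] U} {ε μ : ℂ} {SW : Submodule ℂ W}
  {SA SB SC SD : Submodule ℂ U}

/-- The right hand side of the first equation for the component `D`. -/
def rhsSix (i j : U →ₗ[ℂ] U) (ε : ℂ) (θ : Fin 8 → U) : U :=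
  ε • θ 6 - i (j (θ 0)) - Complex.I • (i (θ 5) + j (θ 4))

/-- The right hand side of the second equation for the component `D`. -/
def rhsSeven (e f i j : U →ₗ[ℂ] U) (ε μ : ℂ) (θ : Fin 8 → U) : U :=
  -(ε • θ 7) - Complex.I • (e (i (j (θ 2))) + f (i (j (θ 1))) + i (j (e (θ 2) + f (θ 1))) +
    μ ^ 2 • (i (θ 1) + j (θ 2)) - (2 * μ) • (i (θ 5) + j (θ 4))) - i (j (θ 3)) +
    (4 * μ) • i (j (θ 0))

/-- The boundary data of `(a, b)` determine the components `A, B, C` of `a` and the component `A`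
of `b`; the components `B, C` of `b` are then determined by `D a`, and `D a`, `D b` satisfy a
triangular system in terms of `Z = ie + jf`. -/
structure Equations (A B C D : W →ₗ[ℂ] U) (e f i j : U →ₗ[ℂ] U) (ε μ : ℂ) (a b : W)
    (θ : Fin 8 → U) : Prop where
  A_a : A a = θ 0
  B_a : B a = θ 1
  C_a : C a = θ 2
  A_b : A b = μ • θ 0 - θ 3 - Complex.I • (e (θ 2) + f (θ 1))
  C_b : C b = μ • θ 2 - θ 4 + Complex.I • (i (θ 0) - f (D a))
  B_b : B b = μ • θ 1 - θ 5 + Complex.I • (j (θ 0) - e (D a))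
  D_a : (3 * μ ^ 2) • D a - (i (e (D a)) + j (f (D a))) =
    rhsSix i j ε θ + (2 * μ) • (D b + μ • D a)
  D_b : μ ^ 2 • (D b + μ • D a) + (i (e (D b + μ • D a)) + j (f (D b + μ • D a))) =
    rhsSeven e f i j ε μ θ

theorem modelBoundary_of_le_five (a b : W) :
    modelBoundary A B C D e f i j ε μ (a, b) 0 = A a ∧
    modelBoundary A B C D e f i j ε μ (a, b) 1 = B a ∧
    modelBoundary A B C D e f i j ε μ (a, b) 2 = C a ∧
    modelBoundary A B C D e f i j ε μ (a, b) 3 =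
      μ • A a - A b - Complex.I • (e (C a) + f (B a)) ∧
    modelBoundary A B C D e f i j ε μ (a, b) 4 =
      μ • C a - C b + Complex.I • (i (A a) - f (D a)) ∧
    modelBoundary A B C D e f i j ε μ (a, b) 5 =
      μ • B a - B b + Complex.I • (j (A a) - e (D a)) := by
  refine ⟨?_, ?_, ?_, ?_, ?_, ?_⟩ <;>
  · simp only [modelBoundary, modelOrder, modelCoeff, decayDeriv, LinearMap.pi_apply,
      LinearMap.smul_apply, LinearMap.comp_apply, LinearMap.fst_apply, LinearMap.snd_apply,
      LinearMap.sub_apply, LinearMap.neg_apply, LinearMap.add_apply, zero_add,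
      Finset.sum_range_succ, Finset.sum_range_zero, map_sub, map_smul]
    match_scalars <;> (ring_nf; try simp only [Complex.I_sq]; try ring)

theorem modelBoundary_six (a b : W) :
    modelBoundary A B C D e f i j ε μ (a, b) 6 = ε • (μ ^ 2 • D a - (2 * μ) • D b - i (j (A a)) -
      Complex.I • (i (B b) + j (C b) - μ • (i (B a) + j (C a)))) := by
  simp only [modelBoundary, modelOrder, modelCoeff, decayDeriv, LinearMap.pi_apply,
      LinearMap.smul_apply, LinearMap.comp_apply, LinearMap.fst_apply, LinearMap.snd_apply,
      LinearMap.sub_apply, LinearMap.add_apply, zero_add,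
      Finset.sum_range_succ, Finset.sum_range_zero, map_sub, map_smul]
  match_scalars <;> ring_nf <;>
    simp only [Complex.I_sq, Complex.I_pow_three, Complex.I_pow_four] <;> ring

theorem modelBoundary_seven (a b : W) :
    modelBoundary A B C D e f i j ε μ (a, b) 7 =
      ε • (i (j (A b - μ • A a)) + (e (i (D b)) + f (j (D b))) - μ • (e (i (D a)) + f (j (D a))) -
        (3 * μ ^ 2) • D b + μ ^ 3 • D a - Complex.I • (e (i (j (C a))) + f (i (j (B a)))) +
        Complex.I • (μ ^ 2 • (i (B a) + j (C a)) - (2 * μ) • (i (B b) + j (C b)))) := by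
  simp only [modelBoundary, modelOrder, modelCoeff, decayDeriv, LinearMap.pi_apply,
      LinearMap.smul_apply, LinearMap.comp_apply, LinearMap.fst_apply, LinearMap.snd_apply,
      LinearMap.sub_apply, LinearMap.add_apply, zero_add,
      Finset.sum_range_succ, Finset.sum_range_zero, map_sub, map_smul]
  have I5 : Complex.I ^ 5 = Complex.I := by rw [pow_succ, Complex.I_pow_four, one_mul]
  have I6 : Complex.I ^ 6 = -1 := by
    rw [show 6 = 4 + 2 from rfl, pow_add, Complex.I_pow_four, Complex.I_sq, one_mul]
  match_scalars <;> ring_nf <;>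
    simp only [Complex.I_pow_three, Complex.I_pow_four, I5, I6] <;> ring

theorem equations (h : IsModelProblem A B C D e f i j (μ ^ 2) SW SA SB SC SD)
    (hε : ε = 1 ∨ ε = -1) (a b : W) :
    Equations A B C D e f i j ε μ a b (modelBoundary A B C D e f i j ε μ (a, b)) := by
  obtain ⟨h0, h1, h2, h3, h4, h5⟩ := modelBoundary_of_le_five (A := A) (B := B) (C := C) (D := D)
    (e := e) (f := f) (i := i) (j := j) (ε := ε) (μ := μ) a b
  refine ⟨h0.symm, h1.symm, h2.symm, ?_, ?_, ?_, ?_, ?_⟩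
  · rw [h0, h1, h2, h3]; module
  · rw [h0, h2, h4]; module
  · rw [h0, h1, h5]; module
  · rw [rhsSix, h0, h4, h5, modelBoundary_six]
    simp only [map_sub, map_add, map_smul, h.j_i]
    rcases hε with rfl | rfl <;> match_scalars <;> ring_nf <;> simp only [Complex.I_sq] <;> ring
  · rw [rhsSeven, h0, h1, h2, h3, h4, h5, modelBoundary_seven]
    simp only [map_sub, map_add, map_smul, h.j_i, h.e_i, h.f_j, h.f_i, h.e_j]
    rcases hε with rfl | rfl <;> match_scalars <;> ring_nf <;> simp only [Complex.I_sq] <;> ring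

/-- The operators `ie` and `jf` are commuting and have spectrum in `{0, μ²}`, so that the inverse of
`μ² + (ie + jf)` is a polynomial in them. -/
theorem exists_add_eq (h : IsModelProblem A B C D e f i j (μ ^ 2) SW SA SB SC SD) (hμ : μ ≠ 0)
    {v : U} (hv : v ∈ SD) :
    ∃ u ∈ SD, μ ^ 2 • u + (i (e u) + j (f u)) = v := by
  refine ⟨(μ ^ 2)⁻¹ • v - (2 * μ ^ 4)⁻¹ • (i (e v) + j (f v)) +
    (3 * μ ^ 6)⁻¹ • i (e (j (f v))), ?_, ?_⟩
  · have h1 := h.iB_mem _ (h.eD_mem v hv)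
    have h2 := h.jC_mem _ (h.fD_mem v hv)
    have h3 := h.iB_mem _ (h.eD_mem _ h2)
    exact add_mem (sub_mem (SD.smul_mem _ hv) (SD.smul_mem _ (add_mem h1 h2))) (SD.smul_mem _ h3)
  · simp only [map_sub, map_add, map_smul, h.j_i, h.e_i, h.f_j, h.f_i, h.e_j, h.f_e, h.e_e, h.f_f,
      map_zero]
    match_scalars <;> field_simp <;> ring

/-- The operator `3μ² - Z`, `Z = ie + jf`, is onto: since `Z` is the sum of the two
commuting operators `p = ie`, `q = jf` with `p² = μ² p` and `q² = μ² q`, its inverse is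
`(3μ²)⁻¹ + (6μ⁴)⁻¹ Z + (3μ⁶)⁻¹ p q`. -/
theorem exists_sub_eq (h : IsModelProblem A B C D e f i j (μ ^ 2) SW SA SB SC SD) (hμ : μ ≠ 0)
    {v : U} (hv : v ∈ SD) :
    ∃ u ∈ SD, (3 * μ ^ 2) • u - (i (e u) + j (f u)) = v := by
  refine ⟨(3 * μ ^ 2)⁻¹ • v + (6 * μ ^ 4)⁻¹ • (i (e v) + j (f v)) +
    (3 * μ ^ 6)⁻¹ • i (e (j (f v))), ?_, ?_⟩
  · have h1 := h.iB_mem _ (h.eD_mem v hv)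
    have h2 := h.jC_mem _ (h.fD_mem v hv)
    have h3 := h.iB_mem _ (h.eD_mem _ h2)
    exact add_mem (add_mem (SD.smul_mem _ hv) (SD.smul_mem _ (add_mem h1 h2))) (SD.smul_mem _ h3)
  · simp only [map_sub, map_add, map_smul, h.j_i, h.e_i, h.f_j, h.f_i, h.e_j, h.f_e, h.e_e, h.f_f,
      map_zero]
    match_scalars <;> field_simp <;> ring

theorem eq_zero_of_add_eq_zero (h : IsModelProblem A B C D e f i j (μ ^ 2) SW SA SB SC SD)
    (hμ : μ ≠ 0) {u : U} (hu : μ ^ 2 • u + (i (e u) + j (f u)) = 0) : u = 0 := by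
  have key : u = (μ ^ 2)⁻¹ • (μ ^ 2 • u + (i (e u) + j (f u))) - (2 * μ ^ 4)⁻¹ •
      (i (e (μ ^ 2 • u + (i (e u) + j (f u)))) + j (f (μ ^ 2 • u + (i (e u) + j (f u))))) +
      (3 * μ ^ 6)⁻¹ • i (e (j (f (μ ^ 2 • u + (i (e u) + j (f u)))))) := by
    simp only [map_sub, map_add, map_smul, h.j_i, h.e_i, h.f_j, h.f_i, h.e_j, h.f_e, h.e_e, h.f_f,
      map_zero]
    match_scalars <;> field_simp <;> ring
  rw [key, hu]
  simp

theorem eq_zero_of_sub_eq_zero (h : IsModelProblem A B C D e f i j (μ ^ 2) SW SA SB SC SD)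
    (hμ : μ ≠ 0) {u : U} (hu : (3 * μ ^ 2) • u - (i (e u) + j (f u)) = 0) : u = 0 := by
  have key : u = (3 * μ ^ 2)⁻¹ • ((3 * μ ^ 2) • u - (i (e u) + j (f u))) + (6 * μ ^ 4)⁻¹ •
      (i (e ((3 * μ ^ 2) • u - (i (e u) + j (f u)))) +
        j (f ((3 * μ ^ 2) • u - (i (e u) + j (f u))))) +
      (3 * μ ^ 6)⁻¹ • i (e (j (f ((3 * μ ^ 2) • u - (i (e u) + j (f u)))))) := by
    simp only [map_sub, map_add, map_smul, h.j_i, h.e_i, h.f_j, h.f_i, h.e_j, h.f_e, h.e_e, h.f_f,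
      map_zero]
    match_scalars <;> field_simp <;> ring
  rw [key, hu]
  simp

/-- The boundary data with values in the prescribed submodules. -/
def dataSubmodule (SA SB SC SD : Submodule ℂ U) : Submodule ℂ (Fin 8 → U) :=
  Submodule.pi univ ![SA, SB, SC, SA, SC, SB, SD, SD]

theorem mem_dataSubmodule {θ : Fin 8 → U} : θ ∈ dataSubmodule SA SB SC SD ↔
    θ 0 ∈ SA ∧ θ 1 ∈ SB ∧ θ 2 ∈ SC ∧ θ 3 ∈ SA ∧ θ 4 ∈ SC ∧ θ 5 ∈ SB ∧ θ 6 ∈ SD ∧ θ 7 ∈ SD := by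
  simp only [dataSubmodule, Submodule.mem_pi, mem_univ, true_imp_iff]
  simp [Fin.forall_fin_succ]

theorem modelBoundary_mem (h : IsModelProblem A B C D e f i j (μ ^ 2) SW SA SB SC SD) {a b : W}
    (ha : a ∈ SW) (hb : b ∈ SW) :
    modelBoundary A B C D e f i j ε μ (a, b) ∈ dataSubmodule SA SB SC SD := by
  obtain ⟨h0, h1, h2, h3, h4, h5⟩ := modelBoundary_of_le_five (A := A) (B := B) (C := C) (D := D)
    (e := e) (f := f) (i := i) (j := j) (ε := ε) (μ := μ) a b
  have Aa := h.A_mem a ha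
  have Ba := h.B_mem a ha
  have Ca := h.C_mem a ha
  have Da := h.D_mem a ha
  have Ab := h.A_mem b hb
  have Bb := h.B_mem b hb
  have Cb := h.C_mem b hb
  have Db := h.D_mem b hb
  have ij {v : U} (hv : v ∈ SA) : i (j v) ∈ SD := h.iB_mem _ (h.jA_mem _ hv)
  have ei {v : U} (hv : v ∈ SD) : e (i v) ∈ SD := by
    rw [h.e_i]
    exact sub_mem (SD.smul_mem _ hv) (h.iB_mem _ (h.eD_mem _ hv))
  have fj {v : U} (hv : v ∈ SD) : f (j v) ∈ SD := by
    rw [h.f_j]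
    exact sub_mem (SD.smul_mem _ hv) (h.jC_mem _ (h.fD_mem _ hv))
  have eij {v : U} (hv : v ∈ SC) : e (i (j v)) ∈ SD := ei (h.jC_mem _ hv)
  have fij {v : U} (hv : v ∈ SB) : f (i (j v)) ∈ SD := by
    rw [← h.j_i]
    exact fj (h.iB_mem _ hv)
  rw [mem_dataSubmodule, h0, h1, h2, h3, h4, h5, modelBoundary_six, modelBoundary_seven]
  refine ⟨Aa, Ba, Ca, ?_, ?_, ?_, ?_, ?_⟩
  · exact sub_mem (sub_mem (SA.smul_mem _ Aa) Ab)
      (SA.smul_mem _ (add_mem (h.eC_mem _ Ca) (h.fB_mem _ Ba)))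
  · exact add_mem (sub_mem (SC.smul_mem _ Ca) Cb)
      (SC.smul_mem _ (sub_mem (h.iA_mem _ Aa) (h.fD_mem _ Da)))
  · exact add_mem (sub_mem (SB.smul_mem _ Ba) Bb)
      (SB.smul_mem _ (sub_mem (h.jA_mem _ Aa) (h.eD_mem _ Da)))
  · exact SD.smul_mem _ (sub_mem (sub_mem (sub_mem (SD.smul_mem _ Da) (SD.smul_mem _ Db)) (ij Aa))
      (SD.smul_mem _ (sub_mem (add_mem (h.iB_mem _ Bb) (h.jC_mem _ Cb))
        (SD.smul_mem _ (add_mem (h.iB_mem _ Ba) (h.jC_mem _ Ca))))))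
  · exact SD.smul_mem _ (add_mem (sub_mem (add_mem (sub_mem (sub_mem
      (add_mem (ij (sub_mem Ab (SA.smul_mem _ Aa))) (add_mem (ei Db) (fj Db)))
      (SD.smul_mem _ (add_mem (ei Da) (fj Da)))) (SD.smul_mem _ Db)) (SD.smul_mem _ Da))
      (SD.smul_mem _ (add_mem (eij Ca) (fij Ba)))) (SD.smul_mem _ (sub_mem
        (SD.smul_mem _ (add_mem (h.iB_mem _ Ba) (h.jC_mem _ Ca)))
        (SD.smul_mem _ (add_mem (h.iB_mem _ Bb) (h.jC_mem _ Cb))))))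

/-- If the boundary data vanish, the triangular system gives `D b + μ D a = 0`, then `D a = 0`, and
then all other components vanish. -/
theorem modelBoundary_injective (h : IsModelProblem A B C D e f i j (μ ^ 2) SW SA SB SC SD)
    (hε : ε = 1 ∨ ε = -1) (hμ : μ ≠ 0) :
    Function.Injective (modelBoundary A B C D e f i j ε μ) := by
  rw [injective_iff_map_eq_zero]
  rintro ⟨a, b⟩ hab
  have E := h.equations hε a b
  rw [hab] at E
  obtain ⟨hAa, hBa, hCa, hAb, hCb, hBb, hDa, hDb⟩ := E
  simp only [rhsSix, rhsSeven, Pi.zero_apply, map_zero, smul_zero, sub_zero, add_zero, neg_zero,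
    zero_add, zero_sub] at hAa hBa hCa hAb hCb hBb hDa hDb
  have hu := h.eq_zero_of_add_eq_zero hμ hDb
  rw [hu, smul_zero] at hDa
  have hp := h.eq_zero_of_sub_eq_zero hμ hDa
  rw [hp, smul_zero, add_zero] at hu
  rw [hp, map_zero, neg_zero, smul_zero] at hCb hBb
  rw [h.eq_zero a hAa hBa hCa hp, h.eq_zero b hAb hBb hCb hu]
  rfl

/-- Any boundary data are attained: the triangular system is solved for `D b + μ D a` and `D a`, and
the other components are then read off. -/
theorem exists_modelBoundary_eq (h : IsModelProblem A B C D e f i j (μ ^ 2) SW SA SB SC SD)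
    (hε : ε = 1 ∨ ε = -1) (hμ : μ ≠ 0) {θ : Fin 8 → U} (hθ : θ ∈ dataSubmodule SA SB SC SD) :
    ∃ a ∈ SW, ∃ b ∈ SW, modelBoundary A B C D e f i j ε μ (a, b) = θ := by
  obtain ⟨h0, h1, h2, h3, h4, h5, h6, h7⟩ := mem_dataSubmodule.1 hθ
  have ij {v : U} (hv : v ∈ SA) : i (j v) ∈ SD := h.iB_mem _ (h.jA_mem _ hv)
  have ei {v : U} (hv : v ∈ SD) : e (i v) ∈ SD := by
    rw [h.e_i]
    exact sub_mem (SD.smul_mem _ hv) (h.iB_mem _ (h.eD_mem _ hv))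
  have fj {v : U} (hv : v ∈ SD) : f (j v) ∈ SD := by
    rw [h.f_j]
    exact sub_mem (SD.smul_mem _ hv) (h.jC_mem _ (h.fD_mem _ hv))
  have fij {v : U} (hv : v ∈ SB) : f (i (j v)) ∈ SD := by
    rw [← h.j_i]
    exact fj (h.iB_mem _ hv)
  have hsum {v w : U} (hv : v ∈ SB) (hw : w ∈ SC) : i v + j w ∈ SD :=
    add_mem (h.iB_mem _ hv) (h.jC_mem _ hw)
  have hr6 : rhsSix i j ε θ ∈ SD :=
    sub_mem (sub_mem (SD.smul_mem _ h6) (ij h0)) (SD.smul_mem _ (hsum h5 h4))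
  have hr7 : rhsSeven e f i j ε μ θ ∈ SD :=
    add_mem (sub_mem (sub_mem (neg_mem (SD.smul_mem _ h7)) (SD.smul_mem _ (sub_mem (add_mem
      (add_mem (add_mem (ei (h.jC_mem _ h2)) (fij h1))
        (ij (add_mem (h.eC_mem _ h2) (h.fB_mem _ h1)))) (SD.smul_mem _ (hsum h1 h2)))
      (SD.smul_mem _ (hsum h5 h4))))) (ij h3)) (SD.smul_mem _ (ij h0))
  obtain ⟨u, hu, hu'⟩ := h.exists_add_eq hμ hr7
  obtain ⟨p, hp, hp'⟩ := h.exists_sub_eq hμ (add_mem hr6 (SD.smul_mem (2 * μ) hu))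
  obtain ⟨a, ha, hAa, hBa, hCa, hDa⟩ := h.exists_components _ h0 _ h1 _ h2 _ hp
  obtain ⟨b, hb, hAb, hBb, hCb, hDb⟩ := h.exists_components
    (μ • θ 0 - θ 3 - Complex.I • (e (θ 2) + f (θ 1)))
    (sub_mem (sub_mem (SA.smul_mem _ h0) h3)
      (SA.smul_mem _ (add_mem (h.eC_mem _ h2) (h.fB_mem _ h1))))
    (μ • θ 1 - θ 5 + Complex.I • (j (θ 0) - e p))
    (add_mem (sub_mem (SB.smul_mem _ h1) h5)
      (SB.smul_mem _ (sub_mem (h.jA_mem _ h0) (h.eD_mem _ hp))))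
    (μ • θ 2 - θ 4 + Complex.I • (i (θ 0) - f p))
    (add_mem (sub_mem (SC.smul_mem _ h2) h4)
      (SC.smul_mem _ (sub_mem (h.iA_mem _ h0) (h.fD_mem _ hp))))
    (u - μ • p) (sub_mem hu (SD.smul_mem _ hp))
  -- `(a, b)` satisfies the equations both for its own boundary data and for `θ`, and the equations
  -- determine the data.
  refine ⟨a, ha, b, hb, ?_⟩
  have E := h.equations hε a b
  generalize modelBoundary A B C D e f i j ε μ (a, b) = τ at E
  have e0 : τ 0 = θ 0 := E.A_a.symm.trans hAa
  have e1 : τ 1 = θ 1 := E.B_a.symm.trans hBa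
  have e2 : τ 2 = θ 2 := E.C_a.symm.trans hCa
  have e3 : τ 3 = θ 3 := by
    have := hAb.symm.trans E.A_b
    rw [e0, e1, e2] at this
    simpa using this.symm
  have e4 : τ 4 = θ 4 := by
    have := hCb.symm.trans E.C_b
    rw [e0, e2, hDa] at this
    simpa using this.symm
  have e5 : τ 5 = θ 5 := by
    have := hBb.symm.trans E.B_b
    rw [e0, e1, hDa] at this
    simpa using this.symm
  have hu'' : D b + μ • D a = u := by rw [hDb, hDa, sub_add_cancel]
  have hε0 : ε ≠ 0 := by rcases hε with rfl | rfl <;> simp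
  have e6 : τ 6 = θ 6 := by
    have := E.D_a
    rw [hu'', hDa, hp', rhsSix, rhsSix, e0, e4, e5] at this
    simpa [hε0] using this.symm
  have e7 : τ 7 = θ 7 := by
    have := E.D_b
    rw [hu'', hu', rhsSeven, rhsSeven, e0, e1, e2, e3, e4, e5] at this
    simpa [hε0] using this.symm
  funext r
  fin_cases r
  exacts [e0, e1, e2, e3, e4, e5, e6, e7]

/-- Exchange of the form part and the vector part. -/
theorem swap {c : ℂ} (h : IsModelProblem A B C D e f i j c SW SA SB SC SD) :
    IsModelProblem A C B D f e j i c SW SA SC SB SD where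
  e_e := h.f_f
  f_f := h.e_e
  i_i := h.j_j
  j_j := h.i_i
  e_i := h.f_j
  f_j := h.e_i
  f_e v := (h.f_e v).symm
  j_i v := (h.j_i v).symm
  f_i := h.e_j
  e_j := h.f_i
  A_mem := h.A_mem
  B_mem := h.C_mem
  C_mem := h.B_mem
  D_mem := h.D_mem
  eC_mem := h.fB_mem
  eD_mem := h.fD_mem
  fB_mem := h.eC_mem
  fD_mem := h.eD_mem
  iA_mem := h.jA_mem
  iB_mem := h.jC_mem
  jA_mem := h.iA_mem
  jC_mem := h.iB_mem
  eq_zero w hA hC hB hD := h.eq_zero w hA hB hC hD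
  exists_components a ha c hc b hb d hd := by
    obtain ⟨w, hw, h1, h2, h3, h4⟩ := h.exists_components a ha b hb c hc d hd
    exact ⟨w, hw, h1, h3, h2, h4⟩

/-- Exchange of the tangential and the normal components in the form part. -/
theorem flip {c : ℂ} (h : IsModelProblem A B C D e f i j c SW SA SB SC SD) :
    IsModelProblem C D A B (-i) f (-e) j c SW SC SD SA SB where
  e_e v := by simp [h.i_i]
  f_f := h.f_f
  i_i v := by simp [h.e_e]
  j_j := h.j_j
  e_i v := by simp [h.e_i]
  f_j := h.f_j
  f_e v := by simp [h.f_i]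
  j_i v := by simp [h.e_j]
  f_i v := by simp [h.f_e]
  e_j v := by simp [h.j_i]
  A_mem := h.C_mem
  B_mem := h.D_mem
  C_mem := h.A_mem
  D_mem := h.B_mem
  eC_mem v hv := neg_mem (h.iA_mem v hv)
  eD_mem v hv := neg_mem (h.iB_mem v hv)
  fB_mem := h.fD_mem
  fD_mem := h.fB_mem
  iA_mem v hv := neg_mem (h.eC_mem v hv)
  iB_mem v hv := neg_mem (h.eD_mem v hv)
  jA_mem := h.jC_mem
  jC_mem := h.jA_mem
  eq_zero w hC hD hA hB := h.eq_zero w hA hB hC hD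
  exists_components c hc d hd a ha b hb := by
    obtain ⟨w, hw, h1, h2, h3, h4⟩ := h.exists_components a ha b hb c hc d hd
    exact ⟨w, hw, h3, h4, h1, h2⟩

end IsModelProblem

end ModelProblem

/-! ### The Lopatinskij-Shapiro condition -/

section Curves

variable {d : ℕ}

/-- A parametrization `Θ` of the domain by a submodule of `Z`, along which `f` becomes the injective
linear map `Λ`, shows that `f` is a linear isomorphism onto `Λ '' K`. -/
theorem isLinearIso_of_injective {X Y Z : Type*} [AddCommGroup X] [Module ℂ X] [AddCommGroup Y]
    [Module ℂ Y] [AddCommGroup Z] [Module ℂ Z] (Θ : Z →ₗ[ℂ] X) (Λ : Z →ₗ[ℂ] Y) {f : X → Y}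
    (K : Submodule ℂ Z) (hf : ∀ z, f (Θ z) = Λ z) (hΛ : Function.Injective Λ) :
    IsLinearIso f (Θ '' K) (Λ '' K) := by
  have hΘ : Function.Injective Θ := fun z w h => hΛ (by rw [← hf, ← hf, h])
  refine ⟨K.map Θ, K.map Λ, (Submodule.equivMapOfInjective Θ hΘ K).symm ≪≫ₗ
    Submodule.equivMapOfInjective Λ hΛ K, Submodule.map_coe _ _, Submodule.map_coe _ _, ?_⟩
  intro x
  obtain ⟨z, rfl⟩ := (Submodule.equivMapOfInjective Θ hΘ K).surjective x
  rw [LinearEquiv.trans_apply, LinearEquiv.symm_apply_apply,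
    Submodule.coe_equivMapOfInjective_apply, Submodule.coe_equivMapOfInjective_apply, hf]

theorem smul_apply_eq_real_smul (c : ℝ) (η : GForm d) (k m : ℕ) :
    ((c : ℂ) • η) k m = c • η k m := by
  ext X Y
  simp

/-- The curve `s ↦ e^{-μs} (a + s b)` of graded double forms, as a linear function of `(a, b)`. -/
def decayCurve (d : ℕ) (μ : ℝ) : GForm d × GForm d →ₗ[ℂ] (ℝ → GForm d) where
  toFun x s k m := expCurve (-μ) (x.1 k m) (x.2 k m) s
  map_add' x y := by
    funext s k m
    simp only [Prod.fst_add, Prod.snd_add, Pi.add_apply, expCurve]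
    module
  map_smul' c x := by
    funext s k m
    ext X Y
    simp [expCurve]
    ring

theorem decayCurve_apply (μ : ℝ) (a b : GForm d) (s : ℝ) (k m : ℕ) :
    decayCurve d μ (a, b) s k m = expCurve (-μ) (a k m) (b k m) s := rfl

theorem curveDeriv_decayCurve (μ : ℝ) (x : GForm d × GForm d) {l : ℕ} (hl : l ≤ 3) :
    curveDeriv l (decayCurve d μ x) 0 = decayDeriv (μ : ℂ) l x := by
  obtain ⟨a, b⟩ := x
  funext k m
  change iteratedDeriv l (expCurve (-μ) (a k m) (b k m)) 0 = _
  have h0 (v w : DForm (Euc d) ℂ k m) : expCurve (-μ) v w 0 = v := by simp [expCurve]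
  have hr (c : ℝ) (v : GForm d) := smul_apply_eq_real_smul c v k m
  match l with
  | 0 => rw [iteratedDeriv_zero, h0]; rfl
  | 1 =>
    have h2 := hr μ a
    rw [iteratedDeriv_expCurve_one, h0]
    simp only [decayDeriv, LinearMap.sub_apply, LinearMap.smul_apply, LinearMap.fst_apply,
      LinearMap.snd_apply, Pi.sub_apply]
    rw [h2]
    module
  | 2 =>
    have h2 := hr (μ ^ 2) a
    have h3 := hr (2 * μ) b
    push_cast at h2 h3
    rw [iteratedDeriv_expCurve_two, h0]
    simp only [decayDeriv, LinearMap.sub_apply, LinearMap.smul_apply, LinearMap.fst_apply,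
      LinearMap.snd_apply, Pi.sub_apply]
    rw [h2, h3]
    module
  | 3 =>
    have h2 := hr (3 * μ ^ 2) b
    have h3 := hr (μ ^ 3) a
    push_cast at h2 h3
    rw [iteratedDeriv_expCurve_three, h0]
    simp only [decayDeriv, LinearMap.sub_apply, LinearMap.smul_apply, LinearMap.fst_apply,
      LinearMap.snd_apply, Pi.sub_apply]
    rw [h2, h3]
    module
  | l + 4 => omega

end Curves

namespace LocalData

variable {n : ℕ} {L : LocalData n} {y : Euc n} {ξ : Euc (n + 1) →L[ℝ] ℝ}

/-- The coefficients of `t ↦ (c² + t²)²`. -/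
def bilaplacianCoeff (d : ℕ) (c : ℂ) : ℕ → (GForm d →ₗ[ℂ] GForm d)
  | 0 => c ^ 4 • LinearMap.id
  | 2 => (2 * c ^ 2) • LinearMap.id
  | 4 => LinearMap.id
  | _ => 0

theorem shift_sharp_shift (hL : L.IsRegularAt (bdry n y)) (hξ : ξ (L.normal (bdry n y)) = 0)
    (t : ℝ) : L.shift y ξ t (sharp L.G (bdry n y) (L.shift y ξ t)) =
      ξ (sharp L.G (bdry n y) ξ) + t ^ 2 := by
  rw [hL.sharp_shift hξ, hL.sharp_eq_bdry_sharp hξ]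
  simp [hL.isConormalPair.apply_bdry, hL.isConormalPair.apply_normal, hξ]
  ring

/-- The ordinary differential operator associated with `𝐁` is `(c² - ∂ₛ²)²`, `c = |ξ|`. -/
theorem odeOp_bilaplacian (hL : L.IsRegularAt (bdry n y)) (hξ : ξ (L.normal (bdry n y)) = 0)
    {c : ℝ} (hc : c ^ 2 = ξ (sharp L.G (bdry n y) ξ)) (σ : ℝ → GForm (n + 1)) (s : ℝ) :
    odeOp (fun ψ => evalAt (L.bilaplacian ψ) (bdry n y)) 4 (bdry n y) ξ (L.dr (bdry n y)) σ s =
      fun k m => iteratedDeriv 4 (fun s => σ s k m) s -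
        (2 * c ^ 2) • iteratedDeriv 2 (fun s => σ s k m) s + c ^ 4 • σ s k m := by
  rw [odeOp_eq (C := bilaplacianCoeff (n + 1) c) (fun t η => ?_)]
  · funext k m
    have h1 := smul_apply_eq_real_smul (c ^ 4) (σ s) k m
    have h2 := smul_apply_eq_real_smul (2 * c ^ 2) (curveDeriv 2 σ s) k m
    push_cast at h1 h2
    have h0 : curveDeriv 0 σ s = σ s := by
      funext k m
      simp [curveDeriv]
    simp only [Finset.sum_range_succ, Finset.sum_range_zero, bilaplacianCoeff, h0,
      LinearMap.zero_apply, LinearMap.smul_apply, LinearMap.id_apply, Complex.I_pow_four, one_smul,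
      Complex.I_sq, pow_zero, smul_zero, add_zero, zero_add, Pi.add_apply, Pi.smul_apply]
    rw [Pi.smul_apply, Pi.smul_apply] at h1 h2
    rw [h1, h2]
    simp only [curveDeriv]
    module
  · have h := (hasSymbol_bilaplacian hL (L.shift y ξ t)).principalSymbol_eq η
    rw [shift_sharp_shift hL hξ, ← hc] at h
    refine h.trans ?_
    congr 1
    simp only [Finset.sum_range_succ, Finset.sum_range_zero, bilaplacianCoeff, LinearMap.add_apply,
      LinearMap.zero_apply, LinearMap.smul_apply, LinearMap.id_apply]
    push_cast
    module

/-- Curves that are bounded solutions of the equation for the symbol of `𝐁`. -/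
theorem boundedSolutions_bilaplacian (hL : L.IsRegularAt (bdry n y))
    (hξ : ξ (L.normal (bdry n y)) = 0) {c : ℝ} (hc0 : 0 < c)
    (hc : c ^ 2 = ξ (sharp L.G (bdry n y) ξ)) (k m : ℕ) :
    boundedSolutions L k m (bilaplacianOp n) (bdry n y) ξ = decayCurve (n + 1) c ''
      ((degSubmodule (n + 1) k m).prod (degSubmodule (n + 1) k m) : Submodule ℂ _) := by
  ext σ
  constructor
  · rintro ⟨hdeg, hsmooth, hbdd, hode⟩
    have hsol (p q : ℕ) : ∃ a b, (fun s => σ s p q) = expCurve (-c) a b := by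
      refine exists_eq_expCurve_of_bounded hc0 (hsmooth p q) (fun s => ?_) (hbdd p q)
      have := (odeOp_bilaplacian hL hξ hc σ s).symm.trans (hode s)
      exact congrFun (congrFun this p) q
    choose a b hab using hsol
    have hσ (s : ℝ) (p q : ℕ) : σ s p q = expCurve (-c) (a p q) (b p q) s := congrFun (hab p q) s
    have ha : HasDegree (d := n + 1) k m a := fun p q hpq => by
      have h0 := hσ 0 p q
      rw [hdeg 0 p q hpq] at h0
      simpa [expCurve] using h0.symm
    have hb : HasDegree (d := n + 1) k m b := fun p q hpq => by
      have h1 := hσ 1 p q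
      rw [hdeg 1 p q hpq, ha p q hpq] at h1
      simpa [expCurve] using h1.symm
    exact ⟨(a, b), ⟨ha, hb⟩, funext fun s => funext fun p => funext fun q => (hσ s p q).symm⟩
  · rintro ⟨⟨a, b⟩, ⟨ha, hb⟩, rfl⟩
    refine ⟨fun s p q hpq => ?_, fun p q => contDiff_expCurve _ _ _,
      fun p q => ⟨_, fun s hs => norm_expCurve_le hc0 _ _ hs⟩, fun s => ?_⟩
    · have ha' : a p q = 0 := ha p q hpq
      have hb' : b p q = 0 := hb p q hpq
      rw [decayCurve_apply, ha', hb']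
      simp [expCurve]
    · refine (odeOp_bilaplacian hL hξ hc _ s).trans (funext fun p => funext fun q => ?_)
      change iteratedDeriv 4 (expCurve (-c) (a p q) (b p q)) s -
        (2 * c ^ 2) • iteratedDeriv 2 (expCurve (-c) (a p q) (b p q)) s +
        c ^ 4 • expCurve (-c) (a p q) (b p q) s = 0
      rw [iteratedDeriv_expCurve_four, iteratedDeriv_expCurve_two]
      simp only [expCurve]
      module

/-- On the curve `e^{-cs} (a + s b)`, the boundary operators with symbols `modelSymbol` take the
values of the algebraic map `modelBoundary` at `(a, b)`. -/
theorem boundaryMap_decayCurve (hL : L.IsRegularAt (bdry n y))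
    {B : Fin 8 → BoundaryOperator n} {A₁ B₁ C₁ D₁ : GForm (n + 1) →ₗ[ℂ] GForm n}
    {e f i j : GForm n →ₗ[ℂ] GForm n} {ε : ℂ} (hord : ∀ r, (B r).order = modelOrder r)
    (hsymb : ∀ (t : ℝ) r, HasSymbol (shiftCov hL ξ t) (restrCov y ξ) ((B r).op L) (modelOrder r)
      (modelSymbol A₁ B₁ C₁ D₁ e f i j ε t r)) (c : ℝ) (x : GForm (n + 1) × GForm (n + 1)) :
    boundaryMap L B y ξ (decayCurve (n + 1) c x) = modelBoundary A₁ B₁ C₁ D₁ e f i j ε c x := by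
  funext r
  rw [boundaryMap, hord]
  refine (odeOp_eq (C := modelCoeff A₁ B₁ C₁ D₁ e f i j ε r)
    (fun t η => (hsymb t r).principalSymbol_eq η) _ _).trans ?_
  rw [modelBoundary, LinearMap.pi_apply, LinearMap.smul_apply, LinearMap.sum_apply]
  congr 1
  refine Finset.sum_congr rfl fun l hl => ?_
  have hl3 : l ≤ 3 := by
    have hr := modelOrder_le_three r
    have := Finset.mem_range.1 hl
    omega
  rw [curveDeriv_decayCurve c x hl3]
  rfl

/-- The Lopatinskij-Shapiro condition for boundary operators whose symbols have the model form. -/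
theorem isLinearIso_boundaryMap (hL : L.IsRegularAt (bdry n y))
    (hξ : ξ (L.normal (bdry n y)) = 0) (hξ0 : ξ ≠ 0) {k m : ℕ}
    {B : Fin 8 → BoundaryOperator n} {A₁ B₁ C₁ D₁ : GForm (n + 1) →ₗ[ℂ] GForm n}
    {e f i j : GForm n →ₗ[ℂ] GForm n} {ε : ℂ} (hε : ε = 1 ∨ ε = -1)
    (hord : ∀ r, (B r).order = modelOrder r)
    (hsymb : ∀ (t : ℝ) r, HasSymbol (shiftCov hL ξ t) (restrCov y ξ) ((B r).op L) (modelOrder r)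
      (modelSymbol A₁ B₁ C₁ D₁ e f i j ε t r))
    {SA SB SC SD : Submodule ℂ (GForm n)}
    (hmodel : IsModelProblem A₁ B₁ C₁ D₁ e f i j (ξ (sharp L.G (bdry n y) ξ) : ℂ)
      (degSubmodule (n + 1) k m) SA SB SC SD)
    (hdata : boundaryData k m B = IsModelProblem.dataSubmodule SA SB SC SD) :
    IsLinearIso (boundaryMap L B y ξ) (boundedSolutions L k m (bilaplacianOp n) (bdry n y) ξ)
      (boundaryData k m B) := by
  have hpos := hL.metric.apply_sharp_pos hξ0
  set c := Real.sqrt (ξ (sharp L.G (bdry n y) ξ)) with hcdef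
  have hc0 : 0 < c := Real.sqrt_pos.2 hpos
  have hc : c ^ 2 = ξ (sharp L.G (bdry n y) ξ) := Real.sq_sqrt hpos.le
  have hcne : (c : ℂ) ≠ 0 := by exact_mod_cast hc0.ne'
  rw [← hc] at hmodel
  push_cast at hmodel
  have himage : boundaryData k m B = modelBoundary A₁ B₁ C₁ D₁ e f i j ε c ''
      ((degSubmodule (n + 1) k m).prod (degSubmodule (n + 1) k m) : Submodule ℂ _) := by
    rw [hdata]
    ext θ
    constructor
    · intro hθ
      obtain ⟨a, ha, b, hb, hab⟩ := hmodel.exists_modelBoundary_eq hε hcne hθ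
      exact ⟨(a, b), ⟨ha, hb⟩, hab⟩
    · rintro ⟨⟨a, b⟩, ⟨ha, hb⟩, rfl⟩
      exact hmodel.modelBoundary_mem ha hb
  rw [boundedSolutions_bilaplacian hL hξ hc0 hc, himage]
  exact isLinearIso_of_injective _ _ _ (boundaryMap_decayCurve hL hord hsymb c)
    (hmodel.modelBoundary_injective hε hcne)

end LocalData

/-! ### The four boundary value problems as model problems -/

section Instances

variable {n : ℕ} {ρ : Euc (n + 1) →L[ℝ] ℝ} {N : Euc (n + 1)}

/-- The model problem for the components `tt, tn, nt, nn` of double forms of degree `(p,q)`. -/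
theorem IsConormalPair.isModelProblem (h : IsConormalPair ρ N) (p q : ℤ) (β : Euc n →L[ℝ] ℝ)
    (v : Euc n) :
    IsModelProblem (compTT n) (compTN N) (compNT N) (compNN N) (extMul β) (extMulV β)
      (contr v) (contrV v) (β v : ℂ) (degSubmodule (n + 1) p q) (degSubmodule n p q)
      (degSubmodule n p (q - 1)) (degSubmodule n (p - 1) q) (degSubmodule n (p - 1) (q - 1)) where
  e_e := extMul_extMul β
  f_f := extMulV_extMulV β
  i_i := contr_contr v
  j_j := contrV_contrV v
  e_i w := by rw [contr_extMul, sub_sub_cancel]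
  f_j w := by rw [contrV_extMulV, sub_sub_cancel]
  f_e := extMulV_extMul β β
  j_i := contrV_contr v v
  f_i := extMulV_contr β v
  e_j w := (contrV_extMul v β w).symm
  A_mem _ hw := hasDegree_compTT hw
  B_mem _ hw := hasDegree_compTN hw N
  C_mem _ hw := hasDegree_compNT hw N
  D_mem _ hw := hasDegree_compNN hw N
  eC_mem _ hw := by simpa only [mem_degSubmodule, sub_add_cancel] using HasDegree.extMul hw β
  eD_mem _ hw := by simpa only [mem_degSubmodule, sub_add_cancel] using HasDegree.extMul hw β
  fB_mem _ hw := by simpa only [mem_degSubmodule, sub_add_cancel] using HasDegree.extMulV hw β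
  fD_mem _ hw := by simpa only [mem_degSubmodule, sub_add_cancel] using HasDegree.extMulV hw β
  iA_mem _ hw := HasDegree.contr hw v
  iB_mem _ hw := HasDegree.contr hw v
  jA_mem _ hw := HasDegree.contrV hw v
  jC_mem _ hw := HasDegree.contrV hw v
  eq_zero _ htt htn hnt hnn := h.eq_zero_of_components htt hnt htn hnn
  exists_components tt htt tn htn nt hnt nn hnn :=
    ⟨IsConormalPair.ofComponents ρ N tt tn nt nn,
      IsConormalPair.hasDegree_ofComponents htt htn hnt hnn,
      h.compTT_ofComponents tt tn nt nn, h.compTN_ofComponents tt tn nt nn,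
      h.compNT_ofComponents tt tn nt nn, h.compNN_ofComponents tt tn nt nn⟩

end Instances

namespace LocalData

variable {n : ℕ} {L : LocalData n} {y : Euc n} {ξ : Euc (n + 1) →L[ℝ] ℝ}

theorem IsRegularAt.isModelProblem (hL : L.IsRegularAt (bdry n y))
    (hξ : ξ (L.normal (bdry n y)) = 0) (p q : ℤ) :
    IsModelProblem (compTT n) (L.cTN y) (L.cNT y) (L.cNN y) (bE ξ) (bEV ξ) (L.bI y ξ) (L.bIV y ξ)
      (ξ (sharp L.G (bdry n y) ξ) : ℂ) (degSubmodule (n + 1) p q) (degSubmodule n p q)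
      (degSubmodule n p (q - 1)) (degSubmodule n (p - 1) q) (degSubmodule n (p - 1) (q - 1)) := by
  rw [hL.sharp_eq_bdry_sharp hξ]
  exact hL.isConormalPair.isModelProblem p q (ξ ∘L bdry n) (sharp L.G₀ y (ξ ∘L bdry n))

theorem lopatinskij_TT (hL : L.IsRegularAt (bdry n y)) (hξ : ξ (L.normal (bdry n y)) = 0)
    (hξ0 : ξ ≠ 0) (k m : ℕ) :
    IsLinearIso (boundaryMap L (boundaryTT n) y ξ)
      (boundedSolutions L k m (bilaplacianOp n) (bdry n y) ξ) (boundaryData k m (boundaryTT n)) := by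
  refine isLinearIso_boundaryMap hL hξ hξ0 (Or.inl rfl) ?_ (hasSymbol_boundaryTT hL hξ)
    (hL.isModelProblem hξ k m) ?_
  · intro r; fin_cases r <;> rfl
  · ext θ
    rw [SetLike.mem_coe, IsModelProblem.mem_dataSubmodule]
    simp [boundaryData, boundaryTT, Fin.forall_fin_succ, mem_degSubmodule, ← sub_eq_add_neg]

theorem lopatinskij_NN (hL : L.IsRegularAt (bdry n y)) (hξ : ξ (L.normal (bdry n y)) = 0)
    (hξ0 : ξ ≠ 0) (k m : ℕ) :
    IsLinearIso (boundaryMap L (boundaryNN n) y ξ)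
      (boundedSolutions L k m (bilaplacianOp n) (bdry n y) ξ) (boundaryData k m (boundaryNN n)) := by
  refine isLinearIso_boundaryMap hL hξ hξ0 (Or.inl rfl) ?_ (hasSymbol_boundaryNN hL hξ)
    (hL.isModelProblem hξ k m).flip.swap.flip ?_
  · intro r; fin_cases r <;> rfl
  · ext θ
    rw [SetLike.mem_coe, IsModelProblem.mem_dataSubmodule]
    simp [boundaryData, boundaryNN, Fin.forall_fin_succ, mem_degSubmodule, ← sub_eq_add_neg]

theorem lopatinskij_NT (hL : L.IsRegularAt (bdry n y)) (hξ : ξ (L.normal (bdry n y)) = 0)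
    (hξ0 : ξ ≠ 0) (k m : ℕ) :
    IsLinearIso (boundaryMap L (boundaryNT n) y ξ)
      (boundedSolutions L k m (bilaplacianOp n) (bdry n y) ξ) (boundaryData k m (boundaryNT n)) := by
  refine isLinearIso_boundaryMap hL hξ hξ0 (Or.inr rfl) ?_ (hasSymbol_boundaryNT hL hξ)
    (hL.isModelProblem hξ k m).flip ?_
  · intro r; fin_cases r <;> rfl
  · ext θ
    rw [SetLike.mem_coe, IsModelProblem.mem_dataSubmodule]
    simp [boundaryData, boundaryNT, Fin.forall_fin_succ, mem_degSubmodule, ← sub_eq_add_neg]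

theorem lopatinskij_TN (hL : L.IsRegularAt (bdry n y)) (hξ : ξ (L.normal (bdry n y)) = 0)
    (hξ0 : ξ ≠ 0) (k m : ℕ) :
    IsLinearIso (boundaryMap L (boundaryTN n) y ξ)
      (boundedSolutions L k m (bilaplacianOp n) (bdry n y) ξ) (boundaryData k m (boundaryTN n)) := by
  refine isLinearIso_boundaryMap hL hξ hξ0 (Or.inr rfl) ?_ (hasSymbol_boundaryTN hL hξ)
    (hL.isModelProblem hξ k m).swap.flip ?_
  · intro r; fin_cases r <;> rfl
  · ext θ
    rw [SetLike.mem_coe, IsModelProblem.mem_dataSubmodule]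
    simp [boundaryData, boundaryTN, Fin.forall_fin_succ, mem_degSubmodule, ← sub_eq_add_neg]

end LocalData

/-! ### The geometric data in a chart -/

section Charts

variable {n : ℕ} {M : Type*} [TopologicalSpace M]
  {e : OpenPartialHomeomorph M (EuclideanHalfSpace (n + 1))} {x : Euc (n + 1)}

theorem extend_target_eventuallyEq_halfSpace (hx : x ∈ (e.extend (𝓡∂ (n + 1))).target) :
    (e.extend (𝓡∂ (n + 1))).target =ᶠ[nhds x] LocalData.halfSpace n := by
  have h := e.extend_target_eventuallyEq (I := 𝓡∂ (n + 1)) (y := (e.extend (𝓡∂ (n + 1))).symm x)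
    (by rw [← e.extend_source (I := 𝓡∂ (n + 1))]; exact (e.extend (𝓡∂ (n + 1))).map_target hx)
  rwa [(e.extend (𝓡∂ (n + 1))).right_inv hx] at h

theorem extend_target_mem_nhdsWithin_halfSpace (hx : x ∈ (e.extend (𝓡∂ (n + 1))).target) :
    (e.extend (𝓡∂ (n + 1))).target ∈ nhdsWithin x (LocalData.halfSpace n) := by
  rw [← nhdsWithin_eq_iff_eventuallyEq.2 (extend_target_eventuallyEq_halfSpace hx)]
  exact self_mem_nhdsWithin

theorem uniqueDiffOn_extend_target : UniqueDiffOn ℝ (e.extend (𝓡∂ (n + 1))).target := by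
  rw [e.extend_target]
  exact (𝓡∂ (n + 1)).uniqueDiffOn_preimage e.open_target

variable [ChartedSpace (EuclideanHalfSpace (n + 1)) M]

theorem contMDiffOn_extend_symm_target
    (he : e ∈ IsManifold.maximalAtlas (𝓡∂ (n + 1)) ∞ M) :
    ContMDiffOn 𝓘(ℝ, Euc (n + 1)) (𝓡∂ (n + 1)) ∞ (e.extend (𝓡∂ (n + 1))).symm
      (e.extend (𝓡∂ (n + 1))).target := by
  rw [e.extend_target']
  exact contMDiffOn_extend_symm he

theorem chartSymmDeriv_eq_mfderivWithin (hx : x ∈ (e.extend (𝓡∂ (n + 1))).target) :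
    chartSymmDeriv (M := M) e x = mfderivWithin 𝓘(ℝ, Euc (n + 1)) (𝓡∂ (n + 1))
      (e.extend (𝓡∂ (n + 1))).symm (e.extend (𝓡∂ (n + 1))).target x := by
  rw [chartSymmDeriv]
  exact (mfderivWithin_congr_set (extend_target_eventuallyEq_halfSpace hx)).symm

theorem chartSymmDeriv_injective (he : e ∈ IsManifold.maximalAtlas (𝓡∂ (n + 1)) ∞ M)
    (hx : x ∈ (e.extend (𝓡∂ (n + 1))).target) :
    Function.Injective (chartSymmDeriv e x) := by
  set φ := e.extend (𝓡∂ (n + 1)) with hφ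
  have hu : UniqueMDiffWithinAt 𝓘(ℝ, Euc (n + 1)) φ.target x :=
    (uniqueDiffOn_extend_target x hx).uniqueMDiffWithinAt
  have h1 : MDifferentiableWithinAt 𝓘(ℝ, Euc (n + 1)) (𝓡∂ (n + 1)) φ.symm φ.target x :=
    (contMDiffOn_extend_symm_target he x hx).mdifferentiableWithinAt (by simp)
  have hsrc : φ.symm x ∈ e.source := by
    rw [← e.extend_source (I := 𝓡∂ (n + 1))]
    exact φ.map_target hx
  have h2 : MDifferentiableAt (𝓡∂ (n + 1)) 𝓘(ℝ, Euc (n + 1)) φ (φ.symm x) :=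
    ((e.contMDiffOn_extend he).contMDiffAt (e.open_source.mem_nhds hsrc)).mdifferentiableAt (by simp)
  have h3 := mfderiv_comp_mfderivWithin x h2 h1 hu
  have h4 : mfderivWithin 𝓘(ℝ, Euc (n + 1)) 𝓘(ℝ, Euc (n + 1)) (φ ∘ φ.symm) φ.target x =
      mfderivWithin 𝓘(ℝ, Euc (n + 1)) 𝓘(ℝ, Euc (n + 1)) id φ.target x :=
    mfderivWithin_congr (fun z hz => φ.right_inv hz) (φ.right_inv hx)
  rw [h4, mfderivWithin_id hu, ← chartSymmDeriv_eq_mfderivWithin hx] at h3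
  intro u v huv
  have h5 (w : Euc (n + 1)) : w = mfderiv (𝓡∂ (n + 1)) 𝓘(ℝ, Euc (n + 1)) φ (φ.symm x)
      (chartSymmDeriv e x w) := congrArg (fun T : Euc (n + 1) →L[ℝ] Euc (n + 1) => T w) h3
  rw [h5 u, h5 v, huv]

variable [IsManifold (𝓡∂ (n + 1)) ∞ M]

theorem contDiffOn_localMetric (g : Metric n M)
    (he : e ∈ IsManifold.maximalAtlas (𝓡∂ (n + 1)) ∞ M) :
    ContDiffOn ℝ ∞ (localMetric g e) (e.extend (𝓡∂ (n + 1))).target := by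
  have hφ := contMDiffOn_extend_symm_target he
  have hT := hφ.contMDiffOn_tangentMapWithin (m := ∞) (by simp)
    uniqueDiffOn_extend_target.uniqueMDiffOn
  have hv (u : Euc (n + 1)) : ContMDiffOn 𝓘(ℝ, Euc (n + 1)) (𝓡∂ (n + 1)).tangent ∞
      (fun y => (Bundle.TotalSpace.mk' (Euc (n + 1)) ((e.extend (𝓡∂ (n + 1))).symm y)
        (chartSymmDeriv e y u) : TangentBundle (𝓡∂ (n + 1)) M))
      (e.extend (𝓡∂ (n + 1))).target := by
    have hs : ContMDiffOn 𝓘(ℝ, Euc (n + 1)) 𝓘(ℝ, Euc (n + 1)).tangent ∞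
        (fun y => (⟨y, u⟩ : TangentBundle 𝓘(ℝ, Euc (n + 1)) (Euc (n + 1))))
        (e.extend (𝓡∂ (n + 1))).target := fun y _ =>
      contMDiffWithinAt_vectorSpace_iff_contDiffWithinAt.2 contDiffWithinAt_const
    refine (hT.comp hs fun y hy => hy).congr fun y hy => ?_
    rw [chartSymmDeriv_eq_mfderivWithin hy]
    rfl
  refine contDiffOn_clm_apply.2 fun u => contDiffOn_clm_apply.2 fun v => fun x hx => ?_
  have hg : ContMDiffWithinAt 𝓘(ℝ, Euc (n + 1)) ((𝓡∂ (n + 1)).prod 𝓘(ℝ)) ∞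
      (fun y => Bundle.TotalSpace.mk' ℝ (E := Bundle.Trivial M ℝ) ((e.extend (𝓡∂ (n + 1))).symm y)
        (g.inner ((e.extend (𝓡∂ (n + 1))).symm y) (chartSymmDeriv e y u) (chartSymmDeriv e y v)))
      (e.extend (𝓡∂ (n + 1))).target x := by
    apply ContMDiffWithinAt.clm_bundle_apply₂ (F₁ := Euc (n + 1)) (F₂ := Euc (n + 1))
    · exact ContMDiffAt.comp_contMDiffWithinAt x g.contMDiff.contMDiffAt (hφ x hx)
    · exact hv u x hx
    · exact hv v x hx
  simp only [Bundle.contMDiffWithinAt_totalSpace] at hg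
  exact hg.2.contDiffWithinAt

theorem localData_isRegularAt (g : Metric n M) (P : TensorialOperators g)
    (he : e ∈ IsManifold.maximalAtlas (𝓡∂ (n + 1)) ∞ M)
    (hx : x ∈ (e.extend (𝓡∂ (n + 1))).target) : (localData g P e).IsRegularAt x where
  mem := e.extend_target_subset_range hx
  metric :=
    { contDiffWithinAt := (contDiffOn_localMetric g he x hx).mono_of_mem_nhdsWithin
        (extend_target_mem_nhdsWithin_halfSpace hx)
      symm := fun u v => g.symm _ _ _
      pos := fun v hv => by
        refine g.pos _ _ fun h0 => hv (chartSymmDeriv_injective he hx ?_)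
        rw [map_zero]
        exact h0 }
  smooth_D k m := (P.smooth_D k m e he x hx).mono_of_mem_nhdsWithin
    (extend_target_mem_nhdsWithin_halfSpace hx)
  smooth_Dst k m := (P.smooth_Dst k m e he x hx).mono_of_mem_nhdsWithin
    (extend_target_mem_nhdsWithin_halfSpace hx)
  smooth_S k m := (P.smooth_S k m e he x hx).mono_of_mem_nhdsWithin
    (extend_target_mem_nhdsWithin_halfSpace hx)
  smooth_Sst k m := (P.smooth_Sst k m e he x hx).mono_of_mem_nhdsWithin
    (extend_target_mem_nhdsWithin_halfSpace hx)

end Charts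

/-! ### Ellipticity -/

section Ellipticity

variable {d : ℕ}

/-- The wedge product of `dx₀, …, dx_{k-1}` with a nonzero form of degree `(0,m)` does not vanish:
it is recovered by contraction with the basis vectors. -/
theorem exists_hasDegree_of_zero {m : ℤ} {η₀ : GForm d} (h₀ : HasDegree 0 m η₀) (hne : η₀ ≠ 0)
    {k : ℕ} (hk : k ≤ d) : ∃ η : GForm d, HasDegree k m η ∧ η ≠ 0 ∧
      ∀ i : Fin d, k ≤ i → contr (EuclideanSpace.single i 1) η = 0 := by
  induction k with
  | zero =>
    refine ⟨η₀, h₀, hne, fun i _ => funext fun p => funext fun q => ?_⟩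
    exact h₀.contr (EuclideanSpace.single i 1) p q (by omega)
  | succ k ih =>
    obtain ⟨η, hη, hη0, hc⟩ := ih (by omega)
    have hval (i : Fin d) : contr (EuclideanSpace.single i 1)
        (extMul (EuclideanSpace.proj ⟨k, hk⟩) η) = if (i : ℕ) = k then η -
          extMul (EuclideanSpace.proj ⟨k, hk⟩) (contr (EuclideanSpace.single i 1) η)
          else -extMul (EuclideanSpace.proj ⟨k, hk⟩) (contr (EuclideanSpace.single i 1) η) := by
      rw [contr_extMul]
      by_cases hi : (i : ℕ) = k
      · obtain rfl : i = ⟨k, hk⟩ := Fin.ext hi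
        simp
      · have : (⟨k, hk⟩ : Fin d) ≠ i := fun h => hi (by rw [← h])
        simp [hi, this]
    refine ⟨extMul (EuclideanSpace.proj ⟨k, hk⟩) η, by exact_mod_cast hη.extMul _, fun h0 => ?_,
      fun i hi => ?_⟩
    · have := hval ⟨k, hk⟩
      rw [h0, map_zero, if_pos rfl, hc _ le_rfl, map_zero, sub_zero] at this
      exact hη0 this.symm
    · rw [hval, if_neg (by omega), hc i (by omega), map_zero, neg_zero]

/-- The constant double form `1` of degree `(0,0)`. -/
def oneForm (d : ℕ) : GForm d
  | 0, 0 => ContinuousAlternatingMap.constOfIsEmpty ℝ (Euc d) (Fin 0)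
      (ContinuousAlternatingMap.constOfIsEmpty ℝ (Euc d) (Fin 0) (1 : ℂ))
  | _, _ => 0

theorem exists_hasDegree_ne_zero {k m : ℕ} (hk : k ≤ d) (hm : m ≤ d) :
    ∃ η : GForm d, HasDegree k m η ∧ η ≠ 0 := by
  have h1 : HasDegree 0 0 (oneForm d) := fun p q hpq => by
    match p, q with
    | 0, 0 => simp at hpq
    | 0, q + 1 => rfl
    | p + 1, q => rfl
  have h1' : oneForm d ≠ 0 := fun h => by
    have := congrArg (fun η : GForm d => η 0 0 0 0) h
    simp [oneForm] at this
  obtain ⟨η, hη, hη0, -⟩ := exists_hasDegree_of_zero h1 h1' hm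
  have h2 : transG η ≠ 0 := fun h => hη0 (by rw [← transG_transG η, h, map_zero])
  obtain ⟨ζ, hζ, hζ0, -⟩ := exists_hasDegree_of_zero hη.transG h2 hk
  exact ⟨ζ, hζ, hζ0⟩

end Ellipticity

namespace LocalData

variable {n : ℕ} {L : LocalData n} {x : Euc (n + 1)}

/-- The principal symbol `|ξ|⁴` of `𝐁` is invertible exactly for `ξ ≠ 0`. -/
theorem isLinearIso_principalSymbol_iff (hL : L.IsRegularAt x) {k m : ℕ} (hk : k ≤ n + 1)
    (hm : m ≤ n + 1) (ξ : Euc (n + 1) →L[ℝ] ℝ) :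
    IsLinearIso (principalSymbol (fun ψ => evalAt (L.bilaplacian ψ) x) 4 x ξ)
      {η | HasDegree k m η} {η | HasDegree k m η} ↔ ξ ≠ 0 := by
  have hP (η : GForm (n + 1)) : principalSymbol (fun ψ => evalAt (L.bilaplacian ψ) x) 4 x ξ η =
      ((ξ (sharp L.G x ξ) : ℂ) ^ 2) • η := by
    refine ((hasSymbol_bilaplacian hL ξ).principalSymbol_eq η).trans ?_
    rw [Complex.I_pow_four, one_smul]
    rfl
  constructor
  · rintro ⟨p, q, Φ, hp, hq, hΦ⟩ rfl
    obtain ⟨η, hη, hη0⟩ := exists_hasDegree_ne_zero hk hm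
    have hmem : η ∈ p := by
      rw [← SetLike.mem_coe, hp]
      exact hη
    have h0 : Φ ⟨η, hmem⟩ = 0 := by
      refine Subtype.ext ((hΦ _).trans ((hP η).trans ?_))
      simp
    exact hη0 (congrArg Subtype.val (Φ.map_eq_zero_iff.1 h0))
  · intro hξ
    have hc : (ξ (sharp L.G x ξ) : ℂ) ^ 2 ≠ 0 := by
      have := (hL.metric.apply_sharp_pos hξ).ne'
      exact pow_ne_zero _ (by exact_mod_cast this)
    exact ⟨degSubmodule (n + 1) k m, degSubmodule (n + 1) k m,
      LinearEquiv.smulOfNeZero ℂ _ _ hc, rfl, rfl, fun η => (hP η).symm⟩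

end LocalData

section Assembly

variable {n : ℕ} {M : Type*} [TopologicalSpace M] [ChartedSpace (EuclideanHalfSpace (n + 1)) M]
  [IsManifold (𝓡∂ (n + 1)) ∞ M]

theorem isRegularElliptic_bilaplacian (g : Metric n M) (P : TensorialOperators g) {k m : ℕ}
    (hk : k ≤ n + 1) (hm : m ≤ n + 1) {B : Fin 8 → BoundaryOperator n}
    (hord : ∀ j, (B j).order = modelOrder j)
    (hB : ∀ (L : LocalData n) (y : Euc n) (ξ : Euc (n + 1) →L[ℝ] ℝ), L.IsRegularAt (bdry n y) →
      ξ (L.normal (bdry n y)) = 0 → ξ ≠ 0 → IsLinearIso (boundaryMap L B y ξ)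
        (boundedSolutions L k m (bilaplacianOp n) (bdry n y) ξ) (boundaryData k m B)) :
    IsRegularElliptic g P k m (bilaplacianOp n) B :=
  ⟨fun j => (hord j).trans_lt (Nat.lt_succ_of_le (modelOrder_le_three j)), fun _ he _ hx ξ =>
    LocalData.isLinearIso_principalSymbol_iff (localData_isRegularAt g P he hx) hk hm ξ,
    fun _ he y hy ξ hξ hξ0 => hB _ y ξ (localData_isRegularAt g P he hy) hξ hξ0⟩

end Assembly

end DoubleForms

end

theorem mainTheorem1 (n : ℕ) (M : Type*) [TopologicalSpace M] [T2Space M] [CompactSpace M]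
    [ChartedSpace (EuclideanHalfSpace (n + 1)) M] [IsManifold (𝓡∂ (n + 1)) ∞ M]
    (g : DoubleForms.Metric n M) (P : DoubleForms.TensorialOperators g)
    (k m : ℕ) (hk : k ≤ n + 1) (hm : m ≤ n + 1) :
    DoubleForms.IsRegularElliptic g P k m (DoubleForms.bilaplacianOp n)
        (DoubleForms.boundaryTT n) ∧
      DoubleForms.IsRegularElliptic g P k m (DoubleForms.bilaplacianOp n)
        (DoubleForms.boundaryNN n) ∧
      DoubleForms.IsRegularElliptic g P k m (DoubleForms.bilaplacianOp n)
        (DoubleForms.boundaryNT n) ∧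
      DoubleForms.IsRegularElliptic g P k m (DoubleForms.bilaplacianOp n)
        (DoubleForms.boundaryTN n) := by
  refine ⟨DoubleForms.isRegularElliptic_bilaplacian g P hk hm ?_ fun L y ξ hL hξ hξ0 =>
      DoubleForms.LocalData.lopatinskij_TT hL hξ hξ0 k m,
    DoubleForms.isRegularElliptic_bilaplacian g P hk hm ?_ fun L y ξ hL hξ hξ0 =>
      DoubleForms.LocalData.lopatinskij_NN hL hξ hξ0 k m,
    DoubleForms.isRegularElliptic_bilaplacian g P hk hm ?_ fun L y ξ hL hξ hξ0 =>
      DoubleForms.LocalData.lopatinskij_NT hL hξ hξ0 k m,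
    DoubleForms.isRegularElliptic_bilaplacian g P hk hm ?_ fun L y ξ hL hξ hξ0 =>
      DoubleForms.LocalData.lopatinskij_TN hL hξ hξ0 k m⟩ <;>
  · intro j
    fin_cases j <;> rfl
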